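/- Let $\mathbf F/\mathbb F_q$ be an algebraic function field of one variable over the finite field $\mathbb F_q$ (a finite extension of $\mathbb F_q(x)$ for some $x \in \mathbf F$ transcendental over $\mathbb F_q$), with full constant field $\mathbb F_q$, and let $g \ge 0$ be its genus. For a divisor $D$ let $\dim(D)$ be the dimension over $\mathbb F_q$ of the Riemann--Roch space $\mathcal L(D)=\{x\in \mathbf F^{*} : (x)\ge -D\}\cup\{0\}$. A divisor $D$ is called non-special if $\dim(\kappa-D)=0$, where $\kappa$ is a canonical divisor of $\mathbf F/\mathbb F_q$. Let $h$ be the class number of $\mathbf F/\mathbb F_q$, that is, the order of the (finite) group of classes of divisors of degree $0$ modulo principal divisors, and for $n\in\mathbb Z$ let $A_n$ be the number of effective divisors of degree $n$ (so $A_n=0$ for $n<0$). Consider the assertions - $\mathcal E_g$: $\mathbf F/\mathbb F_q$ has an effective non-special divisor of degree $g$; - $\mathcal E_{g-1}$: $\mathbf F/\mathbb F_q$ has a non-special divisor of degree $g-1$. Then: 1. If $A_g < h(q+1)$, then $\mathcal E_g$ is true. 2. If $A_{g-1} < h$, then $\mathcal E_{g-1}$ is true. 3. Assume $g\ge 2$.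 If $A_{g-2} < h$, then $\mathcal E_g$ is true. 4. If $g = 2$ or $g = 3$, then $\mathcal E_g$ is untrue if and only if $A_{g-2} = h$. -/

import Mathlib

open scoped WithZero

noncomputable section

namespace AlgFunctionField

/-- `F / K` is an algebraic function field of one variable: `F` is a finite extension of `K(x)`
for some `x ∈ F` that is transcendental over `K`. -/
class IsFunctionField (K F : Type*) [Field K] [Field F] [Algebra K F] : Prop where
  exists_transcendental : ∃ x : F, Transcendental K x ∧
    FiniteDimensional (IntermediateField.adjoin K {x}) F

/-- A place of `F / K`, given by its valuation ring `O`, with `K ⊆ O ⊊ F` and `z ∈ O` or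
`z⁻¹ ∈ O` for all `z ∈ F`. -/
@[ext]
structure Place (K F : Type*) [Field K] [Field F] [Algebra K F] where
  ring : ValuationSubring F
  algebraMap_mem : ∀ c : K, algebraMap K F c ∈ ring
  ne_top : ring ≠ ⊤

section Places

variable {K F : Type*} [Field K] [Field F] [Algebra K F]

instance (P : Place K F) : Algebra K P.ring :=
  ((algebraMap K F).codRestrict P.ring.toSubring P.algebraMap_mem).toAlgebra

instance (P : Place K F) : IsScalarTower K P.ring F :=
  IsScalarTower.of_algebraMap_eq fun _ => rfl

open scoped IntermediateField.algebraAdjoinAdjoin in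
theorem IsFunctionField.finiteDimensional_adjoin [IsFunctionField K F] {y : F}
    (hy : Transcendental K y) : FiniteDimensional (IntermediateField.adjoin K {y}) F := by
  obtain ⟨x, hx, hfin⟩ := IsFunctionField.exists_transcendental (K := K) (F := F)
  have h1 : Algebra.IsAlgebraic (Algebra.adjoin K {x}) F := by
    have : Algebra.IsAlgebraic (IntermediateField.adjoin K {x}) F := inferInstance
    exact (IsFractionRing.comap_isAlgebraic_iff
      (A := Algebra.adjoin K {x}) (K := IntermediateField.adjoin K {x}) (C := F)).2 this
  have h2 : Algebra.trdeg K F ≤ 1 := by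
    simpa using Algebra.IsAlgebraic.trdeg_le_cardinalMk K ({x} : Set F)
  have h3 : AlgebraicIndependent K (fun _ : Unit => y) := by
    rw [algebraicIndependent_unique_type_iff]; exact hy
  have h4 : IsTranscendenceBasis K (fun _ : Unit => y) :=
    h3.isTranscendenceBasis_of_lift_trdeg_le_of_finite (by simpa using h2)
  have h5 := h4.isAlgebraic
  rw [Set.range_const] at h5
  have h6 : Algebra.IsAlgebraic (IntermediateField.adjoin K {y}) F :=
    (IsFractionRing.comap_isAlgebraic_iff
      (A := Algebra.adjoin K {y}) (K := IntermediateField.adjoin K {y}) (C := F)).1 h5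
  have h7 : Algebra.EssFiniteType K (IntermediateField.adjoin K {x}) :=
    IntermediateField.essFiniteType_iff.2 (IntermediateField.fg_adjoin_of_finite (Set.finite_singleton x))
  have h8 : Algebra.EssFiniteType K F := Algebra.EssFiniteType.comp K (IntermediateField.adjoin K {x}) F
  have h9 : Algebra.EssFiniteType (IntermediateField.adjoin K {y}) F :=
    Algebra.EssFiniteType.of_comp K _ _
  obtain ⟨s, hs⟩ := IntermediateField.fg_top (IntermediateField.adjoin K {y}) F
  have := IntermediateField.finiteDimensional_adjoin (K := IntermediateField.adjoin K {y})
    (L := F) (S := (s : Set F)) (fun x _ => (h6.isAlgebraic x).isIntegral)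
  rw [hs] at this
  exact Module.Finite.equiv (IntermediateField.topEquiv (F := IntermediateField.adjoin K {y}) (E := F)).toLinearEquiv

theorem Place.transcendental_of_not_isUnit (P : Place K F) {y : P.ring} (hy0 : y ≠ 0)
    (hy : ¬ IsUnit y) : Transcendental K (y : F) := by
  intro h
  apply hy
  have h1 : IsIntegral K ((y : F)⁻¹) := h.inv.isIntegral
  have h2 : IsIntegral P.ring ((y : F)⁻¹) := h1.tower_top
  obtain ⟨z, hz⟩ := IsIntegrallyClosed.isIntegral_iff.1 h2
  refine IsUnit.of_mul_eq_one z (Subtype.ext ?_)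
  have hz' : (z : F) = (y : F)⁻¹ := hz
  have : (y : F) ≠ 0 := fun h => hy0 (Subtype.ext h)
  push_cast
  rw [hz', mul_inv_cancel₀ this]

open scoped IntermediateField.algebraAdjoinAdjoin in
theorem Place.finite_quotient [IsFunctionField K F] (P : Place K F) {y : P.ring} (hy0 : y ≠ 0)
    (hy : ¬ IsUnit y) : Module.Finite K (P.ring ⧸ Ideal.span {y}) := by
  have := IsFunctionField.finiteDimensional_adjoin (P.transcendental_of_not_isUnit hy0 hy)
  have hyF : (y : F) ≠ 0 := fun h => hy0 (Subtype.ext h)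
  let R := Algebra.adjoin K {(y : F)}
  have hRO : ∀ r : R, (r : F) ∈ P.ring := by
    intro r
    refine Algebra.adjoin_induction (p := fun z _ => z ∈ P.ring) ?_ P.algebraMap_mem
      (fun _ _ _ _ => P.ring.add_mem _ _) (fun _ _ _ _ => P.ring.mul_mem _ _) r.2
    rintro z rfl
    exact y.2
  let yR : R := ⟨y, Algebra.self_mem_adjoin_singleton K _⟩
  have hyR0 : yR ≠ 0 := fun h => hyF (congrArg Subtype.val h)
  have hyR : ¬ IsUnit yR := by
    rintro ⟨u, hu⟩
    apply hy
    refine IsUnit.of_mul_eq_one ⟨_, hRO (u⁻¹ : Rˣ)⟩ (Subtype.ext ?_)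
    have : (u : R) * (u⁻¹ : Rˣ) = 1 := u.mul_inv
    rw [hu] at this
    exact congrArg (fun z : R => (z : F)) this
  have hsplit : ∀ r : R, ∃ (c : K) (s : R), r = algebraMap K R c + yR * s := by
    rintro ⟨r, hr⟩
    have : ∃ (c : K) (s : R), r = algebraMap K F c + y * s := by
      have hr' : r ∈ Algebra.adjoin K {(y : F)} := hr
      rw [Algebra.adjoin_singleton_eq_range_aeval] at hr'
      obtain ⟨p, hp⟩ := hr'
      have hp' : Polynomial.aeval (y : F) p = r := hp
      refine ⟨p.coeff 0, ⟨Polynomial.aeval (y : F) p.divX,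
        Polynomial.aeval_mem_adjoin_singleton _ _⟩, ?_⟩
      rw [← hp']
      conv_lhs => rw [← Polynomial.divX_mul_X_add p]
      rw [map_add, map_mul, Polynomial.aeval_X, Polynomial.aeval_C, add_comm, mul_comm]
    obtain ⟨c, s, h⟩ := this
    exact ⟨c, s, Subtype.ext h⟩
  have hnoeth : IsNoetherianRing R := by
    have : Algebra.FiniteType K R :=
      (Subalgebra.fg_iff_finiteType _).1 ⟨{(y : F)}, by simp [R]⟩
    exact Algebra.FiniteType.isNoetherianRing K R
  let b := Module.Basis.ofVectorSpace K (P.ring ⧸ Ideal.span {y})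
  choose a ha using fun i => Ideal.Quotient.mk_surjective (b i)
  have hdvd : ∀ n : ℕ, ∀ (s : Finset _) (r : _ → R), ∑ i ∈ s, r i • (a i : F) = 0 →
      ∀ i ∈ s, yR ^ n ∣ r i := by
    intro n
    induction n with
    | zero => simp
    | succ n ih =>
      intro s r hr i hi
      choose c t hct using fun i => hsplit (r i)
      have hc : ∀ i ∈ s, c i = 0 := by
        have hsum : ∑ i ∈ s, c i • b i = 0 := by
          have e : (∑ i ∈ s, c i • a i) + y * ∑ i ∈ s, (⟨t i, hRO _⟩ : P.ring) * a i = 0 := by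
            apply Subtype.ext
            have := hr
            push_cast
            rw [← this, Finset.mul_sum, ← Finset.sum_add_distrib]
            refine Finset.sum_congr rfl fun i _ => ?_
            rw [hct i, Algebra.smul_def, Algebra.smul_def, map_add, map_mul, add_mul, mul_assoc]
            rfl
          have e2 := congrArg (Ideal.Quotient.mk (Ideal.span {y})) e
          rw [map_add, map_mul, Ideal.Quotient.eq_zero_iff_mem.2 (Ideal.mem_span_singleton_self y),
            zero_mul, add_zero, map_zero, map_sum] at e2
          rw [← e2]
          refine Finset.sum_congr rfl fun i _ => ?_
          rw [← ha i]
          rfl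
        exact linearIndependent_iff'.1 b.linearIndependent s c hsum
      have ht : ∑ i ∈ s, t i • (a i : F) = 0 := by
        have e : (y : F) * ∑ i ∈ s, t i • (a i : F) = 0 := by
          rw [← hr, Finset.mul_sum]
          refine Finset.sum_congr rfl fun i hi => ?_
          rw [hct i, hc i hi, map_zero, zero_add, mul_smul]
          rfl
        exact (mul_eq_zero.1 e).resolve_left hyF
      rw [hct i, hc i hi, map_zero, zero_add, pow_succ']
      exact mul_dvd_mul_left _ (ih s t ht i hi)
  have hli : LinearIndependent R (fun i => (a i : F)) := by
    rw [linearIndependent_iff']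
    intro s r hr i hi
    by_contra hne
    obtain ⟨n, hn⟩ := FiniteMultiplicity.of_not_isUnit hyR hne
    exact hn (hdvd _ s r hr i hi)
  have hli2 : LinearIndependent (IntermediateField.adjoin K {(y : F)}) (fun i => (a i : F)) :=
    (LinearIndependent.iff_fractionRing R _).1 hli
  have := hli2.finite
  exact Module.Finite.of_basis b

/-- The valuation ring of a place is a discrete valuation ring. -/
instance Place.isDiscreteValuationRing [IsFunctionField K F] (P : Place K F) :
    IsDiscreteValuationRing P.ring := by
  have hN : IsNoetherianRing P.ring := by
    refine ⟨fun I => ?_⟩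
    by_cases hI : I = ⊤
    · subst hI
      exact ⟨{1}, by simp [Ideal.submodule_span_eq]⟩
    by_cases hI0 : I = ⊥
    · subst hI0
      exact Submodule.fg_bot
    obtain ⟨y, hyI, hy0⟩ := Submodule.exists_mem_ne_zero_of_ne_bot hI0
    have hy : ¬ IsUnit y := fun h => hI (Ideal.eq_top_of_isUnit_mem _ hyI h)
    have := P.finite_quotient hy0 hy
    have : Module.Finite P.ring (P.ring ⧸ Ideal.span {y}) := Module.Finite.of_restrictScalars_finite K _ _
    have : IsNoetherian K (P.ring ⧸ Ideal.span {y}) := inferInstance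
    have : IsNoetherian P.ring (P.ring ⧸ Ideal.span {y}) := isNoetherian_of_tower K this
    refine Submodule.fg_of_fg_map_of_fg_inf_ker (Submodule.mkQ (Ideal.span {y}))
      (IsNoetherian.noetherian _) ?_
    rw [Submodule.ker_mkQ, inf_eq_right.2 ((Ideal.span_singleton_le_iff_mem I).2 hyI)]
    exact ⟨{y}, by simp [Ideal.submodule_span_eq]⟩
  have hP : IsPrincipalIdealRing P.ring := inferInstance
  refine { hP with not_a_field' := fun h => P.ne_top ?_ }
  rw [eq_top_iff]
  intro x _
  rcases P.ring.mem_or_inv_mem x with hx | hx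
  · exact hx
  by_cases hx0 : x = 0
  · subst hx0; exact P.ring.zero_mem
  have hu : IsUnit (⟨x⁻¹, hx⟩ : P.ring) := by
    by_contra hu
    have h1 := (IsLocalRing.mem_maximalIdeal _).2 hu
    rw [h] at h1
    exact inv_ne_zero hx0 (congrArg Subtype.val ((Submodule.mem_bot _).1 h1))
  obtain ⟨z, hz⟩ := hu.exists_right_inv
  have hz' : x⁻¹ * (z : F) = 1 := congrArg Subtype.val hz
  have : (z : F) = x := by field_simp at hz'; exact hz'
  rw [← this]
  exact z.2

/-- The degree of a place: the degree over `K` of its residue field. -/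
def Place.degree (P : Place K F) : ℕ :=
  Module.finrank K (IsLocalRing.ResidueField P.ring)

/-- The normalized discrete valuation of a place, written multiplicatively: it takes the value
`exp (-n)` at `x` if `x` has order `n` at `P`, and the value `0` at `0`. -/
def Place.valuation [IsFunctionField K F] (P : Place K F) : Valuation F ℤᵐ⁰ :=
  (IsDiscreteValuationRing.maximalIdeal P.ring).valuation F

theorem Place.valuation_algebraMap_le_one [IsFunctionField K F] (P : Place K F) (c : K) :
    P.valuation (algebraMap K F c) ≤ 1 :=
  (IsDiscreteValuationRing.maximalIdeal P.ring).valuation_le_one (algebraMap K P.ring c)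

/-- The order `v_P(x)` of a nonzero `x` at the place `P`. -/
def Place.ord [IsFunctionField K F] (P : Place K F) (x : F) : ℤ :=
  -WithZero.log (P.valuation x)

end Places

section Divisors

/-- Divisors are finitely supported integer-valued functions on the set of places; they carry the
pointwise order, so a divisor `D` is effective if `0 ≤ D`. -/
abbrev Divisor (K F : Type*) [Field K] [Field F] [Algebra K F] : Type _ :=
  Place K F →₀ ℤ

/-- The degree `∑ n_P deg P` of a divisor `∑ n_P P`. -/
def degree (K F : Type*) [Field K] [Field F] [Algebra K F] : Divisor K F →+ ℤ :=
  Finsupp.liftAddHom fun P => AddMonoidHom.mulRight (P.degree : ℤ)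

/-- The number `A_n` of effective divisors of degree `n`. -/
def numEffective (K F : Type*) [Field K] [Field F] [Algebra K F] (n : ℤ) : ℕ :=
  Nat.card {D : Divisor K F // 0 ≤ D ∧ degree K F D = n}

/-- The group of principal divisors `(x) = ∑ v_P(x) P`, for `x ∈ F` nonzero. -/
def principalDivisors (K F : Type*) [Field K] [Field F] [Algebra K F] [IsFunctionField K F] :
    AddSubgroup (Divisor K F) where
  carrier := {D | ∃ x : F, x ≠ 0 ∧ ∀ P : Place K F, D P = P.ord x}
  zero_mem' := ⟨1, one_ne_zero, fun P => by simp [Place.ord]⟩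
  add_mem' := by
    rintro D E ⟨x, hx, hD⟩ ⟨y, hy, hE⟩
    refine ⟨x * y, mul_ne_zero hx hy, fun P => ?_⟩
    rw [Finsupp.add_apply, hD, hE, Place.ord, Place.ord, Place.ord, map_mul,
      WithZero.log_mul ((Valuation.ne_zero_iff _).2 hx) ((Valuation.ne_zero_iff _).2 hy)]
    ring
  neg_mem' := by
    rintro D ⟨x, hx, hD⟩
    refine ⟨x⁻¹, inv_ne_zero hx, fun P => ?_⟩
    rw [Finsupp.neg_apply, hD, Place.ord, Place.ord, map_inv₀, WithZero.log_inv]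

/-- The divisor class group. -/
abbrev DivisorClassGroup (K F : Type*) [Field K] [Field F] [Algebra K F] [IsFunctionField K F] :
    Type _ :=
  Divisor K F ⧸ principalDivisors K F

/-- The subgroup of the classes of divisors of degree zero. -/
def classGroupZero (K F : Type*) [Field K] [Field F] [Algebra K F] [IsFunctionField K F] :
    AddSubgroup (DivisorClassGroup K F) :=
  (degree K F).ker.map (QuotientAddGroup.mk' (principalDivisors K F))

/-- The class number `h`: the order of the group of divisor classes of degree zero. -/
def classNumber (K F : Type*) [Field K] [Field F] [Algebra K F] [IsFunctionField K F] : ℕ :=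
  Nat.card (classGroupZero K F)

end Divisors

section RiemannRoch

variable {K F : Type*} [Field K] [Field F] [Algebra K F] [IsFunctionField K F]

/-- The Riemann-Roch space `L(D) = {x ∈ F : x = 0 or (x) ≥ -D}`: in terms of the multiplicative
valuations, `v_P(x) ≥ -n` (or `x = 0`) says that the value of `x` is at most `exp n`. -/
def riemannRochSpace (D : Divisor K F) : Submodule K F where
  carrier := {x | ∀ P : Place K F, P.valuation x ≤ WithZero.exp (D P)}
  zero_mem' := fun P => by simp
  add_mem' := fun {x y} hx hy P => (P.valuation.map_add x y).trans (max_le (hx P) (hy P))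
  smul_mem' := fun c x hx P => by
    rw [Algebra.smul_def, map_mul]
    exact (mul_le_of_le_one_left' (P.valuation_algebraMap_le_one c)).trans (hx P)

/-- The dimension `dim D` of the Riemann-Roch space of `D`. -/
def dim (D : Divisor K F) : ℕ :=
  Module.finrank K (riemannRochSpace D)

/-- The genus: the maximum of `deg D - dim D + 1` over all divisors `D`. -/
def genus (K F : Type*) [Field K] [Field F] [Algebra K F] [IsFunctionField K F] : ℤ :=
  ⨆ D : Divisor K F, (degree K F D - dim D + 1)

/-- The adele space (repartitions): families `(α_P)` of elements of `F` with `α_P ∈ O_P` for all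
but finitely many places `P`. -/
def adeles (K F : Type*) [Field K] [Field F] [Algebra K F] : Submodule K (Place K F → F) where
  carrier := {α | {P : Place K F | α P ∉ P.ring}.Finite}
  zero_mem' := by simp
  add_mem' := fun {α β} hα hβ => (hα.union hβ).subset fun P hP => by
    by_contra h
    simp only [Set.mem_union, Set.mem_ofPred_eq, not_or, not_not] at h
    exact hP (P.ring.add_mem _ _ h.1 h.2)
  smul_mem' := fun c α hα => Set.Finite.subset hα fun P hP h => hP <| by
    rw [Pi.smul_apply, Algebra.smul_def]
    exact P.ring.mul_mem _ _ (P.algebraMap_mem c) h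

/-- The `K`-linear form `ω` on the adeles vanishes on `A_F(D)`, the set of the adeles `α` with
`v_P(α_P) ≥ -D(P)` for all places `P`. -/
def VanishesOn (ω : adeles K F →ₗ[K] K) (D : Divisor K F) : Prop :=
  ∀ α : adeles K F, (∀ P : Place K F, P.valuation (α.1 P) ≤ WithZero.exp (D P)) → ω α = 0

/-- A Weil differential: a `K`-linear form on the adeles that vanishes on the principal (that is,
constant) adeles and on `A_F(D)` for some divisor `D`. -/
def IsWeilDifferential (ω : adeles K F →ₗ[K] K) : Prop :=
  (∀ (x : F) (α : adeles K F), (∀ P, α.1 P = x) → ω α = 0) ∧ ∃ D : Divisor K F, VanishesOn ω D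

/-- A canonical divisor: the divisor of a nonzero Weil differential `ω`, that is, the largest
divisor `W` such that `ω` vanishes on `A_F(W)`. -/
def IsCanonical (W : Divisor K F) : Prop :=
  ∃ ω : adeles K F →ₗ[K] K, IsWeilDifferential ω ∧ ω ≠ 0 ∧ IsGreatest {D | VanishesOn ω D} W

/-- `D` is non-special: its index of speciality `dim (W - D)`, for `W` a canonical divisor,
is zero. -/
def IsNonSpecial (D : Divisor K F) : Prop :=
  ∃ W : Divisor K F, IsCanonical W ∧ dim (W - D) = 0

end RiemannRoch

end AlgFunctionField

end

/-! The proof rests on Riemann–Roch, on the exact number of divisor classes in each degree, and on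
the count of effective divisors in a single class.

Write `i(D)` for `index D`, the dimension of the adeles modulo `A(D) + F`. An induction adding one
place at a time gives `dim D = deg D + 1 - g + i(D)` (`dim_eq_add_index`). Since Weil differentials
form a line over `F`, `i(D) = dim (W - D)` for every canonical `W` (`index_eq_dim_sub`), so
non-special means `i(D) = 0`.

By F. K. Schmidt's theorem (`exists_degree_eq_one`) every integer is the degree of a divisor, hence
each degree has exactly `h` classes. As `K` is the full constant field, effective divisors in the
class of `D` are the lines of `L(D)`, and there are `(q ^ dim D - 1) / (q - 1)` of them.

If no class of degree `g` contains an effective non-special divisor, each has dimension at least `2`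
and so at least `q + 1` effective divisors, whence `A_g ≥ h (q + 1)`. If `A_n < h`, some class of
degree `n` has dimension `0`; for `n = g - 1` it is non-special by Riemann–Roch, and for `n = g - 2`
its residual class `W - D` has degree `g`, index `0` and dimension `1`, so it contains an effective
non-special divisor. This passage to the residual class is an equivalence. For `g = 2, 3` the degree
`g - 2` is `0` or `1` and `g > 0`, so a class contains at most one effective divisor; then `A_{g-2}
= h` exactly when every class of that degree is effective.

Schmidt's theorem is proved without zeta functions: if all degrees were divisible by some `d ≥ 2`,
every place would acquire two places above it of the same degree in a constant field extension,
which would then have too many effective divisors. -/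

noncomputable section

namespace AlgFunctionField

/-! ### Places, their valuations and leading coefficients -/

section PlaceBasics

variable {K F : Type*} [Field K] [Field F] [Algebra K F] [IsFunctionField K F]

theorem Place.valuation_le_one_iff (P : Place K F) (x : F) : P.valuation x ≤ 1 ↔ x ∈ P.ring := by
  refine ⟨fun h => ?_, fun h =>
    (IsDiscreteValuationRing.maximalIdeal P.ring).valuation_le_one (⟨x, h⟩ : P.ring)⟩
  obtain ⟨a, ha⟩ := IsDiscreteValuationRing.exists_lift_of_le_one h
  exact ha ▸ a.2

theorem Place.valuation_lt_one_iff (P : Place K F) (x : P.ring) :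
    P.valuation (x : F) < 1 ↔ x ∈ IsLocalRing.maximalIdeal P.ring :=
  (IsDiscreteValuationRing.maximalIdeal P.ring).valuation_lt_one_iff_mem (K := F) x

theorem Place.exists_valuation_eq (P : Place K F) (n : ℤ) :
    ∃ x : F, P.valuation x = WithZero.exp n :=
  (IsDiscreteValuationRing.maximalIdeal P.ring).valuation_surjective F _

theorem Place.valuation_eq_exp (P : Place K F) {x : F} (hx : x ≠ 0) :
    P.valuation x = WithZero.exp (-P.ord x) := by
  rw [Place.ord, neg_neg, WithZero.exp_log ((Valuation.ne_zero_iff _).2 hx)]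

theorem Place.valuation_le_exp_iff (P : Place K F) {x : F} (hx : x ≠ 0) (n : ℤ) :
    P.valuation x ≤ WithZero.exp n ↔ 0 ≤ P.ord x + n := by
  rw [P.valuation_eq_exp hx, WithZero.exp_le_exp]
  constructor <;> intro h <;> linarith

theorem exp_lt_iff_le_sub_one {x : ℤᵐ⁰} {n : ℤ} :
    x < WithZero.exp n ↔ x ≤ WithZero.exp (n - 1) := by
  rcases eq_or_ne x 0 with rfl | hx
  · simp
  · rw [← WithZero.exp_log hx, WithZero.exp_lt_exp, WithZero.exp_le_exp, Int.le_sub_one_iff]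

theorem Place.finite_residueField (P : Place K F) :
    Module.Finite K (IsLocalRing.ResidueField P.ring) := by
  obtain ⟨π, hπ⟩ := IsDiscreteValuationRing.exists_irreducible P.ring
  have := P.finite_quotient hπ.ne_zero hπ.not_isUnit
  have h := (IsDiscreteValuationRing.irreducible_iff_uniformizer π).1 hπ
  rw [← h] at this
  exact this

theorem Place.degree_pos (P : Place K F) : 0 < P.degree := by
  have := P.finite_residueField
  exact Module.finrank_pos

/-- The elements of `F` of valuation at most `exp n` at the place `P`. -/
def Place.ball (P : Place K F) (n : ℤ) : Submodule K F where
  carrier := {x | P.valuation x ≤ WithZero.exp n}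
  zero_mem' := by simp
  add_mem' := fun {x y} hx hy => (P.valuation.map_add x y).trans (max_le hx hy)
  smul_mem' := fun c x hx => by
    change P.valuation (c • x) ≤ _
    rw [Algebra.smul_def, map_mul]
    exact (mul_le_of_le_one_left' (P.valuation_algebraMap_le_one c)).trans hx

theorem Place.mem_ball {P : Place K F} {n : ℤ} {x : F} :
    x ∈ P.ball n ↔ P.valuation x ≤ WithZero.exp n := Iff.rfl

theorem Place.mul_mem_ring_of_mem_ball {P : Place K F} {n : ℤ} {t x : F}
    (ht : P.valuation t = WithZero.exp (-n)) (hx : x ∈ P.ball n) : t * x ∈ P.ring := by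
  rw [← P.valuation_le_one_iff, map_mul, ht]
  calc _ ≤ WithZero.exp (-n) * WithZero.exp n := mul_le_mul_right (P.mem_ball.1 hx) _
    _ = 1 := by rw [← WithZero.exp_add]; simp

/-- The leading coefficient of an element of `P.ball n`, an element of the residue field. -/
def Place.leading (P : Place K F) (n : ℤ) : P.ball n →ₗ[K] IsLocalRing.ResidueField P.ring where
  toFun x := IsLocalRing.residue P.ring ⟨(P.exists_valuation_eq (-n)).choose * x,
    P.mul_mem_ring_of_mem_ball (P.exists_valuation_eq (-n)).choose_spec x.2⟩
  map_add' x y := by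
    rw [← map_add]
    congr 1
    exact Subtype.ext (mul_add _ _ _)
  map_smul' c x := by
    rw [RingHom.id_apply, Algebra.smul_def, IsScalarTower.algebraMap_apply K P.ring,
      IsLocalRing.ResidueField.algebraMap_eq, ← map_mul]
    congr 1
    refine Subtype.ext ?_
    change _ * (c • (x : F)) = algebraMap K F c * (_ * (x : F))
    rw [Algebra.smul_def]
    ring

theorem Place.leading_eq_zero_iff (P : Place K F) (n : ℤ) (x : P.ball n) :
    P.leading n x = 0 ↔ P.valuation (x : F) ≤ WithZero.exp (n - 1) := by
  set t := (P.exists_valuation_eq (-n)).choose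
  have hv : P.valuation t = WithZero.exp (-n) := (P.exists_valuation_eq (-n)).choose_spec
  change IsLocalRing.residue P.ring ⟨t * x, _⟩ = 0 ↔ _
  rw [IsLocalRing.residue_eq_zero_iff, ← P.valuation_lt_one_iff, ← exp_lt_iff_le_sub_one]
  simp only [map_mul, hv, WithZero.exp_neg]
  rw [inv_mul_lt_iff₀ WithZero.exp_pos, mul_one]

theorem Place.leading_surjective (P : Place K F) (n : ℤ) :
    Function.Surjective (P.leading n) := by
  intro y
  obtain ⟨⟨y, hy⟩, rfl⟩ := IsLocalRing.residue_surjective y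
  set t := (P.exists_valuation_eq (-n)).choose
  have hv : P.valuation t = WithZero.exp (-n) := (P.exists_valuation_eq (-n)).choose_spec
  have ht0 : t ≠ 0 := (Valuation.ne_zero_iff P.valuation).1 (by rw [hv]; simp)
  refine ⟨⟨t⁻¹ * y, ?_⟩, ?_⟩
  · rw [Place.mem_ball, map_mul, map_inv₀, hv, WithZero.exp_neg, inv_inv]
    exact mul_le_of_le_one_right' ((P.valuation_le_one_iff y).2 hy)
  · change IsLocalRing.residue P.ring ⟨t * (t⁻¹ * y), _⟩ = _
    congr 1
    exact Subtype.ext (mul_inv_cancel_left₀ ht0 y)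

theorem Place.valuation_algebraic (P : Place K F) {x : F} (hx : x ≠ 0) (h : IsAlgebraic K x) :
    P.valuation x = 1 := by
  have key : ∀ y : F, IsAlgebraic K y → P.valuation y ≤ 1 := fun y hy => by
    rw [P.valuation_le_one_iff]
    obtain ⟨z, hz⟩ := IsIntegrallyClosed.isIntegral_iff.1 (hy.isIntegral.tower_top (A := P.ring))
    exact hz ▸ z.2
  refine le_antisymm (key x h) ?_
  have := key _ h.inv
  rwa [map_inv₀, inv_le_one₀ (zero_lt_iff.2 ((Valuation.ne_zero_iff _).2 hx))] at this

/-- Every transcendental element has a zero. -/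
theorem exists_valuation_lt_one {x : F} (hx : Transcendental K x) :
    ∃ P : Place K F, P.valuation x < 1 := by
  let R := Algebra.adjoin K {x}
  let xR : R := ⟨x, Algebra.self_mem_adjoin_singleton K x⟩
  have hI : Ideal.span {xR} ≠ ⊤ := by
    rw [Ne, Ideal.span_singleton_eq_top]
    intro h
    obtain ⟨⟨y, hy⟩, hxy⟩ := h.exists_right_inv
    have hy' : y ∈ Algebra.adjoin K {x} := hy
    rw [Algebra.adjoin_singleton_eq_range_aeval] at hy'
    obtain ⟨p, hp⟩ := hy'
    have hp' : Polynomial.aeval x p = y := hp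
    have h1 : x * y = 1 := congrArg Subtype.val hxy
    have h2 : Polynomial.aeval x (Polynomial.X * p - 1) = 0 := by
      rw [map_sub, map_mul, Polynomial.aeval_X, hp', h1, map_one, sub_self]
    have h3 := (transcendental_iff.1 hx) _ h2
    have := congrArg (Polynomial.eval 0) h3
    simp at this
  -- Chevalley's extension theorem: some valuation ring contains `K[x]` and has the proper ideal
  -- `(x)` among its nonunits. The nonzero nonunit `x` also keeps it from being all of `F`.
  obtain ⟨V, hRV, hV⟩ := Ideal.image_subset_nonunits_valuationSubring (A := R.toSubring)
    (Ideal.span {xR}) hI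
  have hx0 : x ≠ 0 := fun h => hx (h ▸ isAlgebraic_zero)
  have hxn : x ∈ V.nonunits := hV ⟨xR, Ideal.mem_span_singleton_self xR, rfl⟩
  let P : Place K F := ⟨V, fun c => hRV (R.algebraMap_mem c), fun h => by
    subst h
    rw [ValuationSubring.mem_nonunits_iff] at hxn
    have : (⊤ : ValuationSubring F).valuation x⁻¹ ≤ 1 :=
      ((⊤ : ValuationSubring F).valuation_le_one_iff _).2 trivial
    rw [map_inv₀, inv_le_one₀ (zero_lt_iff.2 ((Valuation.ne_zero_iff _).2 hx0))] at this
    exact this.not_gt hxn⟩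
  refine ⟨P, lt_of_not_ge fun h => ?_⟩
  have h1 : x⁻¹ ∈ P.ring := by
    rw [← P.valuation_le_one_iff, map_inv₀]
    exact inv_le_one_of_one_le₀ h
  have h2 : V.valuation x⁻¹ ≤ 1 := (V.valuation_le_one_iff _).2 h1
  rw [map_inv₀, inv_le_one₀ (zero_lt_iff.2 ((Valuation.ne_zero_iff _).2 hx0))] at h2
  exact h2.not_gt (V.mem_nonunits_iff.1 hxn)

/-- A discrete valuation ring is a maximal proper subring of its field: if `x` has a pole at `P`,
every `y` is `(y / x ^ n) * x ^ n` with `y / x ^ n` integral at `P` for large `n`, so a ring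
containing `P.ring` and `x` is everything. -/
theorem Place.eq_of_ring_le {P Q : Place K F} (h : P.ring ≤ Q.ring) : P = Q := by
  refine Place.ext (le_antisymm h fun x hx => ?_)
  by_contra hxP
  have hxP' : 1 < P.valuation x := not_le.1 fun h' => hxP ((P.valuation_le_one_iff x).1 h')
  apply Q.ne_top
  rw [eq_top_iff]
  intro y _
  rcases eq_or_ne y 0 with rfl | hy
  · exact Q.ring.zero_mem
  have hx0 : x ≠ 0 := fun h0 => by simp [h0] at hxP'
  obtain ⟨n, hn⟩ : ∃ n : ℕ, P.valuation y ≤ P.valuation x ^ n := by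
    rw [P.valuation_eq_exp hx0, ← WithZero.exp_zero, WithZero.exp_lt_exp] at hxP'
    rw [P.valuation_eq_exp hx0, P.valuation_eq_exp hy]
    refine ⟨(P.ord y).natAbs, ?_⟩
    rw [← WithZero.exp_nsmul, WithZero.exp_le_exp, nsmul_eq_mul]
    have : -P.ord y ≤ ((P.ord y).natAbs : ℤ) := by omega
    nlinarith [Int.natCast_nonneg (P.ord y).natAbs]
  have hyx : y / x ^ n ∈ P.ring := by
    rw [← P.valuation_le_one_iff, map_div₀, map_pow]
    exact div_le_one_of_le₀ hn zero_le
  have := Q.ring.mul_mem _ _ (h hyx) (pow_mem hx n)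
  rwa [div_mul_cancel₀ _ (pow_ne_zero n hx0)] at this

end PlaceBasics

/-! ### Degrees of divisors and induction over places -/

section DivisorDegree

variable {K F : Type*} [Field K] [Field F] [Algebra K F]

theorem degree_single (P : Place K F) (n : ℤ) :
    degree K F (Finsupp.single P n) = n * P.degree := by
  simp [degree]

theorem degree_nonneg {D : Divisor K F} (hD : 0 ≤ D) : 0 ≤ degree K F D := by
  rw [degree, Finsupp.liftAddHom_apply]
  exact Finset.sum_nonneg fun P _ => mul_nonneg (hD P) (Int.natCast_nonneg _)

theorem degree_mono {A B : Divisor K F} (h : A ≤ B) : degree K F A ≤ degree K F B := by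
  have := degree_nonneg (sub_nonneg.2 h)
  rw [map_sub] at this
  linarith

theorem exists_single_add_le {A B : Divisor K F} (h : A ≤ B) (hne : A ≠ B) :
    ∃ P : Place K F, A + Finsupp.single P 1 ≤ B := by
  classical
  obtain ⟨P, hP⟩ := DFunLike.ne_iff.1 hne
  refine ⟨P, fun Q => ?_⟩
  have hQ := h Q
  rw [Finsupp.add_apply, Finsupp.single_apply]
  split_ifs with hPQ
  · subst hPQ
    exact Int.add_one_le_iff.2 (lt_of_le_of_ne hQ hP)
  · simpa using hQ

theorem apply_mul_degree_le {D : Divisor K F} (hD : 0 ≤ D) (P : Place K F) :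
    D P * P.degree ≤ degree K F D := by
  classical
  rw [← degree_single]
  refine degree_mono fun Q => ?_
  rw [Finsupp.single_apply]
  split_ifs with h
  · rw [h]
  · exact hD Q

theorem single_nonneg (P : Place K F) : (0 : Divisor K F) ≤ Finsupp.single P 1 := fun Q => by
  classical
  rw [Finsupp.single_apply]
  split_ifs <;> simp

theorem adjoin_inv_eq (x : F) :
    IntermediateField.adjoin K {x⁻¹} = IntermediateField.adjoin K {x} := by
  refine le_antisymm ?_ ?_ <;> rw [IntermediateField.adjoin_simple_le_iff]
  · exact inv_mem (IntermediateField.mem_adjoin_simple_self K x)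
  · simpa using inv_mem (IntermediateField.mem_adjoin_simple_self K x⁻¹)

variable [IsFunctionField K F]

theorem apply_le_degree {D : Divisor K F} (hD : 0 ≤ D) (P : Place K F) :
    D P ≤ degree K F D := by
  have h2 := apply_mul_degree_le hD P
  have h3 : (1 : ℤ) ≤ P.degree := by exact_mod_cast P.degree_pos
  nlinarith [show 0 ≤ D P from hD P]

theorem eq_zero_of_degree_eq_zero {D : Divisor K F} (hD : 0 ≤ D) (h : degree K F D = 0) :
    D = 0 := by
  ext P
  exact le_antisymm ((apply_le_degree hD P).trans h.le) (hD P)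

theorem eq_of_le_of_degree_le {A B : Divisor K F} (h : A ≤ B)
    (hd : degree K F B ≤ degree K F A) : A = B := by
  have h0 := sub_nonneg.2 h
  have := eq_zero_of_degree_eq_zero h0
    (le_antisymm (by rw [map_sub]; linarith) (degree_nonneg h0))
  exact (sub_eq_zero.1 this).symm

/-- Induction along the divisors above `A`, adding one place at a time. -/
theorem divisor_le_induction {A : Divisor K F} {p : Divisor K F → Prop} (h0 : p A)
    (hs : ∀ D P, A ≤ D → p D → p (D + Finsupp.single P 1)) {B : Divisor K F} (hB : A ≤ B) :
    p B := by
  obtain ⟨n, hn⟩ : ∃ n : ℕ, degree K F B - degree K F A = n :=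
    Int.eq_ofNat_of_zero_le (sub_nonneg.2 (degree_mono hB))
  induction n using Nat.strong_induction_on generalizing B with
  | _ n ih =>
    rcases eq_or_ne A B with rfl | hne
    · exact h0
    obtain ⟨P, hP⟩ := exists_single_add_le hB hne
    have hA : A ≤ B - Finsupp.single P 1 := le_sub_iff_add_le.2 hP
    have hPd := P.degree_pos
    have hd : degree K F (B - Finsupp.single P 1) - degree K F A = n - P.degree := by
      rw [map_sub, degree_single, one_mul, ← hn]; ring
    have h1 := sub_nonneg.2 (degree_mono hA)
    have := hs _ P hA (ih (n - P.degree) (by omega) hA (by omega))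
    rwa [sub_add_cancel] at this

/-- Induction along the divisors below `B`, removing one place at a time. -/
theorem divisor_ge_induction {B : Divisor K F} {p : Divisor K F → Prop} (h0 : p B)
    (hs : ∀ D P, p (D + Finsupp.single P 1) → p D) {A : Divisor K F} (hA : A ≤ B) :
    p A := by
  have := divisor_le_induction (A := -B) (p := fun D => p (-D)) (by simpa using h0)
    (fun D P _ h => hs _ P (by simpa [neg_add] using h)) (neg_le_neg hA)
  simpa using this

end DivisorDegree

/-! ### Weak approximation and the bound on the number of zeros -/

section Approximation

variable {K F : Type*} [Field K] [Field F] [Algebra K F] [IsFunctionField K F]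

/-- The real absolute value attached to a place. -/
def Place.abv (P : Place K F) : AbsoluteValue F ℝ :=
  (IsDiscreteValuationRing.maximalIdeal P.ring).adicAbv (b := 2) one_lt_two

theorem Place.abv_lt_abv (P : Place K F) (x y : F) :
    P.abv x < P.abv y ↔ P.valuation x < P.valuation y :=
  NNReal.coe_lt_coe.trans (WithZeroMulInt.toNNReal_strictMono one_lt_two).lt_iff_lt

theorem Place.abv_lt_one (P : Place K F) (x : F) : P.abv x < 1 ↔ P.valuation x < 1 := by
  simpa using P.abv_lt_abv x 1

theorem Place.one_lt_abv (P : Place K F) (x : F) : 1 < P.abv x ↔ 1 < P.valuation x := by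
  simpa using P.abv_lt_abv 1 x

/-- Distinct places have pairwise inequivalent absolute values, since equivalent ones would have the
same valuation ring; the Artin–Whaples lemma then separates them. -/
theorem exists_one_lt_valuation (S : Finset (Place K F)) (P : Place K F) :
    ∃ a : F, 1 < P.valuation a ∧ ∀ Q ∈ S, Q ≠ P → Q.valuation a < 1 := by
  classical
  let T : Finset (Place K F) := insert P S
  have hnt : ∀ Q : T, Q.1.abv.IsNontrivial := fun Q => by
    obtain ⟨x, hx⟩ := Q.1.exists_valuation_eq (-1)
    refine ⟨x, (Valuation.ne_zero_iff Q.1.valuation).1 (by rw [hx]; simp),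
      ((Q.1.abv_lt_one x).2 ?_).ne⟩
    rw [hx, ← WithZero.exp_zero, WithZero.exp_lt_exp]
    norm_num
  have hne : Pairwise fun Q R : T => ¬ Q.1.abv.IsEquiv R.1.abv := fun Q R hQR h => by
    refine hQR (Subtype.ext (Place.eq_of_ring_le fun x hx => ?_))
    rw [← Place.valuation_le_one_iff] at hx ⊢
    rw [← not_lt, ← Place.one_lt_abv] at hx ⊢
    rwa [← h.one_lt_iff]
  obtain ⟨a, ha, ha'⟩ := AbsoluteValue.exists_one_lt_lt_one_pi_of_not_isEquiv hnt hne
    ⟨P, Finset.mem_insert_self _ _⟩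
  exact ⟨a, (P.one_lt_abv a).1 ha, fun Q hQ hQP => (Q.abv_lt_one a).1
    (ha' ⟨Q, Finset.mem_insert_of_mem hQ⟩ fun h => hQP (congrArg Subtype.val h))⟩

theorem pow_le_exp_neg {x : ℤᵐ⁰} (hx : x < 1) (k : ℕ) : x ^ k ≤ WithZero.exp (-(k : ℤ)) := by
  have h1 : x ≤ WithZero.exp (-1) := by
    have := exp_lt_iff_le_sub_one.1 (WithZero.exp_zero (M := ℤ) ▸ hx)
    simpa using this
  calc x ^ k ≤ WithZero.exp (-1) ^ k := pow_le_pow_left₀ zero_le h1 k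
    _ = WithZero.exp (-(k : ℤ)) := by rw [← WithZero.exp_nsmul]; simp

theorem exists_valuation_sub_one_le (S : Finset (Place K F)) (P : Place K F) (k : ℕ) :
    ∃ z : F, P.valuation (z - 1) ≤ WithZero.exp (-(k : ℤ)) ∧
      ∀ Q ∈ S, Q ≠ P → Q.valuation z ≤ WithZero.exp (-(k : ℤ)) := by
  rcases Nat.eq_zero_or_pos k with rfl | hk
  · exact ⟨1, by simp, fun Q _ _ => by simp⟩
  obtain ⟨a, ha, ha'⟩ := exists_one_lt_valuation S P
  have hak : 1 < P.valuation (a ^ k) := by rw [map_pow]; exact one_lt_pow₀ ha hk.ne'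
  have h1 : P.valuation (1 + a ^ k) = P.valuation (a ^ k) :=
    P.valuation.map_add_eq_of_lt_right (by rwa [map_one])
  have hne : 1 + a ^ k ≠ 0 := (Valuation.ne_zero_iff P.valuation).1
    (by rw [h1]; exact (zero_lt_one.trans hak).ne')
  -- This quotient tends to `1` where `a` has a pole and to `0` where `a` has a zero, each at rate
  -- at least `k`.
  refine ⟨a ^ k / (1 + a ^ k), ?_, fun Q hQ hQP => ?_⟩
  · have : a ^ k / (1 + a ^ k) - 1 = -(1 + a ^ k)⁻¹ := by field_simp; ring
    rw [this, Valuation.map_neg, map_inv₀, h1, map_pow, ← inv_pow]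
    exact pow_le_exp_neg (inv_lt_one_of_one_lt₀ ha) k
  · have hQ1 : Q.valuation (a ^ k) < 1 := by
      rw [map_pow]; exact pow_lt_one₀ zero_le (ha' Q hQ hQP) hk.ne'
    rw [map_div₀, Valuation.map_one_add_of_lt _ hQ1, div_one, map_pow]
    exact pow_le_exp_neg (ha' Q hQ hQP) k

/-- The elements whose poles at the places of `S` are bounded by the divisor `D`. -/
def semilocalSpace (S : Finset (Place K F)) (D : Divisor K F) : Submodule K F :=
  ⨅ P ∈ S, P.ball (D P)

theorem mem_semilocalSpace {S : Finset (Place K F)} {D : Divisor K F} {x : F} :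
    x ∈ semilocalSpace S D ↔ ∀ P ∈ S, P.valuation x ≤ WithZero.exp (D P) := by
  simp [semilocalSpace, Place.mem_ball]

/-- Multiply by an approximate idempotent: close to `1` at `P`, so that the leading coefficient
survives, and small enough at the other places of `S` to absorb the poles of `y`. -/
theorem exists_mem_semilocalSpace_leading (S : Finset (Place K F)) (D : Divisor K F)
    {P : Place K F} (y : P.ball (D P)) :
    ∃ x ∈ semilocalSpace S D, ∃ hx : x ∈ P.ball (D P),
      P.leading (D P) ⟨x, hx⟩ = P.leading (D P) y := by
  classical
  obtain ⟨y, hy⟩ := y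
  rcases eq_or_ne y 0 with rfl | hy0
  · exact ⟨0, zero_mem _, hy, rfl⟩
  obtain ⟨k, hk⟩ : ∃ k : ℕ, ∀ Q ∈ S, -Q.ord y - D Q ≤ k := by
    refine ⟨∑ Q ∈ S, (-Q.ord y - D Q).natAbs, fun Q hQ => ?_⟩
    have : (-Q.ord y - D Q).natAbs ≤ ∑ Q ∈ S, (-Q.ord y - D Q).natAbs :=
      Finset.single_le_sum (f := fun Q => (-Q.ord y - D Q).natAbs) (fun _ _ => Nat.zero_le _) hQ
    omega
  -- The extra `1` makes the error at `P` drop by one order even when `k = 0`.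
  obtain ⟨z, hz, hz'⟩ := exists_valuation_sub_one_le S P (k + 1)
  have hsub : P.valuation (z * y - y) ≤ WithZero.exp (D P - 1) := by
    have : z * y - y = (z - 1) * y := by ring
    rw [this, map_mul]
    calc _ ≤ WithZero.exp (-((k + 1 : ℕ) : ℤ)) * WithZero.exp (D P) := mul_le_mul' hz hy
      _ ≤ _ := by
        rw [← WithZero.exp_add, WithZero.exp_le_exp]
        push_cast
        linarith [Int.natCast_nonneg k]
  have hzy : z * y ∈ P.ball (D P) := by
    have : z * y = (z * y - y) + y := by ring
    rw [this]
    exact add_mem (hsub.trans (WithZero.exp_le_exp.2 (by linarith))) hy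
  refine ⟨z * y, mem_semilocalSpace.2 fun Q hQ => ?_, hzy, ?_⟩
  · rcases eq_or_ne Q P with rfl | hQP
    · exact hzy
    rw [map_mul, Q.valuation_eq_exp hy0]
    calc _ ≤ WithZero.exp (-((k + 1 : ℕ) : ℤ)) * WithZero.exp (-Q.ord y) :=
          mul_le_mul_left (hz' Q hQ hQP) _
      _ ≤ _ := by
        rw [← WithZero.exp_add, WithZero.exp_le_exp]
        push_cast
        linarith [hk Q hQ]
  · rw [← sub_eq_zero, ← map_sub, P.leading_eq_zero_iff]
    exact hsub

/-- A Chinese remainder statement: `U` represents the quotient of the functions integral on `S` by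
those vanishing to order `D`. Each added place contributes a lift of its residue field, taken inside
the functions that already vanish to the previous order. -/
theorem exists_complement_semilocalSpace (S : Finset (Place K F)) {D : Divisor K F} (hD : 0 ≤ D)
    (hS : ∀ P ∉ S, D P = 0) :
    ∃ U : Submodule K F, U ≤ semilocalSpace S 0 ∧ Module.Finite K U ∧
      (Module.finrank K U : ℤ) = degree K F D ∧ Disjoint U (semilocalSpace S (-D)) := by
  classical
  revert hS
  refine divisor_le_induction (A := 0) (p := fun D => (∀ P ∉ S, D P = 0) →
    ∃ U : Submodule K F, U ≤ semilocalSpace S 0 ∧ Module.Finite K U ∧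
      (Module.finrank K U : ℤ) = degree K F D ∧ Disjoint U (semilocalSpace S (-D)))
    ?_ ?_ hD
  · intro _
    exact ⟨⊥, bot_le, inferInstance, by simp, disjoint_bot_left⟩
  intro D P hD ih hS
  have hPS : P ∈ S := by
    by_contra h
    have h1 := hS P h
    have h2 : 0 ≤ D P := hD P
    simp at h1
    linarith
  obtain ⟨U, hU, hfin, hdim, hdisj⟩ := ih fun Q hQ => by
    have := hS Q hQ
    rwa [Finsupp.add_apply, Finsupp.single_eq_of_ne (by rintro rfl; exact hQ hPS), add_zero] at this
  have hle : ∀ x ∈ semilocalSpace S (-D), x ∈ P.ball ((-D) P) := fun x hx =>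
    mem_semilocalSpace.1 hx P hPS
  let f : semilocalSpace S (-D) →ₗ[K] IsLocalRing.ResidueField P.ring :=
    P.leading ((-D) P) ∘ₗ Submodule.inclusion hle
  have hf : Function.Surjective f := fun y => by
    obtain ⟨y, rfl⟩ := P.leading_surjective ((-D) P) y
    obtain ⟨x, hx, hx', h⟩ := exists_mem_semilocalSpace_leading S (-D) y
    exact ⟨⟨x, hx⟩, h⟩
  have hker : ∀ x : semilocalSpace S (-D), (x : F) ∈ semilocalSpace S (-(D + Finsupp.single P 1)) →
      f x = 0 := fun x hx => by
    refine (P.leading_eq_zero_iff _ _).2 ?_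
    have := mem_semilocalSpace.1 hx P hPS
    simp only [neg_add, Finsupp.add_apply, Finsupp.neg_apply, Finsupp.single_eq_same] at this
    exact this
  obtain ⟨g, hg⟩ := f.exists_rightInverse_of_surjective (LinearMap.range_eq_top.2 hf)
  let g' : IsLocalRing.ResidueField P.ring →ₗ[K] F := (semilocalSpace S (-D)).subtype ∘ₗ g
  have hginj : Function.Injective g' := (Subtype.val_injective).comp
    (Function.LeftInverse.injective (g := f) fun y => LinearMap.congr_fun hg y)
  have := P.finite_residueField
  have hg'D : LinearMap.range g' ≤ semilocalSpace S (-D) := by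
    rintro _ ⟨y, rfl⟩
    exact (g y).2
  have hmono : semilocalSpace S (-(D + Finsupp.single P 1)) ≤ semilocalSpace S (-D) := by
    intro x hx
    refine mem_semilocalSpace.2 fun Q hQ => (mem_semilocalSpace.1 hx Q hQ).trans ?_
    rw [WithZero.exp_le_exp]
    have : 0 ≤ (Finsupp.single P (1 : ℤ)) Q := by
      rw [Finsupp.single_apply]; split_ifs <;> simp
    simp only [Finsupp.neg_apply, Finsupp.add_apply]
    linarith
  have h0 : semilocalSpace S (-D) ≤ semilocalSpace S 0 := fun x hx =>
    mem_semilocalSpace.2 fun Q hQ => (mem_semilocalSpace.1 hx Q hQ).trans <| by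
      rw [WithZero.exp_le_exp]
      simpa using hD Q
  refine ⟨U ⊔ LinearMap.range g', sup_le hU (hg'D.trans h0), inferInstance, ?_, ?_⟩
  · have h1 := Submodule.finrank_sup_add_finrank_inf_eq U (LinearMap.range g')
    rw [(hdisj.mono_right hg'D).eq_bot, finrank_bot, add_zero,
      LinearMap.finrank_range_of_inj hginj] at h1
    rw [h1, map_add, degree_single, ← hdim]
    simp [Place.degree]
  · rw [Submodule.disjoint_def]
    intro x hx hxD
    obtain ⟨u, hu, _, ⟨y, rfl⟩, rfl⟩ := Submodule.mem_sup.1 hx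
    have hgy : g' y ∈ semilocalSpace S (-D) := hg'D ⟨y, rfl⟩
    have hu0 : u = 0 := by
      refine Submodule.disjoint_def.1 hdisj u hu ?_
      have := sub_mem (hmono hxD) hgy
      rwa [add_sub_cancel_right] at this
    subst hu0
    rw [zero_add] at hxD ⊢
    have h1 : f (g y) = 0 := hker (g y) hxD
    have h2 : f (g y) = y := LinearMap.congr_fun hg y
    rw [← h2, h1, map_zero]

-- Elements of `U` independent over `K` stay independent over `K(t)`. In a relation with
-- coefficients in `K[t]`, the constant terms produce an element of `U ∩ tM = 0`, so they vanish;
-- dividing by `t` and repeating, every coefficient is divisible by all powers of `t`.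
open scoped IntermediateField.algebraAdjoinAdjoin in
theorem finrank_le_of_disjoint_mul {t : F} (ht : Transcendental K t) (M : Submodule K F)
    (hM : ∀ x ∈ M, t * x ∈ M) (U : Submodule K F) (hUM : U ≤ M)
    (hU : ∀ x ∈ M, t * x ∈ U → t * x = 0) :
    Module.finrank K U ≤ Module.finrank (IntermediateField.adjoin K {t}) F := by
  have := IsFunctionField.finiteDimensional_adjoin ht
  have ht0 : t ≠ 0 := fun h => ht (h ▸ isAlgebraic_zero)
  let R := Algebra.adjoin K {t}
  let tR : R := ⟨t, Algebra.self_mem_adjoin_singleton K _⟩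
  have hRM : ∀ r : R, ∀ m ∈ M, r • m ∈ M := by
    rintro ⟨r, hr⟩
    refine Algebra.adjoin_induction (p := fun r _ => ∀ m ∈ M, r * m ∈ M) ?_ ?_ ?_ ?_ hr
    · rintro z rfl
      exact hM
    · intro c m hm
      rw [← Algebra.smul_def]
      exact M.smul_mem c hm
    · intro a b _ _ ha hb m hm
      rw [add_mul]
      exact M.add_mem (ha m hm) (hb m hm)
    · intro a b _ _ ha hb m hm
      rw [mul_assoc]
      exact ha _ (hb m hm)
  have hnu : ¬ IsUnit tR := by
    intro h
    obtain ⟨⟨y, hy⟩, hxy⟩ := h.exists_right_inv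
    have hy' : y ∈ Algebra.adjoin K {t} := hy
    rw [Algebra.adjoin_singleton_eq_range_aeval] at hy'
    obtain ⟨p, hp⟩ := hy'
    have hp' : Polynomial.aeval t p = y := hp
    have h1 : t * y = 1 := congrArg Subtype.val hxy
    have h2 : Polynomial.aeval t (Polynomial.X * p - 1) = 0 := by
      rw [map_sub, map_mul, Polynomial.aeval_X, hp', h1, map_one, sub_self]
    have := congrArg (Polynomial.eval 0) ((transcendental_iff.1 ht) _ h2)
    simp at this
  have hsplit : ∀ r : R, ∃ (c : K) (s : R), r = algebraMap K R c + tR * s := by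
    rintro ⟨r, hr⟩
    have hr' : r ∈ Algebra.adjoin K {t} := hr
    rw [Algebra.adjoin_singleton_eq_range_aeval] at hr'
    obtain ⟨p, hp⟩ := hr'
    have hp' : Polynomial.aeval t p = r := hp
    refine ⟨p.coeff 0, ⟨Polynomial.aeval t p.divX,
      Polynomial.aeval_mem_adjoin_singleton _ _⟩, Subtype.ext ?_⟩
    change r = algebraMap K F (p.coeff 0) + t * Polynomial.aeval t p.divX
    rw [← hp']
    conv_lhs => rw [← Polynomial.divX_mul_X_add p]
    rw [map_add, map_mul, Polynomial.aeval_X, Polynomial.aeval_C, add_comm, mul_comm]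
  have hnoeth : IsNoetherianRing R := by
    have : Algebra.FiniteType K R :=
      (Subalgebra.fg_iff_finiteType _).1 ⟨{t}, by simp [R]⟩
    exact Algebra.FiniteType.isNoetherianRing K R
  let b := Module.Basis.ofVectorSpace K U
  have hdvd : ∀ n : ℕ, ∀ (s : Finset _) (r : _ → R), ∑ i ∈ s, r i • (b i : F) = 0 →
      ∀ i ∈ s, tR ^ n ∣ r i := by
    intro n
    induction n with
    | zero => simp
    | succ n ih =>
      intro s r hr i hi
      choose c q hcq using fun i => hsplit (r i)
      have e : ((∑ i ∈ s, c i • b i : U) : F) + t * ∑ i ∈ s, q i • (b i : F) = 0 := by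
        rw [← hr, Finset.mul_sum, AddSubmonoidClass.coe_finsetSum, ← Finset.sum_add_distrib]
        refine Finset.sum_congr rfl fun i _ => ?_
        rw [hcq i, add_smul, algebraMap_smul, mul_smul]
        rfl
      have hqM : ∑ i ∈ s, q i • (b i : F) ∈ M :=
        sum_mem fun i _ => hRM _ _ (hUM (b i).2)
      have hq0 : t * ∑ i ∈ s, q i • (b i : F) = 0 := by
        refine hU _ hqM ?_
        rw [← neg_eq_of_add_eq_zero_right e]
        exact neg_mem (SetLike.coe_mem _)
      rw [hq0, add_zero] at e
      have hc : ∀ i ∈ s, c i = 0 :=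
        linearIndependent_iff'.1 b.linearIndependent s c (Subtype.ext e)
      rw [hcq i, hc i hi, map_zero, zero_add, pow_succ']
      exact mul_dvd_mul_left _ (ih s q ((mul_eq_zero.1 hq0).resolve_left ht0) i hi)
  have hli : LinearIndependent R (fun i => (b i : F)) := by
    rw [linearIndependent_iff']
    intro s r hr i hi
    by_contra hne
    obtain ⟨n, hn⟩ := FiniteMultiplicity.of_not_isUnit hnu hne
    exact hn (hdvd _ s r hr i hi)
  have hli2 : LinearIndependent (IntermediateField.adjoin K {t}) (fun i => (b i : F)) :=
    (LinearIndependent.iff_fractionRing R _).1 hli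
  have := hli2.finite
  have := Fintype.ofFinite (Module.Basis.ofVectorSpaceIndex K U)
  rw [Module.finrank_eq_card_basis b]
  exact hli2.fintype_card_le_finrank

/-- Half of the equality between the degree of the zero divisor and `[F : K(t)]`. Multiplication by
`t` carries functions integral on `S` to functions vanishing to order `D`, which meet the complement
`U` of dimension `deg D` only in `0`. -/
theorem sum_ord_mul_degree_le {t : F} (ht : Transcendental K t) (S : Finset (Place K F))
    (hS : ∀ P ∈ S, P.valuation t < 1) :
    ∑ P ∈ S, P.ord t * P.degree ≤ Module.finrank (IntermediateField.adjoin K {t}) F := by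
  classical
  have ht0 : t ≠ 0 := fun h => ht (h ▸ isAlgebraic_zero)
  let D : Divisor K F := Finsupp.onFinset S (fun P => if P ∈ S then P.ord t else 0)
    (fun P h => by by_contra hP; simp [hP] at h)
  have hDS : ∀ P ∈ S, D P = P.ord t := fun P hP => by simp [D, hP]
  have hD : 0 ≤ D := fun P => by
    by_cases hP : P ∈ S
    · rw [hDS P hP]
      have := hS P hP
      rw [P.valuation_eq_exp ht0, ← WithZero.exp_zero, WithZero.exp_lt_exp] at this
      simp only [Finsupp.coe_zero, Pi.zero_apply]
      linarith
    · simp [D, hP]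
  obtain ⟨U, hU, hfin, hdim, hdisj⟩ := exists_complement_semilocalSpace S hD
    fun P hP => by simp [D, hP]
  have hdeg : degree K F D = ∑ P ∈ S, P.ord t * P.degree := by
    rw [degree, Finsupp.liftAddHom_apply, Finsupp.sum_of_support_subset D (s := S)
      Finsupp.support_onFinset_subset _ (fun _ _ => map_zero _)]
    exact Finset.sum_congr rfl fun P hP => by rw [hDS P hP]; rfl
  rw [← hdeg, ← hdim, Nat.cast_le]
  have hle : ∀ x ∈ semilocalSpace S (0 : Divisor K F), t * x ∈ semilocalSpace S (-D) := by
    intro x hx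
    refine mem_semilocalSpace.2 fun P hP => ?_
    rw [map_mul, Finsupp.neg_apply, hDS P hP, P.valuation_eq_exp ht0]
    exact mul_le_of_le_one_right' (mem_semilocalSpace.1 hx P hP)
  refine finrank_le_of_disjoint_mul ht (semilocalSpace S 0) (fun x hx => ?_) U hU
    (fun x hx hxU => Submodule.disjoint_def.1 hdisj _ hxU (hle x hx))
  refine mem_semilocalSpace.2 fun P hP => (mem_semilocalSpace.1 (hle x hx) P hP).trans ?_
  rw [WithZero.exp_le_exp]
  simpa using hD P

end Approximation

/-! ### Principal divisors, Riemann–Roch spaces and Riemann's theorem -/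

section PrincipalDivisors

variable {K F : Type*} [Field K] [Field F] [Algebra K F] [IsFunctionField K F]

theorem finite_zeros {t : F} (ht : Transcendental K t) :
    {P : Place K F | P.valuation t < 1}.Finite := by
  have ht0 : t ≠ 0 := fun h => ht (h ▸ isAlgebraic_zero)
  by_contra hinf
  obtain ⟨S, hS, hcard⟩ := Set.Infinite.exists_subset_card_eq hinf
    (Module.finrank (IntermediateField.adjoin K {t}) F + 1)
  have h1 := sum_ord_mul_degree_le ht S fun P hP => hS hP
  have h2 : ∑ P ∈ S, (1 : ℤ) ≤ ∑ P ∈ S, P.ord t * P.degree := by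
    refine Finset.sum_le_sum fun P hP => ?_
    have h3 : P.valuation t < 1 := hS hP
    rw [P.valuation_eq_exp ht0, ← WithZero.exp_zero, WithZero.exp_lt_exp] at h3
    have h4 : (0 : ℤ) < P.degree := by exact_mod_cast P.degree_pos
    exact Int.add_one_le_iff.2 (mul_pos (by linarith) h4)
  rw [Finset.sum_const, hcard] at h2
  simp at h2
  linarith

theorem Place.ord_eq_zero_iff (P : Place K F) {x : F} (hx : x ≠ 0) :
    P.ord x = 0 ↔ P.valuation x = 1 := by
  rw [P.valuation_eq_exp hx, WithZero.exp_eq_one, neg_eq_zero]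

theorem Place.ord_mul (P : Place K F) {x y : F} (hx : x ≠ 0) (hy : y ≠ 0) :
    P.ord (x * y) = P.ord x + P.ord y := by
  rw [Place.ord, Place.ord, Place.ord, map_mul,
    WithZero.log_mul ((Valuation.ne_zero_iff _).2 hx) ((Valuation.ne_zero_iff _).2 hy)]
  ring

theorem Place.ord_inv (P : Place K F) (x : F) : P.ord x⁻¹ = -P.ord x := by
  rw [Place.ord, Place.ord, map_inv₀, WithZero.log_inv]

theorem finite_support_ord (x : F) : (Function.support fun P : Place K F => P.ord x).Finite := by
  by_cases hx : IsAlgebraic K x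
  · convert Set.finite_empty
    ext P
    rcases eq_or_ne x 0 with rfl | hx0
    · simp [Place.ord]
    · simp [(P.ord_eq_zero_iff hx0).2 (P.valuation_algebraic hx0 hx)]
  · have hx0 : x ≠ 0 := fun h => hx (h ▸ isAlgebraic_zero)
    refine ((finite_zeros (t := x) hx).union
      (finite_zeros (t := x⁻¹) fun h => hx (by simpa using h.inv))).subset fun P hP => ?_
    have h1 := mt (P.ord_eq_zero_iff hx0).2 hP
    rcases lt_or_gt_of_ne h1 with h | h
    · exact Or.inl h
    · refine Or.inr ?_
      change P.valuation x⁻¹ < 1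
      rw [map_inv₀]
      exact inv_lt_one_of_one_lt₀ h

variable (K) in
/-- The divisor of an element of `F` (by convention `0` for the element `0`). -/
def principalDivisor (x : F) : Divisor K F :=
  Finsupp.ofSupportFinite (fun P => P.ord x) (finite_support_ord x)

theorem principalDivisor_apply (x : F) (P : Place K F) : principalDivisor K x P = P.ord x := rfl

theorem principalDivisor_mul {x y : F} (hx : x ≠ 0) (hy : y ≠ 0) :
    principalDivisor K (x * y) = principalDivisor K x + principalDivisor K y :=
  Finsupp.ext fun P => P.ord_mul hx hy

theorem principalDivisor_inv (x : F) : principalDivisor K x⁻¹ = -principalDivisor K x :=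
  Finsupp.ext fun P => P.ord_inv x

theorem mem_principalDivisors_iff {D : Divisor K F} :
    D ∈ principalDivisors K F ↔ ∃ x : F, x ≠ 0 ∧ D = principalDivisor K x :=
  ⟨fun ⟨x, hx, h⟩ => ⟨x, hx, Finsupp.ext h⟩, fun ⟨x, hx, h⟩ => ⟨x, hx, fun _ => h ▸ rfl⟩⟩

theorem principalDivisor_of_isAlgebraic {x : F} (hx : IsAlgebraic K x) :
    principalDivisor K x = 0 := by
  ext P
  rcases eq_or_ne x 0 with rfl | hx0
  · simp [principalDivisor_apply, Place.ord]
  · exact (P.ord_eq_zero_iff hx0).2 (P.valuation_algebraic hx0 hx)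

theorem mem_riemannRochSpace_iff {D : Divisor K F} {x : F} (hx : x ≠ 0) :
    x ∈ riemannRochSpace D ↔ 0 ≤ principalDivisor K x + D :=
  forall_congr' fun P => P.valuation_le_exp_iff hx (D P)

theorem riemannRochSpace_mono {A B : Divisor K F} (h : A ≤ B) :
    riemannRochSpace A ≤ riemannRochSpace B :=
  fun _ hx P => (hx P).trans (WithZero.exp_le_exp.2 (h P))

theorem mul_mem_riemannRochSpace {A B : Divisor K F} {x y : F} (hx : x ∈ riemannRochSpace A)
    (hy : y ∈ riemannRochSpace B) : x * y ∈ riemannRochSpace (A + B) := fun P => by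
  rw [map_mul, Finsupp.add_apply, WithZero.exp_add]
  exact mul_le_mul' (hx P) (hy P)

theorem one_mem_riemannRochSpace {D : Divisor K F} (hD : 0 ≤ D) : 1 ∈ riemannRochSpace D :=
  fun P => by
    rw [map_one, ← WithZero.exp_zero, WithZero.exp_le_exp]
    exact hD P

theorem isAlgebraic_of_mem_riemannRochSpace_zero {x : F}
    (hx : x ∈ riemannRochSpace (0 : Divisor K F)) : IsAlgebraic K x := by
  by_contra h
  obtain ⟨P, hP⟩ := exists_valuation_lt_one (K := K) (x := x⁻¹) fun h' => h (by simpa using h'.inv)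
  have hx0 : x ≠ 0 := fun h0 => h (h0 ▸ isAlgebraic_zero)
  rw [map_inv₀, inv_lt_one₀ (zero_lt_iff.2 ((Valuation.ne_zero_iff _).2 hx0))] at hP
  exact (hx P).not_gt hP

theorem riemannRochSpace_neg_single (P : Place K F) :
    riemannRochSpace (-Finsupp.single P 1 : Divisor K F) = ⊥ := by
  classical
  rw [eq_bot_iff]
  intro x hx
  by_contra hx0
  have hle : (-Finsupp.single P 1 : Divisor K F) ≤ 0 := by
    rw [neg_le, neg_zero]
    intro Q
    rw [Finsupp.single_apply]
    split_ifs <;> simp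
  have h1 := P.valuation_algebraic hx0
    (isAlgebraic_of_mem_riemannRochSpace_zero (riemannRochSpace_mono hle hx))
  have h2 := hx P
  rw [h1, ← WithZero.exp_zero, WithZero.exp_le_exp] at h2
  simp at h2

/-- The leading coefficients at `P` of the elements of `L(D + P)`. -/
def riemannRochSpace.leading (D : Divisor K F) (P : Place K F) :
    riemannRochSpace (D + Finsupp.single P 1) →ₗ[K] IsLocalRing.ResidueField P.ring :=
  P.leading ((D + Finsupp.single P 1 : Divisor K F) P) ∘ₗ
    Submodule.inclusion (p := riemannRochSpace (D + Finsupp.single P 1)) fun _ hx => hx P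

theorem riemannRochSpace.leading_eq_zero_iff (D : Divisor K F) (P : Place K F)
    (x : riemannRochSpace (D + Finsupp.single P 1)) :
    riemannRochSpace.leading D P x = 0 ↔ (x : F) ∈ riemannRochSpace D := by
  classical
  suffices h : P.valuation (x : F) ≤ WithZero.exp ((D + Finsupp.single P 1 : Divisor K F) P - 1) ↔
      (x : F) ∈ riemannRochSpace D from (P.leading_eq_zero_iff _ _).trans h
  rw [Finsupp.add_apply, Finsupp.single_eq_same, add_sub_cancel_right]
  refine ⟨fun h Q => ?_, fun h => h P⟩
  rcases eq_or_ne Q P with rfl | hQ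
  · exact h
  · have := x.2 Q
    rwa [Finsupp.add_apply, Finsupp.single_eq_of_ne hQ, add_zero] at this

/-- The kernel of the leading coefficient map on `L(D + P)` is `L(D)`. -/
def riemannRochSpace.kerLeadingEquiv (D : Divisor K F) (P : Place K F) :
    LinearMap.ker (riemannRochSpace.leading D P) ≃ₗ[K] riemannRochSpace D where
  toFun x := ⟨x.1, (riemannRochSpace.leading_eq_zero_iff D P x.1).1 x.2⟩
  map_add' _ _ := rfl
  map_smul' _ _ := rfl
  invFun x := ⟨⟨x, riemannRochSpace_mono (le_add_of_nonneg_right (single_nonneg P)) x.2⟩,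
    (riemannRochSpace.leading_eq_zero_iff D P _).2 x.2⟩
  left_inv _ := rfl
  right_inv _ := rfl

variable (K F) in
theorem nonempty_place : Nonempty (Place K F) := by
  obtain ⟨x, hx, _⟩ := IsFunctionField.exists_transcendental (K := K) (F := F)
  exact ⟨(exists_valuation_lt_one hx).choose⟩

instance finite_riemannRochSpace (D : Divisor K F) : Module.Finite K (riemannRochSpace D) := by
  obtain ⟨P⟩ := nonempty_place K F
  -- The induction starts at `-P`, whose space is `0`; adding a place enlarges the space by at most
  -- a residue field.
  have h : Module.Finite K (riemannRochSpace (D ⊔ -Finsupp.single P 1)) := by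
    refine divisor_le_induction (p := fun D => Module.Finite K (riemannRochSpace D))
      (A := -Finsupp.single P 1) ?_ ?_ le_sup_right
    · rw [riemannRochSpace_neg_single]
      infer_instance
    · intro D P _ h
      have := P.finite_residueField
      have := Module.Finite.equiv (riemannRochSpace.kerLeadingEquiv D P).symm
      have := Module.Finite.equiv (riemannRochSpace.leading D P).quotKerEquivRange.symm
      exact Module.Finite.of_submodule_quotient (LinearMap.ker (riemannRochSpace.leading D P))
  exact Submodule.finiteDimensional_of_le (riemannRochSpace_mono
    (le_sup_left : D ≤ D ⊔ -Finsupp.single P 1))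

theorem dim_add_single (D : Divisor K F) (P : Place K F) :
    dim (D + Finsupp.single P 1) =
      dim D + Module.finrank K (LinearMap.range (riemannRochSpace.leading D P)) := by
  rw [dim, dim, ← (riemannRochSpace.leading D P).finrank_range_add_finrank_ker,
    (riemannRochSpace.kerLeadingEquiv D P).finrank_eq, add_comm]

/-- Adding `P` raises the degree by `deg P` and the dimension by the rank of a map into the residue
field, which is at most `deg P`. -/
theorem degree_sub_dim_mono {A B : Divisor K F} (h : A ≤ B) :
    degree K F A - dim A ≤ degree K F B - dim B := by
  refine divisor_le_induction (p := fun B => degree K F A - dim A ≤ degree K F B - dim B) le_rfl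
    (fun D P _ ih => ih.trans ?_) h
  have := P.finite_residueField
  have h1 : Module.finrank K (LinearMap.range (riemannRochSpace.leading D P)) ≤ P.degree :=
    Submodule.finrank_le _
  rw [dim_add_single, map_add, degree_single]
  push_cast
  have h2 : (Module.finrank K (LinearMap.range (riemannRochSpace.leading D P)) : ℤ) ≤ P.degree := by
    exact_mod_cast h1
  linarith

theorem riemannRochSpace_nsmul_pow {D : Divisor K F} {x : F} (hx : x ∈ riemannRochSpace D)
    (n : ℕ) : x ^ n ∈ riemannRochSpace (n • D) := by
  induction n with
  | zero => simpa using one_mem_riemannRochSpace le_rfl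
  | succ n ih =>
    rw [pow_succ, succ_nsmul]
    exact mul_mem_riemannRochSpace ih hx

/-- The divisor of poles of `x`. -/
def poleDivisor (K : Type*) {F : Type*} [Field K] [Field F] [Algebra K F] [IsFunctionField K F]
    (x : F) : Divisor K F :=
  principalDivisor K x⁻¹ ⊔ 0

theorem mem_riemannRochSpace_poleDivisor (x : F) : x ∈ riemannRochSpace (poleDivisor K x) := by
  rcases eq_or_ne x 0 with rfl | hx
  · exact zero_mem _
  rw [mem_riemannRochSpace_iff hx, poleDivisor, principalDivisor_inv]
  have : -principalDivisor K x ≤ -principalDivisor K x ⊔ 0 := le_sup_left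
  simpa using add_le_add_right this (principalDivisor K x)

theorem poleDivisor_nonneg (x : F) : 0 ≤ poleDivisor K x := le_sup_right

theorem degree_poleDivisor_le {x : F} (hx : Transcendental K x) :
    degree K F (poleDivisor K x) ≤ Module.finrank (IntermediateField.adjoin K {x}) F := by
  classical
  have hx' : Transcendental K x⁻¹ := fun h => hx (by simpa using h.inv)
  have hx0 : x⁻¹ ≠ 0 := fun h => hx' (h ▸ isAlgebraic_zero)
  rw [← adjoin_inv_eq]
  refine le_trans (le_of_eq ?_) (sum_ord_mul_degree_le hx' (finite_zeros hx').toFinset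
    fun P hP => by simpa using hP)
  have hord : ∀ P : Place K F, P.valuation x⁻¹ < 1 ↔ 0 < P.ord x⁻¹ := fun P => by
    rw [P.valuation_eq_exp hx0, ← WithZero.exp_zero, WithZero.exp_lt_exp, neg_lt_zero]
  rw [degree, Finsupp.liftAddHom_apply, Finsupp.sum_of_support_subset _
    (s := (finite_zeros hx').toFinset) _ _ (fun _ _ => map_zero _)]
  · refine Finset.sum_congr rfl fun P hP => ?_
    have h1 : 0 < P.ord x⁻¹ := (hord P).1 (by simpa using hP)
    change (P.ord x⁻¹ ⊔ 0) * _ = _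
    rw [sup_eq_left.2 h1.le]
  · intro P hP
    rw [Finsupp.mem_support_iff] at hP
    rw [Set.Finite.mem_toFinset]
    by_contra h
    exact hP (sup_eq_right.2 (not_lt.1 (mt (hord P).2 h)))

-- If `b_j` is a basis of `F` over `K(x)` and `C` bounds the poles of all `b_j`, the products `x ^ i
-- * b_j` with `i ≤ l` are independent over `K` and lie in `L(l (x)_∞ + C)`.
open scoped IntermediateField.algebraAdjoinAdjoin in
theorem exists_le_dim_nsmul_poleDivisor_add {x : F} (hx : Transcendental K x) :
    ∃ C : Divisor K F, 0 ≤ C ∧ ∀ l : ℕ,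
      Module.finrank (IntermediateField.adjoin K {x}) F * (l + 1) ≤
        dim (l • poleDivisor K x + C) := by
  have := IsFunctionField.finiteDimensional_adjoin hx
  let b := Module.finBasis (IntermediateField.adjoin K {x}) F
  set n := Module.finrank (IntermediateField.adjoin K {x}) F with hn
  refine ⟨∑ j, poleDivisor K (b j), Finset.sum_nonneg fun j _ => poleDivisor_nonneg _,
    fun l => ?_⟩
  set C := ∑ j, poleDivisor K (b j) with hC
  have hbC : ∀ j, b j ∈ riemannRochSpace C := fun j => riemannRochSpace_mono
    (Finset.single_le_sum (f := fun j => poleDivisor K (b j))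
      (fun j _ => poleDivisor_nonneg _) (Finset.mem_univ j)) (mem_riemannRochSpace_poleDivisor _)
  have hxl : ∀ p ∈ Polynomial.degreeLT K (l + 1),
      Polynomial.aeval x p ∈ riemannRochSpace (l • poleDivisor K x) := fun p hp => by
    rw [Polynomial.aeval_eq_sum_range]
    refine sum_mem fun i hi => Submodule.smul_mem _ _ ?_
    rcases eq_or_ne p 0 with rfl | hp0
    · simp at hi
      subst hi
      simpa using one_mem_riemannRochSpace (nsmul_nonneg (poleDivisor_nonneg x) l)
    have h1 : p.natDegree < l + 1 := by
      rw [Polynomial.mem_degreeLT] at hp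
      exact (Polynomial.natDegree_lt_iff_degree_lt hp0).2 hp
    have h2 : i ≤ l := by
      have := Finset.mem_range.1 hi
      omega
    exact riemannRochSpace_mono (nsmul_le_nsmul_left (poleDivisor_nonneg x) h2)
      (riemannRochSpace_nsmul_pow (mem_riemannRochSpace_poleDivisor x) i)
  let f : (Fin n → Polynomial.degreeLT K (l + 1)) →ₗ[K]
      riemannRochSpace (l • poleDivisor K x + C) :=
    { toFun := fun p => ⟨∑ j, Polynomial.aeval x (p j : Polynomial K) * b j,
        sum_mem fun j _ => mul_mem_riemannRochSpace (hxl _ (p j).2) (hbC j)⟩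
      map_add' := fun p q => Subtype.ext <| by
        simp [add_mul, Finset.sum_add_distrib]
      map_smul' := fun c p => Subtype.ext <| by
        simp [Finset.smul_sum] }
  have hf : Function.Injective f := by
    rw [← LinearMap.ker_eq_bot, LinearMap.ker_eq_bot']
    intro p hp
    have h1 : ∑ j, Polynomial.aeval x (p j : Polynomial K) * b j = 0 := congrArg Subtype.val hp
    have h2 := Fintype.linearIndependent_iff.1 b.linearIndependent
      (fun j => ⟨Polynomial.aeval x (p j : Polynomial K),
        IntermediateField.algebra_adjoin_le_adjoin K _
          (Polynomial.aeval_mem_adjoin_singleton K x)⟩) h1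
    funext j
    exact Subtype.ext (transcendental_iff.1 hx _ (congrArg Subtype.val (h2 j)))
  have h3 := LinearMap.finrank_le_finrank_of_injective hf
  rw [Module.finrank_pi_fintype, (Polynomial.degreeLTEquiv K (l + 1)).finrank_eq] at h3
  simpa [dim] using h3

theorem finrank_le_degree_poleDivisor {x : F} (hx : Transcendental K x) :
    (Module.finrank (IntermediateField.adjoin K {x}) F : ℤ) ≤ degree K F (poleDivisor K x) := by
  obtain ⟨C, hC, h⟩ := exists_le_dim_nsmul_poleDivisor_add hx
  set n := Module.finrank (IntermediateField.adjoin K {x}) F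
  by_contra hlt
  rw [not_le] at hlt
  set d := degree K F (poleDivisor K x) with hd
  -- The space has dimension at least `n (l + 1)` and at most `l d + deg C + dim 0`. With `d < n`,
  -- this `l` is large enough for a contradiction.
  set l := (degree K F C + dim (0 : Divisor K F)).toNat with hl
  have h1 := degree_sub_dim_mono (A := 0) (B := l • poleDivisor K x + C)
    (add_nonneg (nsmul_nonneg (poleDivisor_nonneg x) l) hC)
  rw [map_zero, map_add, map_nsmul, nsmul_eq_mul, ← hd] at h1
  have h2 : (n : ℤ) * (l + 1) ≤ dim (l • poleDivisor K x + C) := by exact_mod_cast h l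
  have h3 : degree K F C + dim (0 : Divisor K F) ≤ l := Int.self_le_toNat _
  have h4 : d + 1 ≤ n := hlt
  have h5 : 0 ≤ d := degree_nonneg (poleDivisor_nonneg x)
  nlinarith [Int.natCast_nonneg l, mul_le_mul_of_nonneg_right h4 (Int.natCast_nonneg l)]

theorem degree_poleDivisor {x : F} (hx : Transcendental K x) :
    degree K F (poleDivisor K x) = Module.finrank (IntermediateField.adjoin K {x}) F :=
  le_antisymm (degree_poleDivisor_le hx) (finrank_le_degree_poleDivisor hx)

/-- Zeros and poles have the same degree because `x` and `x⁻¹` generate the same subfield, over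
which `F` has a single degree. -/
theorem degree_principalDivisor (x : F) : degree K F (principalDivisor K x) = 0 := by
  by_cases hx : IsAlgebraic K x
  · rw [principalDivisor_of_isAlgebraic hx, map_zero]
  have h1 := degree_poleDivisor (K := K) (x := x) hx
  have h2 := degree_poleDivisor (K := K) (x := x⁻¹) fun h => hx (by simpa using h.inv)
  rw [adjoin_inv_eq, ← h1] at h2
  have h3 : principalDivisor K x = poleDivisor K x⁻¹ - poleDivisor K x := by
    rw [poleDivisor, poleDivisor, inv_inv, principalDivisor_inv]
    ext P
    change (principalDivisor K x P) =
      (principalDivisor K x P ⊔ 0) - (-principalDivisor K x P ⊔ 0)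
    exact (posPart_sub_negPart _).symm
  rw [h3, map_sub, h2, sub_self]

/-- Multiplication by `z` is an isomorphism from `L(D + (z))` to `L(D)`. -/
def riemannRochSpace.mulEquiv (D : Divisor K F) {z : F} (hz : z ≠ 0) :
    riemannRochSpace (D + principalDivisor K z) ≃ₗ[K] riemannRochSpace D :=
  (LinearEquiv.smulOfNeZero F F z hz |>.restrictScalars K).ofSubmodules _ _ <| by
    have hzm : ∀ (E : Divisor K F) {y : F}, y ≠ 0 → ∀ x ∈ riemannRochSpace (E + principalDivisor K y),
        y * x ∈ riemannRochSpace E := fun E y hy x hx => by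
      have hy' : y ∈ riemannRochSpace (-principalDivisor K y) := by
        rw [mem_riemannRochSpace_iff hy, add_neg_cancel]
      simpa using mul_mem_riemannRochSpace hy' hx
    ext x
    constructor
    · rintro ⟨y, hy, rfl⟩
      exact hzm D hz y hy
    · intro hx
      refine ⟨z⁻¹ * x, hzm _ (inv_ne_zero hz) x ?_, ?_⟩
      · rwa [add_assoc, principalDivisor_inv, add_neg_cancel, add_zero]
      · exact mul_inv_cancel_left₀ hz x

theorem dim_add_principalDivisor (D : Divisor K F) {z : F} (hz : z ≠ 0) :
    dim (D + principalDivisor K z) = dim D :=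
  (riemannRochSpace.mulEquiv D hz).finrank_eq

theorem exists_ne_zero_of_dim_pos {D : Divisor K F} (h : 0 < dim D) :
    ∃ x : F, x ≠ 0 ∧ x ∈ riemannRochSpace D := by
  have : Nontrivial (riemannRochSpace D) := Module.nontrivial_of_finrank_pos h
  obtain ⟨⟨x, hx⟩, hx0⟩ := exists_ne (0 : riemannRochSpace D)
  exact ⟨x, fun h => hx0 (Subtype.ext h), hx⟩

theorem exists_principalDivisor_add_nonneg {D : Divisor K F} (h : 0 < dim D) :
    ∃ x : F, x ≠ 0 ∧ 0 ≤ D + principalDivisor K x := by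
  obtain ⟨x, hx, hxD⟩ := exists_ne_zero_of_dim_pos h
  exact ⟨x, hx, by rw [add_comm]; exact (mem_riemannRochSpace_iff hx).1 hxD⟩

variable (K F) in
/-- Riemann's theorem: `deg D - dim D` is bounded. -/
theorem exists_degree_sub_dim_le :
    ∃ γ : ℤ, ∀ D : Divisor K F, degree K F D - dim D ≤ γ := by
  obtain ⟨x, hx, hfin⟩ := IsFunctionField.exists_transcendental (K := K) (F := F)
  obtain ⟨C, hC, h⟩ := exists_le_dim_nsmul_poleDivisor_add hx
  have hdeg := degree_poleDivisor hx
  set n := Module.finrank (IntermediateField.adjoin K {x}) F with hn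
  have hnpos : 0 < n := Module.finrank_pos
  -- The bound is first obtained for multiples of one pole divisor; any effective `A` is then moved
  -- below such a multiple by a principal divisor, which changes neither degree nor dimension.
  have hB : ∀ l : ℕ, degree K F (l • poleDivisor K x) - dim (l • poleDivisor K x) ≤
      degree K F C := fun l => by
    have h1 := degree_sub_dim_mono (A := l • poleDivisor K x) (B := l • poleDivisor K x + C)
      (le_add_of_nonneg_right hC)
    have h2 : (n : ℤ) * (l + 1) ≤ dim (l • poleDivisor K x + C) := by exact_mod_cast h l
    rw [map_add, map_nsmul, hdeg, nsmul_eq_mul] at h1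
    rw [map_nsmul, hdeg, nsmul_eq_mul]
    nlinarith
  refine ⟨degree K F C, fun D => ?_⟩
  refine (degree_sub_dim_mono (le_sup_left : D ≤ D ⊔ 0)).trans ?_
  set A := D ⊔ 0 with hA
  have hA0 : 0 ≤ A := le_sup_right
  -- Chosen so that `dim (l (x)_∞ - A) ≥ n l - deg A - deg C ≥ 1`.
  set l := (degree K F C + degree K F A + 1).toNat with hl
  have hl' : degree K F C + degree K F A + 1 ≤ l := Int.self_le_toNat _
  have h1 := hB l
  have h2 := degree_sub_dim_mono (A := l • poleDivisor K x - A) (B := l • poleDivisor K x)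
    (sub_le_self _ hA0)
  have hpos : 0 < dim (l • poleDivisor K x - A) := by
    rw [map_nsmul, hdeg, nsmul_eq_mul] at h1
    rw [map_sub, map_nsmul, hdeg, nsmul_eq_mul] at h2
    have : (0 : ℤ) < dim (l • poleDivisor K x - A) := by nlinarith [Int.natCast_nonneg l]
    exact_mod_cast this
  obtain ⟨z, hz, hz'⟩ := exists_principalDivisor_add_nonneg hpos
  have hz'' : A + principalDivisor K z⁻¹ ≤ l • poleDivisor K x := by
    rw [principalDivisor_inv, ← sub_nonneg]
    convert hz' using 1
    abel
  have h3 := degree_sub_dim_mono hz''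
  rw [dim_add_principalDivisor A (inv_ne_zero hz), map_add, degree_principalDivisor,
    add_zero] at h3
  exact h3.trans h1

end PrincipalDivisors

/-! ### The adelic index of speciality and Riemann–Roch -/

section Index

variable {K F : Type*} [Field K] [Field F] [Algebra K F]

open Classical in
/-- The adeles concentrated at the place `P`. -/
def singleAdele (P : Place K F) : F →ₗ[K] adeles K F :=
  (LinearMap.single K (fun _ : Place K F => F) P).codRestrict _ fun x =>
    (Set.finite_singleton P).subset fun Q hQ => by
      by_contra h
      refine hQ ?_
      rw [LinearMap.single_apply, Pi.single_eq_of_ne h]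
      exact Q.ring.zero_mem

theorem singleAdele_same (P : Place K F) (x : F) : (singleAdele P x).1 P = x := by
  classical
  exact Pi.single_eq_same (M := fun _ : Place K F => F) P x

theorem singleAdele_of_ne {P Q : Place K F} (h : Q ≠ P) (x : F) : (singleAdele P x).1 Q = 0 := by
  classical
  exact Pi.single_eq_of_ne (M := fun _ : Place K F => F) h x

variable [IsFunctionField K F]

variable (K F) in
theorem bddAbove_degree_sub_dim :
    BddAbove (Set.range fun D : Divisor K F => degree K F D - dim D + 1) := by
  obtain ⟨γ, hγ⟩ := exists_degree_sub_dim_le K F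
  refine ⟨γ + 1, ?_⟩
  rintro _ ⟨D, rfl⟩
  simpa using hγ D

theorem degree_sub_dim_le_genus (D : Divisor K F) : degree K F D - dim D + 1 ≤ genus K F :=
  le_ciSup (bddAbove_degree_sub_dim K F) D

variable (K F) in
theorem exists_degree_sub_dim_eq_genus :
    ∃ D : Divisor K F, degree K F D - dim D + 1 = genus K F := by
  have := Int.csSup_mem (Set.range_nonempty fun D : Divisor K F => degree K F D - dim D + 1)
    (bddAbove_degree_sub_dim K F)
  exact this

/-- The adeles bounded by the divisor `D`. -/
def adeleSpace (D : Divisor K F) : Submodule K (adeles K F) where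
  carrier := {α | ∀ P : Place K F, P.valuation (α.1 P) ≤ WithZero.exp (D P)}
  zero_mem' := fun P => by simp
  add_mem' := fun {α β} hα hβ P =>
    (P.valuation.map_add (α.1 P) (β.1 P)).trans (max_le (hα P) (hβ P))
  smul_mem' := fun c α hα P => (P.ball (D P)).smul_mem c (hα P)

theorem adeleSpace_mono {A B : Divisor K F} (h : A ≤ B) : adeleSpace A ≤ adeleSpace B :=
  fun _ hα P => (hα P).trans (WithZero.exp_le_exp.2 (h P))

theorem finite_notMem_ring (x : F) : {P : Place K F | x ∉ P.ring}.Finite := by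
  refine (finite_support_ord x).subset fun P hP h => hP ?_
  rcases eq_or_ne x 0 with rfl | hx
  · exact P.ring.zero_mem
  · exact (P.valuation_le_one_iff x).1 ((P.ord_eq_zero_iff hx).1 h).le

variable (K F) in
/-- The principal adeles. -/
def constAdele : F →ₗ[K] adeles K F where
  toFun x := ⟨fun _ => x, finite_notMem_ring x⟩
  map_add' _ _ := rfl
  map_smul' _ _ := rfl

theorem exists_mem_adeleSpace (α : adeles K F) : ∃ D : Divisor K F, α ∈ adeleSpace D := by
  refine ⟨Finsupp.ofSupportFinite
    (fun P => 0 ⊔ WithZero.log (P.valuation (α.1 P))) (Set.Finite.subset α.2 fun P hP h => hP ?_),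
    fun P => ?_⟩
  · rw [← P.valuation_le_one_iff] at h
    refine sup_eq_left.2 ?_
    rcases eq_or_ne (P.valuation (α.1 P)) 0 with h0 | h0
    · simp [h0]
    · rw [WithZero.log_le_iff_le_exp h0]
      exact h
  · exact WithZero.le_exp_of_log_le le_sup_right

/-- The sum of the adeles bounded by `D` and the principal adeles. -/
def boundedAddConst (D : Divisor K F) : Submodule K (adeles K F) :=
  adeleSpace D ⊔ LinearMap.range (constAdele K F)

theorem boundedAddConst_mono {A B : Divisor K F} (h : A ≤ B) :
    boundedAddConst A ≤ boundedAddConst B :=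
  sup_le_sup_right (adeleSpace_mono h) _

/-- The index of speciality of a divisor. -/
def index (D : Divisor K F) : ℕ :=
  Module.finrank K (adeles K F ⧸ boundedAddConst D)

theorem sub_single_leading_mem {D : Divisor K F} {P : Place K F} {α : adeles K F}
    (hα : α ∈ adeleSpace (D + Finsupp.single P 1)) {x : F} (hx : P.valuation x ≤
      WithZero.exp ((D + Finsupp.single P 1 : Divisor K F) P))
    (h : P.leading _ ⟨α.1 P, hα P⟩ = P.leading _ ⟨x, hx⟩) :
    α - singleAdele P x ∈ adeleSpace D := by
  intro Q
  change Q.valuation (α.1 Q - (singleAdele P x).1 Q) ≤ _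
  rcases eq_or_ne Q P with rfl | hQ
  · rw [singleAdele_same]
    rw [← sub_eq_zero, ← map_sub, Q.leading_eq_zero_iff] at h
    have h' : Q.valuation (α.1 Q - x) ≤
      WithZero.exp ((D + Finsupp.single Q 1 : Divisor K F) Q - 1) := h
    rwa [Finsupp.add_apply, Finsupp.single_eq_same, add_sub_cancel_right] at h'
  · rw [singleAdele_of_ne hQ, sub_zero]
    have := hα Q
    rwa [Finsupp.add_apply, Finsupp.single_eq_of_ne hQ, add_zero] at this

/-- The connecting map of the exact sequence `L(D + P) → k_P → 𝔸 / (A(D) + F) → 𝔸 / (A(D + P) + F)`: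
a residue is lifted to an element of `F` with that leading coefficient, placed at `P` and extended
by zero. -/
theorem exists_residue_to_quotient (D : Divisor K F) (P : Place K F) :
    ∃ h : IsLocalRing.ResidueField P.ring →ₗ[K] adeles K F ⧸ boundedAddConst D,
      LinearMap.ker h = LinearMap.range (riemannRochSpace.leading D P) ∧
      LinearMap.range h = LinearMap.ker (Submodule.factor (boundedAddConst_mono
        (le_add_of_nonneg_right (single_nonneg P) : D ≤ D + Finsupp.single P 1))) := by
  set n := (D + Finsupp.single P 1 : Divisor K F) P with hn
  obtain ⟨s, hs⟩ := (P.leading n).exists_rightInverse_of_surjective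
    (LinearMap.range_eq_top.2 (P.leading_surjective n))
  have hs' : ∀ y, P.leading n (s y) = y := fun y => LinearMap.congr_fun hs y
  let j : IsLocalRing.ResidueField P.ring →ₗ[K] adeles K F :=
    singleAdele P ∘ₗ (P.ball n).subtype ∘ₗ s
  have hj : ∀ y, j y = singleAdele P (s y : F) := fun _ => rfl
  have hjmem : ∀ y, j y ∈ adeleSpace (D + Finsupp.single P 1) := fun y Q => by
    rw [hj]
    rcases eq_or_ne Q P with rfl | hQ
    · rw [singleAdele_same]
      exact (s y).2
    · rw [singleAdele_of_ne hQ]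
      simp
  refine ⟨(boundedAddConst D).mkQ ∘ₗ j, ?_, ?_⟩
  · ext y
    rw [LinearMap.mem_ker, LinearMap.comp_apply, Submodule.mkQ_apply,
      Submodule.Quotient.mk_eq_zero, LinearMap.mem_range, boundedAddConst, Submodule.mem_sup]
    constructor
    · rintro ⟨β, hβ, _, ⟨x, rfl⟩, hx⟩
      have hxD : constAdele K F x ∈ adeleSpace (D + Finsupp.single P 1) := by
        rw [eq_sub_of_add_eq' hx]
        exact sub_mem (hjmem y)
          (adeleSpace_mono (le_add_of_nonneg_right (single_nonneg P)) hβ)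
      refine ⟨⟨x, hxD⟩, ?_⟩
      change P.leading n ⟨x, _⟩ = y
      rw [← hs' y, ← sub_eq_zero, ← map_sub]
      refine (P.leading_eq_zero_iff _ _).2 ?_
      have h1 := hβ P
      have hn1 : n - 1 = D P := by
        rw [hn, Finsupp.add_apply, Finsupp.single_eq_same, add_sub_cancel_right]
      have h2 : β.1 P + x = (s y : F) := by
        rw [← singleAdele_same P (s y : F), ← hj, ← hx]
        rfl
      change P.valuation (x - (s y : F)) ≤ WithZero.exp (n - 1)
      rw [hn1, ← h2, sub_add_cancel_right, Valuation.map_neg]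
      exact h1
    · rintro ⟨x, hx⟩
      have hx' : P.leading n ⟨x, x.2 P⟩ = y := hx
      have h1 := sub_single_leading_mem (D := D) (P := P) (α := constAdele K F x) x.2 (s y).2
        (hx'.trans (hs' y).symm)
      refine ⟨_, neg_mem h1, _, ⟨x, rfl⟩, ?_⟩
      rw [neg_sub, sub_add_cancel, hj]
  · ext q
    obtain ⟨α, rfl⟩ := Submodule.mkQ_surjective _ q
    rw [LinearMap.mem_ker, Submodule.factor_mk, Submodule.mkQ_apply, Submodule.mkQ_apply,
      Submodule.Quotient.mk_eq_zero, LinearMap.mem_range]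
    constructor
    · rintro ⟨y, hy⟩
      rw [LinearMap.comp_apply, Submodule.mkQ_apply, Submodule.Quotient.eq] at hy
      have h1 := boundedAddConst_mono
        (le_add_of_nonneg_right (single_nonneg P) : D ≤ D + Finsupp.single P 1) hy
      have h2 : j y ∈ boundedAddConst (D + Finsupp.single P 1) :=
        Submodule.mem_sup_left (hjmem y)
      simpa using sub_mem h2 h1
    · intro hα
      obtain ⟨β, hβ, _, ⟨x, rfl⟩, rfl⟩ := Submodule.mem_sup.1 hα
      refine ⟨P.leading n ⟨β.1 P, hβ P⟩, ?_⟩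
      rw [LinearMap.comp_apply, Submodule.mkQ_apply, Submodule.Quotient.eq]
      have h1 := sub_single_leading_mem hβ (s (P.leading n ⟨β.1 P, hβ P⟩)).2 (hs' _).symm
      have h2 : j (P.leading n ⟨β.1 P, hβ P⟩) - (β + constAdele K F x) =
          -(β - j (P.leading n ⟨β.1 P, hβ P⟩)) + constAdele K F (-x) := by
        rw [map_neg]; abel
      rw [h2]
      exact Submodule.add_mem_sup (neg_mem h1) ⟨_, rfl⟩

theorem finite_quotient_of_add_single {D : Divisor K F} {P : Place K F}
    (h : Module.Finite K (adeles K F ⧸ boundedAddConst (D + Finsupp.single P 1))) :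
    Module.Finite K (adeles K F ⧸ boundedAddConst D) := by
  obtain ⟨f, _, hf⟩ := exists_residue_to_quotient D P
  have := P.finite_residueField
  set g := Submodule.factor (boundedAddConst_mono
    (le_add_of_nonneg_right (single_nonneg P) : D ≤ D + Finsupp.single P 1)) with hg
  have h1 : Module.Finite K (LinearMap.ker g) := by
    rw [← hf]; infer_instance
  have := Module.Finite.equiv g.quotKerEquivRange.symm
  exact Module.Finite.of_submodule_quotient (LinearMap.ker g)

/-- Dimension count in the exact sequence above. Together with `dim_add_single` it makes `dim - deg
- index` invariant under adding a place. -/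
theorem index_add_single {D : Divisor K F} {P : Place K F}
    (h : Module.Finite K (adeles K F ⧸ boundedAddConst D)) :
    index D + Module.finrank K (LinearMap.range (riemannRochSpace.leading D P)) =
      index (D + Finsupp.single P 1) + P.degree := by
  obtain ⟨f, hk, hf⟩ := exists_residue_to_quotient D P
  have := P.finite_residueField
  set g := Submodule.factor (boundedAddConst_mono
    (le_add_of_nonneg_right (single_nonneg P) : D ≤ D + Finsupp.single P 1)) with hg
  have h1 := g.finrank_range_add_finrank_ker
  have h2 := f.finrank_range_add_finrank_ker
  rw [LinearMap.range_eq_top.2 (Submodule.factor_surjective _), finrank_top, ← hf] at h1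
  rw [hk] at h2
  rw [index, index, Place.degree]
  omega

/-- When `D` attains the maximum defining the genus, `deg - dim` cannot grow above `D`, so all
leading coefficient maps there are onto and the connecting maps vanish. Hence `A(B) + F` does not
grow with `B ≥ D`, while every adele lies in some `A(B)`. -/
theorem boundedAddConst_eq_top {D : Divisor K F} (hD : degree K F D - dim D + 1 = genus K F) :
    boundedAddConst D = ⊤ := by
  have key : ∀ B, D ≤ B → degree K F B - dim B + 1 = genus K F := fun B hB => by
    have h1 := degree_sub_dim_mono hB
    have h2 := degree_sub_dim_le_genus B
    linarith
  have heq : ∀ B, D ≤ B → boundedAddConst B ≤ boundedAddConst D := fun B hB => by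
    refine divisor_le_induction (p := fun B => boundedAddConst B ≤ boundedAddConst D) le_rfl
      (fun E P hE ih => le_trans ?_ ih) hB
    obtain ⟨f, hk, hf⟩ := exists_residue_to_quotient E P
    have := P.finite_residueField
    have h1 := key E hE
    have h2 := key (E + Finsupp.single P 1) (hE.trans (le_add_of_nonneg_right (single_nonneg P)))
    rw [dim_add_single, map_add, degree_single] at h2
    have h3 : Module.finrank K (LinearMap.range (riemannRochSpace.leading E P)) = P.degree := by
      zify
      push_cast at h2
      linarith
    have h4 : LinearMap.ker f = ⊤ := by
      rw [hk]
      exact Submodule.eq_top_of_finrank_eq h3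
    rw [LinearMap.ker_eq_top] at h4
    intro α hα
    have h5 : (boundedAddConst E).mkQ α ∈ LinearMap.range f := by
      rw [hf, LinearMap.mem_ker, Submodule.factor_mk]
      exact (Submodule.Quotient.mk_eq_zero _).2 hα
    rw [h4, LinearMap.range_zero, Submodule.mem_bot, Submodule.mkQ_apply,
      Submodule.Quotient.mk_eq_zero] at h5
    exact h5
  rw [eq_top_iff]
  intro α _
  obtain ⟨B, hB⟩ := exists_mem_adeleSpace α
  exact heq (D ⊔ B) le_sup_left (Submodule.mem_sup_left (adeleSpace_mono le_sup_right hB))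

/-- The quotient vanishes at a divisor `E` attaining the genus; finiteness descends from `E` to `D ⊓
E` place by place, and passes to `D` by surjectivity. -/
instance finite_quotient_boundedAddConst (D : Divisor K F) :
    Module.Finite K (adeles K F ⧸ boundedAddConst D) := by
  obtain ⟨E, hE⟩ := exists_degree_sub_dim_eq_genus K F
  have h1 : Module.Finite K (adeles K F ⧸ boundedAddConst (D ⊓ E)) := by
    refine divisor_ge_induction (p := fun D => Module.Finite K (adeles K F ⧸ boundedAddConst D))
      (B := E) ?_ (fun D P h => finite_quotient_of_add_single h) inf_le_right
    rw [boundedAddConst_eq_top hE]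
    infer_instance
  exact Module.Finite.of_surjective _
    (Submodule.factor_surjective (boundedAddConst_mono (inf_le_left : D ⊓ E ≤ D)))

/-- The Riemann-Roch theorem, with the index of speciality in place of a canonical divisor. -/
theorem dim_eq_add_index (D : Divisor K F) :
    (dim D : ℤ) = degree K F D + 1 - genus K F + index D := by
  obtain ⟨E, hE⟩ := exists_degree_sub_dim_eq_genus K F
  have hstep : ∀ (D : Divisor K F) (P : Place K F),
      (dim D : ℤ) - degree K F D - index D = dim (D + Finsupp.single P 1) -
        degree K F (D + Finsupp.single P 1) - index (D + Finsupp.single P 1) := fun D P => by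
    have h1 := index_add_single (D := D) (P := P) inferInstance
    zify at h1
    rw [dim_add_single, map_add, degree_single]
    push_cast
    linarith
  have hE0 : index E = 0 := by
    rw [index, boundedAddConst_eq_top hE]
    exact Module.finrank_zero_of_subsingleton
  have h1 : (dim (D ⊓ E) : ℤ) - degree K F (D ⊓ E) - index (D ⊓ E) = 1 - genus K F :=
    divisor_ge_induction (p := fun D => (dim D : ℤ) - degree K F D - index D = 1 - genus K F)
      (by rw [hE0, ← hE]; push_cast; ring) (fun D P h => (hstep D P).trans h) inf_le_right
  have h2 : (dim D : ℤ) - degree K F D - index D = 1 - genus K F :=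
    divisor_le_induction (p := fun D => (dim D : ℤ) - degree K F D - index D = 1 - genus K F)
      h1 (fun D P _ h => (hstep D P).symm.trans h) (inf_le_left : D ⊓ E ≤ D)
  linarith

theorem index_anti {A B : Divisor K F} (h : A ≤ B) : index B ≤ index A :=
  LinearMap.finrank_le_finrank_of_surjective (Submodule.factor_surjective (boundedAddConst_mono h))

theorem index_add_principalDivisor (D : Divisor K F) {z : F} (hz : z ≠ 0) :
    index (D + principalDivisor K z) = index D := by
  have h1 := dim_eq_add_index D
  have h2 := dim_eq_add_index (D + principalDivisor K z)
  rw [dim_add_principalDivisor D hz, map_add, degree_principalDivisor, add_zero] at h2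
  zify
  linarith

-- A divisor of large degree is equivalent to one lying above a fixed `E` of index `0`, and the
-- index decreases as the divisor grows.
variable (K F) in
theorem exists_index_eq_zero_of_le_degree :
    ∃ c : ℤ, ∀ D : Divisor K F, c ≤ degree K F D → index D = 0 := by
  obtain ⟨E, hE⟩ := exists_degree_sub_dim_eq_genus K F
  refine ⟨degree K F E + genus K F, fun D hD => ?_⟩
  have hpos : 0 < dim (D - E) := by
    have := dim_eq_add_index (D - E)
    rw [map_sub] at this
    zify
    linarith [Int.natCast_nonneg (index (D - E))]
  obtain ⟨z, hz, hzE⟩ := exists_principalDivisor_add_nonneg hpos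
  have hle : E ≤ D + principalDivisor K z := by
    rw [← sub_nonneg]
    convert hzE using 1
    abel
  have h0 : index E = 0 := by
    rw [index, boundedAddConst_eq_top hE]
    exact Module.finrank_zero_of_subsingleton
  have := index_anti hle
  rw [index_add_principalDivisor D hz] at this
  omega

end Index

/-! ### Weil differentials, canonical divisors and duality -/

section Differentials

variable {K F : Type*} [Field K] [Field F] [Algebra K F] [IsFunctionField K F]

variable (K F) in
/-- Multiplication of adeles by elements of `F`. -/
def mulAdele : F →ₗ[K] adeles K F →ₗ[K] adeles K F :=
  LinearMap.mk₂ K (fun x α => ⟨fun P => x * α.1 P,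
      ((finite_notMem_ring x).union α.2).subset fun P hP => by
        by_contra h
        simp only [Set.mem_union, Set.mem_ofPred_eq, not_or, not_not] at h
        exact hP (P.ring.mul_mem _ _ h.1 h.2)⟩)
    (fun x y α => Subtype.ext <| funext fun P => add_mul x y (α.1 P))
    (fun c x α => Subtype.ext <| funext fun P => smul_mul_assoc c x (α.1 P))
    (fun x α β => Subtype.ext <| funext fun P => mul_add x (α.1 P) (β.1 P))
    (fun c x α => Subtype.ext <| funext fun P => mul_smul_comm c x (α.1 P))

theorem mulAdele_apply (x : F) (α : adeles K F) (P : Place K F) :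
    (mulAdele K F x α).1 P = x * α.1 P := rfl

theorem mulAdele_mulAdele (x y : F) (α : adeles K F) :
    mulAdele K F x (mulAdele K F y α) = mulAdele K F (x * y) α :=
  Subtype.ext <| funext fun P => (mul_assoc x y (α.1 P)).symm

theorem mulAdele_one (α : adeles K F) : mulAdele K F 1 α = α :=
  Subtype.ext <| funext fun P => one_mul (α.1 P)

theorem mulAdele_constAdele (x y : F) :
    mulAdele K F x (constAdele K F y) = constAdele K F (x * y) := rfl

theorem mulAdele_mem {A B : Divisor K F} {x : F} (hx : x ∈ riemannRochSpace A) {α : adeles K F}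
    (hα : α ∈ adeleSpace B) : mulAdele K F x α ∈ adeleSpace (A + B) := fun P => by
  rw [mulAdele_apply, map_mul, Finsupp.add_apply, WithZero.exp_add]
  exact mul_le_mul' (hx P) (hα P)

/-- The linear forms on the adeles, as a module under multiplication by elements of `F`. -/
def mulForm (ω : adeles K F →ₗ[K] K) : F →ₗ[K] Module.Dual K (adeles K F) :=
  (LinearMap.llcomp K (adeles K F) (adeles K F) K ω) ∘ₗ mulAdele K F

theorem mulForm_apply (ω : adeles K F →ₗ[K] K) (x : F) (α : adeles K F) :
    mulForm ω x α = ω (mulAdele K F x α) := rfl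

theorem mulForm_mulForm (ω : adeles K F →ₗ[K] K) (x y : F) :
    mulForm (mulForm ω x) y = mulForm ω (x * y) :=
  LinearMap.ext fun α => by rw [mulForm_apply, mulForm_apply, mulAdele_mulAdele, mulForm_apply]

theorem mulForm_one (ω : adeles K F →ₗ[K] K) : mulForm ω 1 = ω :=
  LinearMap.ext fun α => by rw [mulForm_apply, mulAdele_one]

theorem mulForm_eq_zero_iff {ω : adeles K F →ₗ[K] K} (hω : ω ≠ 0) {x : F} :
    mulForm ω x = 0 ↔ x = 0 := by
  refine ⟨fun h => ?_, fun h => by rw [h, map_zero]⟩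
  by_contra hx
  refine hω ?_
  rw [← mulForm_one ω, ← mul_inv_cancel₀ hx, ← mulForm_mulForm, h]
  ext α
  rfl

theorem mem_dualAnnihilator_boundedAddConst {ω : adeles K F →ₗ[K] K} {D : Divisor K F} :
    ω ∈ (boundedAddConst D).dualAnnihilator ↔
      (∀ x, ω (constAdele K F x) = 0) ∧ VanishesOn ω D := by
  rw [boundedAddConst, Submodule.dualAnnihilator_sup_eq, Submodule.mem_inf, and_comm,
    Submodule.mem_dualAnnihilator, Submodule.mem_dualAnnihilator]
  exact and_congr (by simp) Iff.rfl

theorem isWeilDifferential_iff {ω : adeles K F →ₗ[K] K} :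
    IsWeilDifferential ω ↔ ∃ D : Divisor K F, ω ∈ (boundedAddConst D).dualAnnihilator := by
  simp only [mem_dualAnnihilator_boundedAddConst, exists_and_left]
  refine and_congr_left fun _ => ⟨fun h x => h x _ fun _ => rfl, fun h x α hα => ?_⟩
  rw [← h x]
  congr 1
  exact Subtype.ext (funext hα)

theorem finrank_dualAnnihilator (D : Divisor K F) :
    Module.finrank K (boundedAddConst D).dualAnnihilator = index D := by
  rw [← (boundedAddConst D).dualQuotEquivDualAnnihilator.finrank_eq, Subspace.dual_finrank_eq]
  rfl

instance finite_dualAnnihilator (D : Divisor K F) :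
    Module.Finite K (boundedAddConst D).dualAnnihilator :=
  Module.Finite.equiv (boundedAddConst D).dualQuotEquivDualAnnihilator

theorem mulForm_mem_dualAnnihilator {ω : adeles K F →ₗ[K] K} {D E : Divisor K F}
    (hω : ω ∈ (boundedAddConst E).dualAnnihilator) {x : F} (hx : x ∈ riemannRochSpace (E - D)) :
    mulForm ω x ∈ (boundedAddConst D).dualAnnihilator := by
  rw [mem_dualAnnihilator_boundedAddConst] at hω ⊢
  refine ⟨fun y => ?_, fun α hα => ?_⟩
  · rw [mulForm_apply, mulAdele_constAdele, hω.1]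
  · refine hω.2 _ ?_
    have := mulAdele_mem hx (B := D) hα
    rwa [sub_add_cancel] at this

/-- An adele bounded by `A ⊔ B` splits, place by place according to which divisor is larger, into a
part bounded by `A` and a part bounded by `B`. -/
theorem VanishesOn.sup {ω : adeles K F →ₗ[K] K} {A B : Divisor K F} (hA : VanishesOn ω A)
    (hB : VanishesOn ω B) : VanishesOn ω (A ⊔ B) := by
  classical
  intro α hα
  let β : adeles K F := ⟨fun P => if B P ≤ A P then α.1 P else 0, Set.Finite.subset α.2
    fun P hP h => hP <| by
      simp only
      split_ifs
      · exact h
      · exact P.ring.zero_mem⟩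
  let δ : adeles K F := ⟨fun P => if B P ≤ A P then 0 else α.1 P, Set.Finite.subset α.2
    fun P hP h => hP <| by
      simp only
      split_ifs
      · exact P.ring.zero_mem
      · exact h⟩
  have hsum : α = β + δ := Subtype.ext <| funext fun P => by
    change α.1 P = (if B P ≤ A P then α.1 P else 0) + (if B P ≤ A P then 0 else α.1 P)
    split_ifs <;> simp
  have hle : ∀ P : Place K F, P.valuation (α.1 P) ≤ WithZero.exp (A P ⊔ B P) := hα
  have h1 : ω β = 0 := hA β fun P => by
    change P.valuation (if B P ≤ A P then α.1 P else 0) ≤ _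
    split_ifs with h
    · exact (hle P).trans_eq (by rw [sup_eq_left.2 h])
    · simp
  have h2 : ω δ = 0 := hB δ fun P => by
    change P.valuation (if B P ≤ A P then 0 else α.1 P) ≤ _
    split_ifs with h
    · simp
    · exact (hle P).trans_eq (by rw [sup_eq_right.2 (not_le.1 h).le])
  rw [hsum, map_add, h1, h2, add_zero]

/-- A nonzero `ω` cannot vanish on divisors of index `0`, so the degrees in question are bounded. A
divisor of maximal degree is then greatest, because the set is closed under suprema. -/
theorem exists_isGreatest_vanishesOn {ω : adeles K F →ₗ[K] K} (hω : IsWeilDifferential ω)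
    (hω0 : ω ≠ 0) : ∃ W : Divisor K F, IsGreatest {D | VanishesOn ω D} W := by
  obtain ⟨c, hc⟩ := exists_index_eq_zero_of_le_degree K F
  obtain ⟨D, hD⟩ := isWeilDifferential_iff.1 hω
  rw [mem_dualAnnihilator_boundedAddConst] at hD
  have hbd : ∀ E, VanishesOn ω E → degree K F E ≤ c := fun E hE => by
    by_contra h
    have h0 := hc E (not_le.1 h).le
    rw [← finrank_dualAnnihilator, Submodule.finrank_eq_zero] at h0
    have := mem_dualAnnihilator_boundedAddConst.2 ⟨hD.1, hE⟩
    rw [h0, Submodule.mem_bot] at this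
    exact hω0 this
  obtain ⟨_, ⟨W, hW, rfl⟩, hmax⟩ := Int.exists_greatest_of_bdd
    (P := fun n => ∃ E, VanishesOn ω E ∧ degree K F E = n)
    ⟨c, by rintro _ ⟨E, hE, rfl⟩; exact hbd E hE⟩ ⟨_, D, hD.2, rfl⟩
  refine ⟨W, hW, fun E hE => ?_⟩
  have h1 := hmax _ ⟨W ⊔ E, hW.sup hE, rfl⟩
  have h2 := eq_of_le_of_degree_le (le_sup_left : W ≤ W ⊔ E) h1
  rw [h2]
  exact le_sup_right

variable (K F) in
theorem exists_isCanonical : ∃ W : Divisor K F, IsCanonical W := by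
  obtain ⟨P⟩ := nonempty_place K F
  -- By Riemann–Roch the index of `-nP` is at least `n deg P + g - 1`, which this `n` makes
  -- positive; a nonzero differential exists.
  set n := (2 - genus K F).toNat with hn
  have hpos : 0 < index (-(n • Finsupp.single P 1) : Divisor K F) := by
    have h1 := dim_eq_add_index (-(n • Finsupp.single P 1) : Divisor K F)
    rw [map_neg, map_nsmul, degree_single, one_mul, nsmul_eq_mul] at h1
    have h2 : 2 - genus K F ≤ n := Int.self_le_toNat _
    have h3 : (1 : ℤ) ≤ P.degree := by exact_mod_cast P.degree_pos
    zify
    nlinarith [Int.natCast_nonneg n, Int.natCast_nonneg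
      (dim (-(n • Finsupp.single P 1) : Divisor K F))]
  rw [← finrank_dualAnnihilator] at hpos
  have := Module.nontrivial_of_finrank_pos hpos
  obtain ⟨⟨ω, hω⟩, hω0⟩ := exists_ne
    (0 : (boundedAddConst (-(n • Finsupp.single P 1) : Divisor K F)).dualAnnihilator)
  have hω0' : ω ≠ 0 := fun h => hω0 (Subtype.ext h)
  have hW := isWeilDifferential_iff.2 ⟨_, hω⟩
  obtain ⟨W, hgr⟩ := exists_isGreatest_vanishesOn hW hω0'
  exact ⟨W, ω, hW, hω0', hgr⟩

theorem dim_neg_eq_zero {D : Divisor K F} {P : Place K F} (h : Finsupp.single P 1 ≤ D) :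
    dim (-D) = 0 := by
  have h1 := riemannRochSpace_mono (neg_le_neg h)
  rw [riemannRochSpace_neg_single, le_bot_iff] at h1
  rw [dim, h1, finrank_bot]

/-- The Weil differentials form a one-dimensional vector space over `F`. -/
theorem exists_eq_mulForm {ω η : adeles K F →ₗ[K] K} (hω : IsWeilDifferential ω) (hω0 : ω ≠ 0)
    (hη : IsWeilDifferential η) : ∃ x : F, η = mulForm ω x := by
  by_contra hne
  obtain ⟨A, hA⟩ := isWeilDifferential_iff.1 hω
  obtain ⟨B, hB⟩ := isWeilDifferential_iff.1 hη
  obtain ⟨P⟩ := nonempty_place K F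
  -- The dimensions `dim (A + C) + dim (B + C)` grow like `2 deg C`, but `index (-C)` only like `deg
  -- C`. The inequality between them would force `deg C ≤ -(deg A + deg B + 3 - 3g)`, which this `n`
  -- excludes.
  set n := (1 + |degree K F A + degree K F B + 3 - 3 * genus K F|).toNat with hn
  have hn' : 1 + |degree K F A + degree K F B + 3 - 3 * genus K F| ≤ n := Int.self_le_toNat _
  have hn1 : 1 ≤ n := by
    have := abs_nonneg (degree K F A + degree K F B + 3 - 3 * genus K F)
    omega
  set C : Divisor K F := n • Finsupp.single P 1 with hC
  have hPC : Finsupp.single P 1 ≤ C := by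
    have := nsmul_le_nsmul_left (single_nonneg P) hn1
    rwa [one_nsmul] at this
  -- The map `(x, y) ↦ xω + yη` would be injective if `η` were not an `F`-multiple of `ω`.
  let f : (riemannRochSpace (A - -C) × riemannRochSpace (B - -C)) →ₗ[K]
      (boundedAddConst (-C)).dualAnnihilator :=
    LinearMap.coprod
      (((mulForm ω) ∘ₗ (riemannRochSpace (A - -C)).subtype).codRestrict _
        fun x => mulForm_mem_dualAnnihilator hA x.2)
      (((mulForm η) ∘ₗ (riemannRochSpace (B - -C)).subtype).codRestrict _
        fun x => mulForm_mem_dualAnnihilator hB x.2)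
  have hf : Function.Injective f := by
    refine (injective_iff_map_eq_zero f).2 ?_
    rintro ⟨⟨x, hx⟩, ⟨y, hy⟩⟩ hxy
    have h1 : mulForm ω x + mulForm η y = 0 := congrArg Subtype.val hxy
    have hy0 : y = 0 := by
      by_contra hy0
      refine hne ⟨-x * y⁻¹, ?_⟩
      rw [← mulForm_mulForm, map_neg, neg_eq_of_add_eq_zero_right h1, mulForm_mulForm,
        mul_inv_cancel₀ hy0, mulForm_one]
    subst hy0
    rw [map_zero, add_zero, mulForm_eq_zero_iff hω0] at h1
    subst h1
    rfl
  have h1 := LinearMap.finrank_le_finrank_of_injective hf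
  rw [Module.finrank_prod, finrank_dualAnnihilator] at h1
  have h2 := dim_eq_add_index (A - -C)
  have h3 := dim_eq_add_index (B - -C)
  have h4 := dim_eq_add_index (-C)
  rw [dim_neg_eq_zero hPC, map_neg] at h4
  rw [sub_neg_eq_add, map_add] at h2 h3
  have h5 : degree K F C = n * P.degree := by
    rw [hC, map_nsmul, degree_single, one_mul, nsmul_eq_mul]
  have h6 : (dim (A + C) : ℤ) + dim (B + C) ≤ index (-C) := by
    rw [sub_neg_eq_add, sub_neg_eq_add] at h1
    exact_mod_cast h1
  have h7 : (1 : ℤ) ≤ P.degree := by exact_mod_cast P.degree_pos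
  have h8 := neg_abs_le (degree K F A + degree K F B + 3 - 3 * genus K F)
  push_cast at h4
  nlinarith [Int.natCast_nonneg (index (A + C)), Int.natCast_nonneg (index (B + C))]

/-- The duality theorem. -/
theorem index_eq_dim_sub {W : Divisor K F} (hW : IsCanonical W) (D : Divisor K F) :
    index D = dim (W - D) := by
  obtain ⟨ω, hω, hω0, hgr⟩ := hW
  have hωW : ω ∈ (boundedAddConst W).dualAnnihilator := by
    obtain ⟨E, hE⟩ := isWeilDifferential_iff.1 hω
    exact mem_dualAnnihilator_boundedAddConst.2
      ⟨(mem_dualAnnihilator_boundedAddConst.1 hE).1, hgr.1⟩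
  let f : riemannRochSpace (W - D) →ₗ[K] (boundedAddConst D).dualAnnihilator :=
    ((mulForm ω) ∘ₗ (riemannRochSpace (W - D)).subtype).codRestrict _
      fun x => mulForm_mem_dualAnnihilator hωW x.2
  have hf : Function.Bijective f := by
    constructor
    · refine (injective_iff_map_eq_zero f).2 ?_
      rintro ⟨x, hx⟩ h
      exact Subtype.ext ((mulForm_eq_zero_iff hω0).1 (congrArg Subtype.val h))
    · rintro ⟨η, hη⟩
      obtain ⟨x, rfl⟩ := exists_eq_mulForm hω hω0 (isWeilDifferential_iff.2 ⟨D, hη⟩)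
      rcases eq_or_ne x 0 with rfl | hx
      · exact ⟨0, Subtype.ext (by simp [f])⟩
      -- Since `ω(α) = (xω)(x⁻¹α)`, vanishing of `xω` on `A(D)` is vanishing of `ω` on `A(D - (x))`;
      -- maximality of `W` then says `x ∈ L(W - D)`.
      have hv : VanishesOn ω (D - principalDivisor K x) := fun α hα => by
        have h1 := (mem_dualAnnihilator_boundedAddConst.1 hη).2 (mulAdele K F x⁻¹ α) ?_
        · rwa [mulForm_apply, mulAdele_mulAdele, mul_inv_cancel₀ hx, mulAdele_one] at h1
        · have hx' : x⁻¹ ∈ riemannRochSpace (principalDivisor K x) := by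
            rw [mem_riemannRochSpace_iff (inv_ne_zero hx), principalDivisor_inv, neg_add_cancel]
          have := mulAdele_mem hx' (B := D - principalDivisor K x) hα
          rwa [add_sub_cancel] at this
      have hle := hgr.2 hv
      refine ⟨⟨x, ?_⟩, rfl⟩
      rw [mem_riemannRochSpace_iff hx]
      have := sub_nonneg.2 hle
      convert this using 1
      abel
  rw [← finrank_dualAnnihilator, ← (LinearEquiv.ofBijective f hf).finrank_eq, dim]

/-- Duality makes the condition independent of the canonical divisor, and replaces it by an index
that involves none. -/
theorem isNonSpecial_iff {D : Divisor K F} : IsNonSpecial D ↔ index D = 0 := by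
  constructor
  · rintro ⟨W, hW, h⟩
    rw [index_eq_dim_sub hW, h]
  · intro h
    obtain ⟨W, hW⟩ := exists_isCanonical K F
    exact ⟨W, hW, by rw [← index_eq_dim_sub hW, h]⟩

theorem riemannRochSpace_zero_eq (hK : ∀ x : F, IsAlgebraic K x → x ∈ Set.range (algebraMap K F)) :
    riemannRochSpace (0 : Divisor K F) = 1 := by
  ext x
  rw [Submodule.mem_one]
  refine ⟨fun h => hK x (isAlgebraic_of_mem_riemannRochSpace_zero h), ?_⟩
  rintro ⟨c, rfl⟩ P
  exact P.valuation_algebraMap_le_one c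

theorem dim_zero (hK : ∀ x : F, IsAlgebraic K x → x ∈ Set.range (algebraMap K F)) :
    dim (0 : Divisor K F) = 1 := by
  rw [dim, riemannRochSpace_zero_eq hK, Submodule.one_eq_span]
  exact finrank_span_singleton one_ne_zero

/-- Riemann–Roch at `0` gives `dim W = g`; Riemann–Roch at `W` then gives the degree. -/
theorem degree_canonical (hK : ∀ x : F, IsAlgebraic K x → x ∈ Set.range (algebraMap K F))
    {W : Divisor K F} (hW : IsCanonical W) : degree K F W = 2 * genus K F - 2 := by
  have h1 := dim_eq_add_index (0 : Divisor K F)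
  have h2 := dim_eq_add_index W
  rw [index_eq_dim_sub hW, dim_zero hK, map_zero, sub_zero] at h1
  rw [index_eq_dim_sub hW, sub_self, dim_zero hK] at h2
  push_cast at h1 h2
  linarith

theorem genus_nonneg (hK : ∀ x : F, IsAlgebraic K x → x ∈ Set.range (algebraMap K F)) :
    0 ≤ genus K F := by
  have := degree_sub_dim_le_genus (0 : Divisor K F)
  rw [dim_zero hK] at this
  simpa using this

end Differentials

/-! ### Finiteness of the class number and effective divisors in a class -/

section Counting

variable {K F : Type*} [Field K] [Field F] [Algebra K F] [IsFunctionField K F]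

/-- For a transcendental `x` and `N = q ^ m`, a place of degree `m` is either a pole of `x` or a
zero of `x ^ N - x`, because its residue field has `N` elements. -/
theorem finite_places_of_degree [Finite K] (m : ℕ) : {P : Place K F | P.degree = m}.Finite := by
  rcases Nat.eq_zero_or_pos m with rfl | hm
  · convert Set.finite_empty
    ext P
    simpa using P.degree_pos.ne'
  have := Fintype.ofFinite K
  obtain ⟨x, hx, _⟩ := IsFunctionField.exists_transcendental (K := K) (F := F)
  set N := Nat.card K ^ m with hN
  have hy : x ^ N - x ≠ 0 := fun h => by
    have h1 : Polynomial.aeval x (Polynomial.X ^ N - Polynomial.X : Polynomial K) = 0 := by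
      simpa using h
    exact FiniteField.X_pow_card_sub_X_ne_zero K
      (one_lt_pow₀ Finite.one_lt_card hm.ne') (transcendental_iff.1 hx _ h1)
  refine ((finite_notMem_ring x).union (finite_support_ord (x ^ N - x))).subset fun P hP => ?_
  by_contra hc
  simp only [Set.mem_union, Set.mem_ofPred_eq, not_or, not_not, Function.mem_support] at hc
  have hP' : P.degree = m := hP
  have hfin := P.finite_residueField
  have : Finite (IsLocalRing.ResidueField P.ring) := Module.finite_of_finite K
  have := Fintype.ofFinite (IsLocalRing.ResidueField P.ring)
  have hcard : Fintype.card (IsLocalRing.ResidueField P.ring) = N := by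
    rw [← Nat.card_eq_fintype_card, Module.natCard_eq_pow_finrank (K := K), hN, ← hP']
    rfl
  have h1 := FiniteField.pow_card (IsLocalRing.residue P.ring ⟨x, hc.1⟩)
  rw [hcard, ← map_pow, ← sub_eq_zero, ← map_sub, IsLocalRing.residue_eq_zero_iff,
    ← P.valuation_lt_one_iff] at h1
  exact h1.ne ((P.ord_eq_zero_iff hy).1 hc.2)

theorem finite_places_of_degree_le [Finite K] (n : ℤ) :
    {P : Place K F | (P.degree : ℤ) ≤ n}.Finite := by
  refine ((Set.finite_Iic n.toNat).biUnion fun m _ => finite_places_of_degree m).subset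
    fun P hP => Set.mem_iUnion₂.2 ⟨P.degree, ?_, rfl⟩
  have : (P.degree : ℤ) ≤ n := hP
  simp only [Set.mem_Iic]
  omega

instance finite_effective [Finite K] (n : ℤ) :
    Finite {D : Divisor K F // 0 ≤ D ∧ degree K F D = n} := by
  have hS := finite_places_of_degree_le (K := K) (F := F) n
  have := hS.to_subtype
  let f : {D : Divisor K F // 0 ≤ D ∧ degree K F D = n} →
      ({P : Place K F | (P.degree : ℤ) ≤ n} → Set.Icc 0 n) := fun D P =>
    ⟨D.1 P, D.2.1 P, (apply_le_degree D.2.1 P).trans D.2.2.le⟩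
  refine Finite.of_injective f fun D E h => Subtype.ext (Finsupp.ext fun P => ?_)
  by_cases hP : (P.degree : ℤ) ≤ n
  · exact congrArg Subtype.val (congrFun h ⟨P, hP⟩)
  · have key : ∀ D : {D : Divisor K F // 0 ≤ D ∧ degree K F D = n}, D.1 P = 0 := fun D => by
      have h1 := apply_mul_degree_le D.2.1 P
      have h2 : 0 ≤ D.1 P := D.2.1 P
      rw [D.2.2] at h1
      by_contra h0
      have h3 : 1 ≤ D.1 P := by omega
      nlinarith [Int.natCast_nonneg P.degree]
    rw [key D, key E]

variable (K F) in
/-- The degree of a divisor class. -/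
def classDegree : DivisorClassGroup K F →+ ℤ :=
  QuotientAddGroup.lift _ (degree K F) fun D hD => by
    obtain ⟨x, _, rfl⟩ := mem_principalDivisors_iff.1 hD
    exact degree_principalDivisor x

theorem classDegree_mk (D : Divisor K F) :
    classDegree K F (QuotientAddGroup.mk D) = degree K F D := rfl

theorem mem_classGroupZero {c : DivisorClassGroup K F} :
    c ∈ classGroupZero K F ↔ classDegree K F c = 0 := by
  obtain ⟨D, rfl⟩ := QuotientAddGroup.mk_surjective c
  rw [classDegree_mk]
  constructor
  · rintro ⟨E, hE, h⟩
    have := congrArg (classDegree K F) h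
    rw [← classDegree_mk, ← this]
    exact hE
  · intro h
    exact ⟨D, h, rfl⟩

variable (K F) in
/-- The set of the divisor classes of degree `n`. -/
abbrev ClassOfDegree (n : ℤ) : Type _ := {c : DivisorClassGroup K F // classDegree K F c = n}

theorem card_classOfDegree {n : ℤ} (D : Divisor K F) (hD : degree K F D = n) :
    Nat.card (ClassOfDegree K F n) = classNumber K F := by
  refine Nat.card_congr ((Equiv.subRight (QuotientAddGroup.mk D)).subtypeEquiv fun c => ?_)
  rw [mem_classGroupZero, Equiv.subRight_apply, map_sub, classDegree_mk, hD, sub_eq_zero]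

/-- The effective divisors in a given class. -/
abbrev EffectiveInClass (c : DivisorClassGroup K F) : Type _ :=
  {D : Divisor K F // 0 ≤ D ∧ (QuotientAddGroup.mk D : DivisorClassGroup K F) = c}

instance finite_effectiveInClass [Finite K] (c : DivisorClassGroup K F) :
    Finite (EffectiveInClass c) :=
  Finite.of_injective (β := {D : Divisor K F // 0 ≤ D ∧ degree K F D = classDegree K F c})
    (fun D => ⟨D.1, D.2.1, by rw [← classDegree_mk, D.2.2]⟩)
    fun _ _ h => Subtype.ext (congrArg (fun D => D.1) h)

variable (K F) in
/-- The effective divisors of degree `n`, sorted by their classes. -/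
def effectiveEquivSigma (n : ℤ) : {D : Divisor K F // 0 ≤ D ∧ degree K F D = n} ≃
    Σ c : ClassOfDegree K F n, EffectiveInClass c.1 where
  toFun D := ⟨⟨QuotientAddGroup.mk D.1, D.2.2⟩, ⟨D.1, D.2.1, rfl⟩⟩
  invFun E := ⟨E.2.1, E.2.2.1, by rw [← classDegree_mk, E.2.2.2, E.1.2]⟩
  left_inv _ := rfl
  right_inv := by
    rintro ⟨⟨c, hc⟩, ⟨D, hD, h⟩⟩
    change (QuotientAddGroup.mk D : DivisorClassGroup K F) = c at h
    subst h
    rfl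

theorem mk_eq_mk_iff {D E : Divisor K F} :
    (QuotientAddGroup.mk E : DivisorClassGroup K F) = QuotientAddGroup.mk D ↔
      ∃ x : F, x ≠ 0 ∧ E = D + principalDivisor K x := by
  rw [eq_comm, QuotientAddGroup.eq, mem_principalDivisors_iff]
  refine exists_congr fun x => and_congr_right fun _ => ?_
  rw [neg_add_eq_iff_eq_add]

theorem exists_effective_of_dim_pos {D : Divisor K F} (h : 0 < dim D) :
    Nonempty (EffectiveInClass (QuotientAddGroup.mk D : DivisorClassGroup K F)) := by
  obtain ⟨x, hx, hxD⟩ := exists_principalDivisor_add_nonneg h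
  exact ⟨⟨_, hxD, mk_eq_mk_iff.2 ⟨x, hx, rfl⟩⟩⟩

theorem dim_pos_of_effective {D : Divisor K F} (hD : 0 ≤ D) : 0 < dim D := by
  have : Nontrivial (riemannRochSpace D) :=
    ⟨⟨1, one_mem_riemannRochSpace hD⟩, 0, fun h => one_ne_zero (congrArg Subtype.val h)⟩
  exact Module.finrank_pos

theorem dim_eq_of_mk_eq {D E : Divisor K F}
    (h : (QuotientAddGroup.mk E : DivisorClassGroup K F) = QuotientAddGroup.mk D) :
    dim E = dim D := by
  obtain ⟨x, hx, rfl⟩ := mk_eq_mk_iff.1 h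
  exact dim_add_principalDivisor D hx

-- In a sufficiently large degree every class contains an effective divisor, and there are finitely
-- many of these; translation by a fixed divisor carries the finiteness to degree `0`.
variable (K F) in
theorem finite_classOfDegree_zero [Finite K] : Finite (ClassOfDegree K F 0) := by
  obtain ⟨P⟩ := nonempty_place K F
  obtain ⟨γ, hγ⟩ := exists_degree_sub_dim_le K F
  set k := (γ + 1).toNat with hk
  set A : Divisor K F := k • Finsupp.single P 1 with hA
  have hdeg : γ < degree K F A := by
    rw [hA, map_nsmul, degree_single, one_mul, nsmul_eq_mul]
    have h1 : γ + 1 ≤ k := Int.self_le_toNat _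
    have h2 : (1 : ℤ) ≤ P.degree := by exact_mod_cast P.degree_pos
    nlinarith [Int.natCast_nonneg k]
  have h1 : Finite (ClassOfDegree K F (degree K F A)) := by
    refine Finite.of_surjective
      (fun D : {D : Divisor K F // 0 ≤ D ∧ degree K F D = degree K F A} =>
        (⟨QuotientAddGroup.mk D.1, D.2.2⟩ : ClassOfDegree K F (degree K F A))) ?_
    rintro ⟨c, hc⟩
    obtain ⟨D, rfl⟩ := QuotientAddGroup.mk_surjective c
    rw [classDegree_mk] at hc
    have hpos : 0 < dim D := by
      have := hγ D
      zify
      linarith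
    obtain ⟨E⟩ := exists_effective_of_dim_pos hpos
    exact ⟨⟨E.1, E.2.1, by rw [← classDegree_mk, E.2.2, classDegree_mk, hc]⟩, Subtype.ext E.2.2⟩
  refine Finite.of_injective (β := ClassOfDegree K F (degree K F A))
    (fun c => ⟨c.1 + QuotientAddGroup.mk A, by rw [map_add, c.2, zero_add, classDegree_mk]⟩)
    fun c d h => Subtype.ext (add_right_cancel (congrArg Subtype.val h))

instance finite_classOfDegree [Finite K] (n : ℤ) : Finite (ClassOfDegree K F n) := by
  have := finite_classOfDegree_zero K F
  rcases isEmpty_or_nonempty (ClassOfDegree K F n) with h | ⟨⟨d, hd⟩⟩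
  · infer_instance
  refine Finite.of_injective (β := ClassOfDegree K F 0)
    (fun c => ⟨c.1 - d, by rw [map_sub, c.2, hd, sub_self]⟩)
    fun c e h => Subtype.ext (sub_left_injective (congrArg Subtype.val h))

theorem numEffective_eq_sum [Finite K] [∀ n, Fintype (ClassOfDegree K F n)] (n : ℤ) :
    numEffective K F n = ∑ c : ClassOfDegree K F n, Nat.card (EffectiveInClass c.1) := by
  rw [numEffective, Nat.card_congr (effectiveEquivSigma K F n), Nat.card_sigma]

theorem card_mul_le_numEffective [Finite K] {n : ℤ} {m : ℕ}
    (h : ∀ D : Divisor K F, degree K F D = n →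
      m ≤ Nat.card (EffectiveInClass (QuotientAddGroup.mk D : DivisorClassGroup K F))) :
    Nat.card (ClassOfDegree K F n) * m ≤ numEffective K F n := by
  have := fun n => Fintype.ofFinite (ClassOfDegree K F n)
  rw [numEffective_eq_sum, Nat.card_eq_fintype_card, ← smul_eq_mul, ← Finset.card_univ]
  refine Finset.card_nsmul_le_sum _ _ _ ?_
  rintro ⟨c, hc⟩ _
  obtain ⟨D, rfl⟩ := QuotientAddGroup.mk_surjective c
  exact h D hc

theorem numEffective_le_card_mul [Finite K] {n : ℤ} {m : ℕ}
    (h : ∀ D : Divisor K F, degree K F D = n →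
      Nat.card (EffectiveInClass (QuotientAddGroup.mk D : DivisorClassGroup K F)) ≤ m) :
    numEffective K F n ≤ Nat.card (ClassOfDegree K F n) * m := by
  have := fun n => Fintype.ofFinite (ClassOfDegree K F n)
  rw [numEffective_eq_sum, Nat.card_eq_fintype_card, ← smul_eq_mul, ← Finset.card_univ]
  refine Finset.sum_le_card_nsmul _ _ _ ?_
  rintro ⟨c, hc⟩ _
  obtain ⟨D, rfl⟩ := QuotientAddGroup.mk_surjective c
  exact h D hc

theorem exists_mem_riemannRochSpace_of_effectiveInClass {D : Divisor K F}
    (E : EffectiveInClass (QuotientAddGroup.mk D : DivisorClassGroup K F)) :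
    ∃ x : F, x ≠ 0 ∧ x ∈ riemannRochSpace D ∧ E.1 = D + principalDivisor K x := by
  obtain ⟨x, hx, h⟩ := mk_eq_mk_iff.1 E.2.2
  exact ⟨x, hx, by rw [mem_riemannRochSpace_iff hx, add_comm, ← h]; exact E.2.1, h⟩

theorem natCard_riemannRochSpace [Finite K] (D : Divisor K F) :
    Nat.card (riemannRochSpace D) = Nat.card K ^ dim D :=
  Module.natCard_eq_pow_finrank

theorem card_effectiveInClass_le [Finite K] (D : Divisor K F) :
    Nat.card (EffectiveInClass (QuotientAddGroup.mk D : DivisorClassGroup K F)) ≤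
      Nat.card K ^ dim D := by
  rw [← natCard_riemannRochSpace]
  have : Finite (riemannRochSpace D) := Module.finite_of_finite K
  choose x _ hxD hx using fun E => exists_mem_riemannRochSpace_of_effectiveInClass (D := D) E
  refine Nat.card_le_card_of_injective (fun E => (⟨x E, hxD E⟩ : riemannRochSpace D))
    fun E E' h => Subtype.ext ?_
  have hxE : x E = x E' := congrArg Subtype.val h
  rw [hx E, hx E', hxE]

theorem eq_algebraMap_mul_of_principalDivisor_eq
    (hK : ∀ x : F, IsAlgebraic K x → x ∈ Set.range (algebraMap K F)) {x y : F} (hx : x ≠ 0)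
    (hy : y ≠ 0) (h : principalDivisor K x = principalDivisor K y) :
    ∃ c : K, x = algebraMap K F c * y := by
  have h1 : x * y⁻¹ ∈ riemannRochSpace (0 : Divisor K F) := by
    rw [mem_riemannRochSpace_iff (mul_ne_zero hx (inv_ne_zero hy)),
      principalDivisor_mul hx (inv_ne_zero hy), principalDivisor_inv, h, add_neg_cancel, add_zero]
  obtain ⟨c, hc⟩ := hK _ (isAlgebraic_of_mem_riemannRochSpace_zero h1)
  exact ⟨c, by rw [hc, inv_mul_cancel_right₀ hy]⟩

/-- Functions with the same divisor differ by a constant, so a nonzero element of `L(D)` is given by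
an effective divisor and a scalar in `Kˣ`; the final `1` accounts for zero. -/
theorem pow_dim_le_card_effectiveInClass [Finite K]
    (hK : ∀ x : F, IsAlgebraic K x → x ∈ Set.range (algebraMap K F)) (D : Divisor K F) :
    Nat.card K ^ dim D ≤ Nat.card (EffectiveInClass
      (QuotientAddGroup.mk D : DivisorClassGroup K F)) * (Nat.card K - 1) + 1 := by
  rw [← natCard_riemannRochSpace, ← Nat.card_units, ← Nat.card_prod, ← Finite.card_option]
  choose x hx0 hxD hx using fun E => exists_mem_riemannRochSpace_of_effectiveInClass (D := D) E
  refine Nat.card_le_card_of_surjective (fun p : Option (EffectiveInClass _ × Kˣ) =>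
    (p.elim 0 fun p => (p.2 : K) • ⟨x p.1, hxD p.1⟩ : riemannRochSpace D)) ?_
  rintro ⟨y, hy⟩
  rcases eq_or_ne y 0 with rfl | hy0
  · exact ⟨none, rfl⟩
  let E : EffectiveInClass (QuotientAddGroup.mk D : DivisorClassGroup K F) :=
    ⟨D + principalDivisor K y, by rw [add_comm]; exact (mem_riemannRochSpace_iff hy0).1 hy,
      mk_eq_mk_iff.2 ⟨y, hy0, rfl⟩⟩
  obtain ⟨c, hc⟩ := eq_algebraMap_mul_of_principalDivisor_eq hK hy0 (hx0 E)
    (add_left_cancel (hx E))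
  have hc0 : c ≠ 0 := by
    rintro rfl
    exact hy0 (by rw [hc, map_zero, zero_mul])
  refine ⟨some (E, Units.mk0 c hc0), Subtype.ext ?_⟩
  change c • x E = y
  rw [hc, Algebra.smul_def]

end Counting

/-! ### Finite extensions of function fields -/

section FiniteExtension

open IntermediateField in
theorem isFunctionField_of_finite (K F F' : Type*) [Field K] [Field F] [Field F'] [Algebra K F]
    [Algebra K F'] [Algebra F F'] [IsScalarTower K F F'] [Module.Finite F F']
    [IsFunctionField K F] : IsFunctionField K F' := by
  obtain ⟨x, hx, hfin⟩ := IsFunctionField.exists_transcendental (K := K) (F := F)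
  refine ⟨algebraMap F F' x, (transcendental_algebraMap_iff (algebraMap F F').injective).2 hx, ?_⟩
  have hmem : ∀ y : K⟮x⟯, algebraMap F F' y ∈ K⟮algebraMap F F' x⟯ := fun y => by
    have h1 : K⟮x⟯.map (IsScalarTower.toAlgHom K F F') = K⟮algebraMap F F' x⟯ := by
      rw [adjoin_map, Set.image_singleton]
      rfl
    rw [← h1]
    exact ⟨y, y.2, rfl⟩
  let f : K⟮x⟯ →+* K⟮algebraMap F F' x⟯ :=
    ((algebraMap F F').comp (algebraMap K⟮x⟯ F)).codRestrict
      K⟮algebraMap F F' x⟯.toSubfield hmem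
  let : Algebra K⟮x⟯ K⟮algebraMap F F' x⟯ := f.toAlgebra
  have : IsScalarTower K⟮x⟯ K⟮algebraMap F F' x⟯ F' := IsScalarTower.of_algebraMap_eq fun _ => rfl
  have : Module.Finite K⟮x⟯ F' := Module.Finite.trans F F'
  exact Module.Finite.of_restrictScalars_finite K⟮x⟯ _ F'

end FiniteExtension

/-! ### Splitting of places when a constant root is adjoined -/

section ConstantExtension

variable {K F F' : Type*} [Field K] [Field F] [Field F'] [Algebra K F] [Algebra K F']
  [Algebra F F'] [IsScalarTower K F F'] [IsFunctionField K F] [IsFunctionField K F']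

open Polynomial

/-- The inclusion of the valuation ring of a place of `F` into an extension of `F`. -/
def Place.toExtension (P : Place K F) (F' : Type*) [Field F'] [Algebra F F'] : P.ring →+* F' :=
  (algebraMap F F').comp P.ring.subtype

/-- Unramifiedness: up to units at `Q`, each nonzero element of `O_P[α]` comes from `O_P`. The proof
is a descent on the order at `Q`, extracting one uniformizer `π` of `P` at a time. -/
theorem Place.exists_mul_eval_eq {P : Place K F} {Q : Place K F'} {φ : K[X]}
    {α : F'} (hα : aeval α φ = 0) {β : IsLocalRing.ResidueField P.ring}
    (hβ : aeval β φ = 0) (hβ' : aeval β (derivative φ) ≠ 0)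
    (hmem : ∀ p : P.ring[X], Q.valuation (p.eval₂ (P.toExtension F') α) ≤ 1)
    (hunit : ∀ p : P.ring[X], p.eval₂ (IsLocalRing.residue P.ring) β ≠ 0 →
      Q.valuation (p.eval₂ (P.toExtension F') α) = 1)
    (hmax : ∀ o ∈ IsLocalRing.maximalIdeal P.ring, Q.valuation (P.toExtension F' o) < 1)
    (p : P.ring[X]) (hp : p.eval₂ (P.toExtension F') α ≠ 0) :
    ∃ (s u : P.ring[X]) (c : P.ring), s.eval₂ (IsLocalRing.residue P.ring) β ≠ 0 ∧
      u.eval₂ (IsLocalRing.residue P.ring) β ≠ 0 ∧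
      (s * p).eval₂ (P.toExtension F') α = (C c * u).eval₂ (P.toExtension F') α := by
  obtain ⟨n, hn⟩ : ∃ n : ℕ, Q.ord (p.eval₂ (P.toExtension F') α) = n := by
    refine Int.eq_ofNat_of_zero_le ?_
    have := hmem p
    rw [← WithZero.exp_zero, Q.valuation_le_exp_iff hp] at this
    linarith
  induction n using Nat.strong_induction_on generalizing p with
  | _ n ih =>
    by_cases hpβ : p.eval₂ (IsLocalRing.residue P.ring) β = 0
    swap
    · exact ⟨1, p, 1, by simp, hpβ, by simp⟩
    obtain ⟨b, hb⟩ := IsLocalRing.residue_surjective β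
    obtain ⟨π, hπ⟩ := IsDiscreteValuationRing.exists_irreducible P.ring
    have hmaxeq := (IsDiscreteValuationRing.irreducible_iff_uniformizer π).1 hπ
    have hdiv : ∀ p : P.ring[X], p.eval₂ (IsLocalRing.residue P.ring) β = 0 →
        ∃ e, p.eval b = π * e := fun p hp => by
      have h1 : p.eval b ∈ IsLocalRing.maximalIdeal P.ring := by
        rw [← IsLocalRing.residue_eq_zero_iff, ← hp, ← hb, eval₂_hom]
      rw [hmaxeq, Ideal.mem_span_singleton] at h1
      exact h1
    set φ' : P.ring[X] := φ.map (algebraMap K P.ring) with hφ'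
    have hφβ : φ'.eval₂ (IsLocalRing.residue P.ring) β = 0 := by
      rw [hφ', eval₂_map]
      exact hβ
    have hφα : φ'.eval₂ (P.toExtension F') α = 0 := by
      rw [hφ', eval₂_map, ← hα, aeval_def]
      congr 1
      ext c
      exact (IsScalarTower.algebraMap_apply K F F' c).symm
    obtain ⟨e₁, he₁⟩ := hdiv φ' hφβ
    obtain ⟨e₂, he₂⟩ := hdiv p hpβ
    obtain ⟨ψ, hψ⟩ := X_sub_C_dvd_sub_C_eval (p := φ') (a := b)
    obtain ⟨q, hq⟩ := X_sub_C_dvd_sub_C_eval (p := p) (a := b)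
    rw [he₁] at hψ
    rw [he₂] at hq
    have hψβ : ψ.eval₂ (IsLocalRing.residue P.ring) β ≠ 0 := by
      have h1 : derivative φ' = ψ + (X - C b) * derivative ψ := by
        rw [sub_eq_iff_eq_add.1 hψ]
        simp
      have h2 := congrArg (eval₂ (IsLocalRing.residue P.ring) β) h1
      rw [hφ', derivative_map, eval₂_map, eval₂_add, eval₂_mul, eval₂_sub, eval₂_X, eval₂_C, hb,
        sub_self, zero_mul, add_zero] at h2
      rw [← h2]
      exact hβ'
    set w := C e₂ * ψ - C e₁ * q with hw
    -- Writing `φ = (X - b) ψ + π e₁` and `p = (X - b) q + π e₂`, eliminating `X - b` gives `ψ p = π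
    -- w + φ q`. At `α` the last term vanishes, and `ψ(α)` is a unit because `ψ(β) = φ'(β) ≠ 0`.
    have hkey : (ψ * p).eval₂ (P.toExtension F') α = (C π * w).eval₂ (P.toExtension F') α := by
      have h1 : ψ * p = C π * w + φ' * q := by
        rw [hw, sub_eq_iff_eq_add.1 hq, sub_eq_iff_eq_add.1 hψ, C_mul, C_mul]
        ring
      rw [h1, eval₂_add, eval₂_mul (p := φ'), hφα, zero_mul, add_zero]
    have hval : Q.valuation (p.eval₂ (P.toExtension F') α) =
        Q.valuation (P.toExtension F' π) * Q.valuation (w.eval₂ (P.toExtension F') α) := by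
      have := congrArg Q.valuation hkey
      rwa [eval₂_mul, eval₂_mul, map_mul, map_mul, hunit ψ hψβ, one_mul, eval₂_C] at this
    have hw0 : w.eval₂ (P.toExtension F') α ≠ 0 := fun h => by
      rw [h, map_zero, mul_zero, Valuation.zero_iff] at hval
      exact hp hval
    have hπ0 : P.toExtension F' π ≠ 0 := fun h => by
      rw [h, map_zero, zero_mul, Valuation.zero_iff] at hval
      exact hp hval
    have hwn : 0 ≤ Q.ord (w.eval₂ (P.toExtension F') α) := by
      have := hmem w
      rw [← WithZero.exp_zero, Q.valuation_le_exp_iff hw0] at this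
      linarith
    have hlt : Q.ord (w.eval₂ (P.toExtension F') α) < n := by
      have h1 := hmax π (hmaxeq ▸ Ideal.mem_span_singleton_self π)
      rw [Q.valuation_eq_exp hπ0, ← WithZero.exp_zero, WithZero.exp_lt_exp] at h1
      rw [Q.valuation_eq_exp hp, Q.valuation_eq_exp hw0, Q.valuation_eq_exp hπ0,
        ← WithZero.exp_add, WithZero.exp_inj] at hval
      linarith
    obtain ⟨s, u, c, hs, hu, h⟩ := ih (Q.ord (w.eval₂ (P.toExtension F') α)).toNat (by omega) w hw0
      (by omega)
    refine ⟨s * ψ, u, π * c, by rw [eval₂_mul]; exact mul_ne_zero hs hψβ, hu, ?_⟩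
    rw [mul_assoc, eval₂_mul, hkey, C_mul, mul_assoc, eval₂_mul (p := C π), eval₂_mul (p := C π),
      ← h, eval₂_mul (p := s)]
    ring

/-- A place `P` splits completely in the extension of `F` obtained by adjoining a root `α` of a
polynomial over `K` that is separable over `K` and has a root in the residue field of `P`. -/
theorem Place.exists_extension (P : Place K F) {φ : K[X]} (hφ : φ.Monic) {α : F'}
    (hα : minpoly F α = φ.map (algebraMap K F)) (hgen : Algebra.adjoin F {α} = ⊤)
    {β : IsLocalRing.ResidueField P.ring}
    (hβ : aeval β φ = 0) (hβ' : aeval β (derivative φ) ≠ 0) :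
    ∃ Q : Place K F', Q.degree = P.degree ∧ (∀ x : F, algebraMap F F' x ∈ Q.ring ↔ x ∈ P.ring) ∧
      ∀ b : P.ring, IsLocalRing.residue P.ring b = β →
        Q.valuation (α - algebraMap F F' b) < 1 := by
  set ι := P.toExtension F' with hι
  have hαφ : aeval α φ = 0 := by
    have := minpoly.aeval F α
    rwa [hα, aeval_map_algebraMap] at this
  let f : P.ring[X] →+* F' := eval₂RingHom ι α
  let ev : P.ring[X] →+* IsLocalRing.ResidueField P.ring :=
    eval₂RingHom (IsLocalRing.residue P.ring) β
  have hf : ∀ p, f p = p.eval₂ ι α := fun _ => rfl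
  have hev : ∀ p, ev p = p.eval₂ (IsLocalRing.residue P.ring) β := fun _ => rfl
  -- The kernel of evaluation at `α` is generated by `φ`, monic over the valuation ring, so
  -- evaluation at `β` factors through `O_P[α]`. The place `Q` comes from a valuation ring
  -- dominating its kernel `I`.
  have hker : ∀ p, f p = 0 → ev p = 0 := fun p hp => by
    have h1 : φ.map (algebraMap K F) ∣ p.map P.ring.subtype := by
      rw [← hα]
      refine minpoly.dvd F α ?_
      rw [aeval_def, eval₂_map]
      exact hp
    have h2 : φ.map (algebraMap K F) = (φ.map (algebraMap K P.ring)).map P.ring.subtype := by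
      rw [map_map]
      rfl
    rw [h2, map_dvd_map _ Subtype.val_injective (hφ.map _)] at h1
    obtain ⟨r, rfl⟩ := h1
    have h3 : ev (φ.map (algebraMap K P.ring)) = 0 := by
      rw [hev, eval₂_map]
      exact hβ
    rw [map_mul, h3, zero_mul]
  let I : Ideal f.range := (RingHom.ker ev).map f.rangeRestrict
  have hI : I ≠ ⊤ := by
    rw [Ne, Ideal.eq_top_iff_one, Ideal.mem_map_iff_of_surjective _ f.rangeRestrict_surjective]
    rintro ⟨p, hp, hp1⟩
    have h1 : f p = 1 := congrArg Subtype.val hp1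
    have h2 := hker (p - 1) (by rw [map_sub, h1, map_one, sub_self])
    rw [map_sub, RingHom.mem_ker.1 hp, map_one, zero_sub, neg_eq_zero] at h2
    exact one_ne_zero h2
  obtain ⟨V, hAV, hIV⟩ := Ideal.image_subset_nonunits_valuationSubring I hI
  have hfV : ∀ p, f p ∈ V := fun p => hAV ⟨p, rfl⟩
  have hnon : ∀ p, ev p = 0 → f p ∈ V.nonunits := fun p hp =>
    hIV ⟨f.rangeRestrict p, Ideal.mem_map_of_mem _ hp, rfl⟩
  have hιf : ∀ o, ι o = f (C o) := fun o => by rw [hf, eval₂_C]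
  obtain ⟨π, hπ⟩ := IsDiscreteValuationRing.exists_irreducible P.ring
  have hinv : ∀ x ∈ V.nonunits, x ≠ 0 → x⁻¹ ∉ V := fun x hx hx0 h => by
    rw [ValuationSubring.mem_nonunits_iff] at hx
    rw [← V.valuation_le_one_iff, map_inv₀,
      inv_le_one₀ (zero_lt_iff.2 ((Valuation.ne_zero_iff _).2 hx0))] at h
    exact h.not_gt hx
  have hmaxV : ∀ o ∈ IsLocalRing.maximalIdeal P.ring, ι o ∈ V.nonunits := fun o ho => by
    rw [hιf]
    refine hnon _ ?_
    rwa [hev, eval₂_C, IsLocalRing.residue_eq_zero_iff]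
  have hιinj : Function.Injective ι := (algebraMap F F').injective.comp Subtype.val_injective
  obtain ⟨Q, rfl⟩ : ∃ Q : Place K F', Q.ring = V := ⟨⟨V, fun c => by
      have := hfV (C (algebraMap K P.ring c))
      rw [← hιf] at this
      rw [IsScalarTower.algebraMap_apply K F F']
      exact this,
    fun h => hinv _ (hmaxV π ((IsLocalRing.mem_maximalIdeal π).2 hπ.not_isUnit))
      (fun h0 => hπ.ne_zero (hιinj (h0.trans (map_zero ι).symm))) (h ▸ trivial)⟩, rfl⟩
  have hlt : ∀ x ∈ Q.ring.nonunits, Q.valuation x < 1 := fun x hx => by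
    rcases eq_or_ne x 0 with rfl | hx0
    · simp
    have h1 := hinv x hx hx0
    have h2 : ¬ Q.valuation x⁻¹ ≤ 1 := fun h => h1 ((Q.valuation_le_one_iff _).1 h)
    rw [not_le, map_inv₀, one_lt_inv₀ (zero_lt_iff.2 ((Valuation.ne_zero_iff _).2 hx0))] at h2
    exact h2
  have hmem : ∀ p : P.ring[X], Q.valuation (f p) ≤ 1 := fun p => (Q.valuation_le_one_iff _).2 (hfV p)
  have hmax : ∀ o ∈ IsLocalRing.maximalIdeal P.ring, Q.valuation (ι o) < 1 := fun o ho =>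
    hlt _ (hmaxV o ho)
  have hιunit : ∀ o : P.ring, IsUnit o → Q.valuation (ι o) = 1 := fun o ho => by
    obtain ⟨o', ho'⟩ := ho.exists_right_inv
    refine le_antisymm (hιf o ▸ hmem _) ?_
    by_contra h
    have h1 : Q.valuation (ι o * ι o') = 1 := by rw [← map_mul, ho', map_one, map_one]
    rw [map_mul] at h1
    exact (mul_lt_one_of_lt_of_le (not_le.1 h) (hιf o' ▸ hmem _)).ne h1
  have happrox : ∀ p : P.ring[X], ∀ o, IsLocalRing.residue P.ring o = ev p →
      Q.valuation (f p - ι o) < 1 := fun p o ho => by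
    rw [hιf, ← map_sub]
    refine hlt _ (hnon _ ?_)
    rw [map_sub, hev (C o), eval₂_C, ho, sub_self]
  have hunit : ∀ p : P.ring[X], ev p ≠ 0 → Q.valuation (f p) = 1 := fun p hp => by
    obtain ⟨o, ho⟩ := IsLocalRing.residue_surjective (ev p)
    have h1 := happrox p o ho
    have h2 : Q.valuation (ι o) = 1 := by
      refine hιunit o ?_
      rw [← ho] at hp
      exact (IsLocalRing.residue_ne_zero_iff_isUnit o).1 hp
    have h3 : f p = (f p - ι o) + ι o := by ring
    rw [h3, Valuation.map_add_eq_of_lt_right _ (by rwa [h2]), h2]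
  have hring : ∀ x : F, algebraMap F F' x ∈ Q.ring ↔ x ∈ P.ring := fun x => by
    refine ⟨fun h => ?_, fun h => ?_⟩
    · by_contra hx
      have hx0 : x ≠ 0 := fun h0 => hx (h0 ▸ P.ring.zero_mem)
      have h1 : 1 < P.valuation x := not_le.1 fun h' => hx ((P.valuation_le_one_iff x).1 h')
      have h2 : P.valuation x⁻¹ < 1 := by
        rw [map_inv₀]
        exact inv_lt_one_of_one_lt₀ h1
      have h3 := hmaxV ⟨x⁻¹, (P.valuation_le_one_iff _).1 h2.le⟩
        ((P.valuation_lt_one_iff _).1 h2)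
      have h4 : ι ⟨x⁻¹, (P.valuation_le_one_iff _).1 h2.le⟩ = (algebraMap F F' x)⁻¹ :=
        map_inv₀ (algebraMap F F') x
      rw [h4] at h3
      refine hinv _ h3 (inv_ne_zero ((_root_.map_ne_zero _).2 hx0)) ?_
      rwa [inv_inv]
    · have := hfV (C ⟨x, h⟩)
      rwa [← hιf] at this
  -- The residue field does not grow: after clearing denominators, `y = e u(α) / s(α)` with `e ∈ F`
  -- and units `u(α)`, `s(α)`. Then `e` is integral at `P`, and replacing `u(α)`, `s(α)` by lifts of
  -- their residues approximates `y`.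
  have hsurj : ∀ y ∈ Q.ring, ∃ o : P.ring, Q.valuation (y - ι o) < 1 := fun y hy => by
    rcases eq_or_ne y 0 with rfl | hy0
    · exact ⟨0, by simp⟩
    have hyt : y ∈ Algebra.adjoin F {α} := hgen ▸ trivial
    rw [Algebra.adjoin_singleton_eq_range_aeval] at hyt
    obtain ⟨r, hr⟩ := hyt
    have hr' : aeval α r = y := hr
    obtain ⟨a, haM, ha⟩ := IsLocalization.integerNormalization_spec (nonZeroDivisors P.ring) r
    set p := IsLocalization.integerNormalization (nonZeroDivisors P.ring) r with hp
    have ha0 : a ≠ 0 := nonZeroDivisors.ne_zero haM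
    have hιa0 : ι a ≠ 0 := fun h => ha0 (hιinj (h.trans (map_zero ι).symm))
    have hpy : f p = ι a * y := by
      have h1 : f p = aeval α (p.map (algebraMap P.ring F)) := by
        rw [aeval_def, eval₂_map]
        rfl
      rw [h1, ha, ← hr']
      rw [← algebraMap_smul F a r, map_smul, Algebra.smul_def]
      rfl
    have hp0 : f p ≠ 0 := by
      rw [hpy]
      exact mul_ne_zero hιa0 hy0
    obtain ⟨s, u, c, hs, hu, h⟩ := Place.exists_mul_eval_eq hαφ hβ hβ' hmem hunit hmax p hp0
    have h' : f s * (ι a * y) = ι c * f u := by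
      rw [← hpy, ← map_mul, hιf c, ← map_mul]
      exact h
    have hfs := hunit s hs
    have hfu := hunit u hu
    set e : F := c / a
    have hιe : algebraMap F F' e * ι a = ι c := by
      have : e * a = (c : F) := div_mul_cancel₀ _ fun h0 => ha0 (Subtype.ext h0)
      rw [← show algebraMap F F' (c : F) = ι c from rfl, ← this, map_mul]
      rfl
    have hy' : y * f s = algebraMap F F' e * f u := by
      refine mul_left_cancel₀ hιa0 ?_
      rw [← mul_assoc (ι a), mul_comm (ι a * y), h', ← hιe]
      ring
    have heP : e ∈ P.ring := by
      rw [← hring, ← Q.valuation_le_one_iff]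
      have h1 := congrArg Q.valuation hy'
      rw [map_mul, map_mul, hfs, hfu, mul_one, mul_one] at h1
      rw [← h1]
      exact (Q.valuation_le_one_iff y).2 hy
    obtain ⟨os, hos⟩ := IsLocalRing.residue_surjective (ev s)
    obtain ⟨ou, hou⟩ := IsLocalRing.residue_surjective (ev u)
    have hosu : IsUnit os := by
      rw [← IsLocalRing.residue_ne_zero_iff_isUnit, hos]
      exact hs
    obtain ⟨os', hos'⟩ := hosu.exists_right_inv
    refine ⟨⟨e, heP⟩ * ou * os', ?_⟩
    have hx1 := happrox s os hos
    have hx2 := happrox u ou hou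
    have hιe' : ι ⟨e, heP⟩ = algebraMap F F' e := rfl
    have hos1 : ι os * ι os' = 1 := by rw [← map_mul, hos', map_one]
    have hfin : (y - ι (⟨e, heP⟩ * ou * os')) * f s =
        ι ⟨e, heP⟩ * ((f u - ι ou) - ι ou * ι os' * (f s - ι os)) := by
      rw [sub_mul, hy', map_mul, map_mul, hιe']
      linear_combination -(algebraMap F F' e * ι ou) * hos1
    have hle : ∀ o, Q.valuation (ι o) ≤ 1 := fun o => hιf o ▸ hmem _
    have hv := congrArg Q.valuation hfin
    rw [map_mul, hfs, mul_one] at hv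
    rw [hv, map_mul]
    refine (mul_le_of_le_one_left' (hle _)).trans_lt
      ((Valuation.map_sub _ _ _).trans_lt (max_lt hx2 ?_))
    rw [map_mul, map_mul]
    exact (mul_le_of_le_one_left' (mul_le_one' (hle _) (hle _))).trans_lt hx1
  let g : P.ring →+* Q.ring := ι.codRestrict Q.ring.toSubring fun o => (hring o).2 o.2
  have hgloc : IsLocalHom g := ⟨fun o ho => by
    by_contra h
    have h1 := hmax o h
    have h2 := (Q.valuation_lt_one_iff (g o)).1 h1
    exact h2 ho⟩
  have hgK : ∀ c : K, g (algebraMap K P.ring c) = algebraMap K Q.ring c := fun c =>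
    Subtype.ext (IsScalarTower.algebraMap_apply K F F' c).symm
  let G : IsLocalRing.ResidueField P.ring →ₐ[K] IsLocalRing.ResidueField Q.ring :=
    { IsLocalRing.ResidueField.map g with
      commutes' := fun c => by
        change IsLocalRing.ResidueField.map g
          (IsLocalRing.residue P.ring (algebraMap K P.ring c)) =
          IsLocalRing.residue Q.ring (algebraMap K Q.ring c)
        rw [IsLocalRing.ResidueField.map_residue, hgK] }
  have hG : Function.Bijective G := by
    refine ⟨G.toRingHom.injective, fun y => ?_⟩
    obtain ⟨⟨y, hy⟩, rfl⟩ := IsLocalRing.residue_surjective y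
    obtain ⟨o, ho⟩ := hsurj y hy
    refine ⟨IsLocalRing.residue P.ring o, ?_⟩
    change IsLocalRing.ResidueField.map g (IsLocalRing.residue P.ring o) = _
    rw [IsLocalRing.ResidueField.map_residue, eq_comm, ← sub_eq_zero, ← map_sub,
      IsLocalRing.residue_eq_zero_iff, ← Q.valuation_lt_one_iff]
    exact ho
  refine ⟨Q, (LinearEquiv.ofBijective G.toLinearMap hG).finrank_eq.symm, hring, fun b hb => ?_⟩
  have := happrox X b (by rw [hev, eval₂_X, hb])
  rwa [hf, eval₂_X] at this

end ConstantExtension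

/-! ### The constant extension in which all places split -/

section DegreeOne

open Polynomial

/-- A monic factor over `F` of a monic polynomial over `K` has coefficients integral over `K`, and
these lie in `K` because `K` is algebraically closed in `F`. -/
theorem irreducible_map_of_isAlgebraic {K F : Type*} [Field K] [Field F] [Algebra K F]
    (hK : ∀ x : F, IsAlgebraic K x → x ∈ Set.range (algebraMap K F)) {φ : K[X]} (hφ : φ.Monic)
    (hirr : Irreducible φ) : Irreducible (φ.map (algebraMap K F)) := by
  have hinj : Function.Injective (Polynomial.map (algebraMap K F)) :=
    map_injective _ (algebraMap K F).injective
  have hlift : ∀ g : F[X], g.Monic → g ∣ φ.map (algebraMap K F) →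
      ∃ g₀ : K[X], g₀.map (algebraMap K F) = g := fun g hg hdvd => by
    have h1 := integralClosure.mem_lifts_of_monic_of_dvd_map F hφ hg hdvd
    rw [lifts_iff_coeff_lifts] at h1
    rw [← mem_lifts, lifts_iff_coeff_lifts]
    intro n
    obtain ⟨z, hz⟩ := h1 n
    exact hK _ (hz ▸ (show IsIntegral K (z : F) from z.2).isAlgebraic)
  rw [(hφ.map _).irreducible_iff_natDegree]
  refine ⟨fun h => ?_, fun g h hg hh hgh => ?_⟩
  · rw [← Polynomial.map_one (algebraMap K F)] at h
    exact hirr.ne_one (hinj h)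
  · obtain ⟨g₀, rfl⟩ := hlift g hg ⟨h, hgh.symm⟩
    obtain ⟨h₀, rfl⟩ := hlift h hh ⟨_, (mul_comm _ _).trans hgh |>.symm⟩
    rw [← Polynomial.map_mul] at hgh
    have h1 := hinj hgh
    rw [natDegree_map, natDegree_map]
    rcases hirr.isUnit_or_isUnit h1.symm with hu | hu
    · exact Or.inl (natDegree_eq_zero_of_isUnit hu)
    · exact Or.inr (natDegree_eq_zero_of_isUnit hu)

/-- If all degrees of places are divisible by `d ≥ 2`, then every place of `F` splits into at least
two places of the same degree in a suitable extension of `F`. -/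
theorem exists_splitting_extension {K : Type*} {F : Type*} [Field K] [Finite K] [Field F]
    [Algebra K F] [IsFunctionField K F]
    (hK : ∀ x : F, IsAlgebraic K x → x ∈ Set.range (algebraMap K F)) {d : ℕ} (hd : 2 ≤ d)
    (hdvd : ∀ P : Place K F, d ∣ P.degree) :
    ∃ φ : K[X], ∃ _ : Fact (Irreducible (φ.map (algebraMap K F))),
      ∃ _ : IsFunctionField K (AdjoinRoot (φ.map (algebraMap K F))),
      ∃ i j : Place K F → Place K (AdjoinRoot (φ.map (algebraMap K F))),
        Function.Injective i ∧ Function.Injective j ∧ (∀ P Q, i P ≠ j Q) ∧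
        (∀ P, (i P).degree = P.degree) ∧ ∀ P, (j P).degree = P.degree := by
  have : NeZero d := ⟨by omega⟩
  obtain ⟨p, hp⟩ := CharP.exists K
  have : Fact p.Prime := ⟨CharP.char_is_prime K p⟩
  let E := FiniteField.Extension K p d
  have hE : Module.finrank K E = d := FiniteField.finrank_extension K p d
  obtain ⟨a, ha⟩ := Field.exists_primitive_element K E
  have haint : IsIntegral K a := Algebra.IsIntegral.isIntegral a
  set φ := minpoly K a
  have hφ : φ.Monic := minpoly.monic haint
  have hirr := irreducible_map_of_isAlgebraic hK hφ (minpoly.irreducible haint)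
  -- The extension is kept as a function field over `K`, not over its larger field of constants, so
  -- that the places above `P` have the same degree as `P`.
  let F' := AdjoinRoot (φ.map (algebraMap K F))
  have : Fact (Irreducible (φ.map (algebraMap K F))) := ⟨hirr⟩
  have hfin : Module.Finite F F' := (hφ.map _).finite_adjoinRoot
  have hFF : IsFunctionField K F' := isFunctionField_of_finite K F F'
  let α : F' := AdjoinRoot.root (φ.map (algebraMap K F))
  have hα : minpoly F α = φ.map (algebraMap K F) := by
    rw [AdjoinRoot.minpoly_root hirr.ne_zero, (hφ.map _).leadingCoeff, inv_one, C_1, mul_one]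
  have hgen : Algebra.adjoin F {α} = ⊤ := AdjoinRoot.adjoinRoot_eq_top
  -- As `d` divides `deg P`, the extension `E` has `d ≥ 2` embeddings into the residue field;
  -- distinct ones send the generator `a` to distinct roots of `φ`.
  have hroots : ∀ P : Place K F, ∃ β γ : IsLocalRing.ResidueField P.ring, β ≠ γ ∧
      aeval β φ = 0 ∧ aeval γ φ = 0 := fun P => by
    have := P.finite_residueField
    have : Finite (IsLocalRing.ResidueField P.ring) := Module.finite_of_finite K
    have hcard := FiniteField.natCard_algHom_of_finrank_dvd (F := K) (K := E)
      (L := IsLocalRing.ResidueField P.ring) (by rw [hE]; exact hdvd P)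
    have : Finite (E →ₐ[K] IsLocalRing.ResidueField P.ring) :=
      Nat.finite_of_card_ne_zero (by rw [hcard, hE]; omega)
    have : Nontrivial (E →ₐ[K] IsLocalRing.ResidueField P.ring) := by
      rw [← Finite.one_lt_card_iff_nontrivial, hcard, hE]
      omega
    obtain ⟨f, g, hfg⟩ := exists_pair_ne (E →ₐ[K] IsLocalRing.ResidueField P.ring)
    refine ⟨f a, g a, fun h => hfg ?_, ?_, ?_⟩
    · refine AlgHom.ext fun x => ?_
      have hx : x ∈ IntermediateField.adjoin K {a} := ha ▸ IntermediateField.mem_top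
      rw [IntermediateField.mem_adjoin_simple_iff] at hx
      obtain ⟨r, s, rfl⟩ := hx
      rw [map_div₀, map_div₀, ← aeval_algHom_apply, ← aeval_algHom_apply, ← aeval_algHom_apply,
        ← aeval_algHom_apply, h]
    · rw [aeval_algHom_apply, minpoly.aeval, map_zero]
    · rw [aeval_algHom_apply, minpoly.aeval, map_zero]
  have hsep : φ.Separable := Algebra.IsSeparable.isSeparable K a
  choose β γ hne hβ hγ using hroots
  choose i hideg hiring hib using fun P : Place K F => P.exists_extension (F' := F') hφ hα hgen
    (hβ P) (hsep.aeval_derivative_ne_zero (hβ P))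
  choose j hjdeg hjring hjb using fun P : Place K F => P.exists_extension (F' := F') hφ hα hgen
    (hγ P) (hsep.aeval_derivative_ne_zero (hγ P))
  have key : ∀ {P Q : Place K F} {R S : Place K F'},
      (∀ x : F, algebraMap F F' x ∈ R.ring ↔ x ∈ P.ring) →
      (∀ x : F, algebraMap F F' x ∈ S.ring ↔ x ∈ Q.ring) → R = S → P = Q := by
    intro P Q R S h1 h2 h
    refine Place.eq_of_ring_le fun x hx => ?_
    rw [← h2, ← h, h1]
    exact hx
  refine ⟨φ, ‹_›, hFF, i, j, fun P Q h => key (hiring P) (hiring Q) h,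
    fun P Q h => key (hjring P) (hjring Q) h, fun P Q h => ?_, hideg, hjdeg⟩
  -- At a common place, `α` would be congruent both to a lift `b` of `β` and to a lift `c` of `γ`,
  -- making the unit `b - c` a nonunit.
  obtain rfl := key (hiring P) (hjring Q) h
  obtain ⟨b, hb⟩ := IsLocalRing.residue_surjective (β P)
  obtain ⟨c, hc⟩ := IsLocalRing.residue_surjective (γ P)
  have h1 := hib P b hb
  have h2 := hjb P c hc
  rw [← h] at h2
  have h3 : (i P).valuation (algebraMap F F' ((b - c : P.ring) : F)) < 1 := by
    have : algebraMap F F' ((b - c : P.ring) : F) =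
        (α - algebraMap F F' c) - (α - algebraMap F F' b) := by
      rw [sub_sub_sub_cancel_left, ← map_sub]
      rfl
    rw [this]
    exact (Valuation.map_sub _ _ _).trans_lt (max_lt h2 h1)
  refine hne P ?_
  rw [← hb, ← hc, ← sub_eq_zero, ← map_sub]
  by_contra h4
  obtain ⟨u, hu⟩ := ((IsLocalRing.residue_ne_zero_iff_isUnit _).1 h4).exists_right_inv
  have h5 : (i P).valuation (algebraMap F F' (u : F)) ≤ 1 :=
    ((i P).valuation_le_one_iff _).2 ((hiring P u).2 u.2)
  have h6 : (i P).valuation (algebraMap F F' ((b - c : P.ring) : F)) *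
      (i P).valuation (algebraMap F F' (u : F)) = 1 := by
    rw [← map_mul, ← map_mul, ← show (((b - c) * u : P.ring) : F) = ((b - c : P.ring) : F) * u
      from rfl, hu]
    simp
  exact (mul_lt_one_of_lt_of_le h3 h5).ne h6

end DegreeOne

/-! ### F. K. Schmidt's theorem -/

section Schmidt

variable {K F F' : Type*} [Field K] [Field F] [Field F'] [Algebra K F] [Algebra K F']

theorem degree_mapDomain {i : Place K F → Place K F'} (hi : ∀ P, (i P).degree = P.degree)
    (D : Divisor K F) : degree K F' (D.mapDomain i) = degree K F D := by
  induction D using Finsupp.induction_linear with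
  | zero => simp
  | add D E hD hE => rw [Finsupp.mapDomain_add, map_add, map_add, hD, hE]
  | single P n => rw [Finsupp.mapDomain_single, degree_single, degree_single, hi]

theorem mapDomain_nonneg {i : Place K F → Place K F'} (hi : Function.Injective i)
    {D : Divisor K F} (hD : 0 ≤ D) : 0 ≤ D.mapDomain i := fun Q => by
  by_cases h : Q ∈ Set.range i
  · obtain ⟨P, rfl⟩ := h
    rw [Finsupp.mapDomain_apply hi]
    exact hD P
  · rw [Finsupp.mapDomain_of_notMem_range _ _ h]
    rfl

variable [IsFunctionField K F] [IsFunctionField K F'] [Finite K]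

/-- The pair `(D, E)` is recovered from `i_* D + j_* E` by restricting to the disjoint ranges of `i`
and `j`, and its index `k` from the degree of `D`. -/
theorem sum_numEffective_mul_le {i j : Place K F → Place K F'} (hi : Function.Injective i)
    (hj : Function.Injective j) (hij : ∀ P Q, i P ≠ j Q) (hid : ∀ P, (i P).degree = P.degree)
    (hjd : ∀ P, (j P).degree = P.degree) {ι : Type*} [Fintype ι] {m n : ι → ℤ} {N : ℤ}
    (hm : Function.Injective m) (hmn : ∀ k, m k + n k = N) :
    ∑ k, numEffective K F (m k) * numEffective K F (n k) ≤ numEffective K F' N := by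
  simp only [numEffective, ← Nat.card_prod]
  rw [← Nat.card_sigma]
  let f : (Σ k : ι, {D : Divisor K F // 0 ≤ D ∧ degree K F D = m k} ×
      {D : Divisor K F // 0 ≤ D ∧ degree K F D = n k}) →
      {D : Divisor K F' // 0 ≤ D ∧ degree K F' D = N} := fun x =>
    ⟨x.2.1.1.mapDomain i + x.2.2.1.mapDomain j,
      add_nonneg (mapDomain_nonneg hi x.2.1.2.1) (mapDomain_nonneg hj x.2.2.2.1), by
        rw [map_add, degree_mapDomain hid, degree_mapDomain hjd, x.2.1.2.2, x.2.2.2.2, hmn]⟩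
  refine Nat.card_le_card_of_injective f ?_
  rintro ⟨k, ⟨D, hD⟩, ⟨E, hE⟩⟩ ⟨l, ⟨D', hD'⟩, ⟨E', hE'⟩⟩ h
  have h1 : D.mapDomain i + E.mapDomain j = D'.mapDomain i + E'.mapDomain j :=
    congrArg Subtype.val h
  have hDD : D = D' := Finsupp.ext fun P => by
    have h2 := DFunLike.congr_fun h1 (i P)
    have h3 : i P ∉ Set.range j := fun ⟨Q, hQ⟩ => hij P Q hQ.symm
    rwa [Finsupp.add_apply, Finsupp.add_apply, Finsupp.mapDomain_apply hi,
      Finsupp.mapDomain_apply hi, Finsupp.mapDomain_of_notMem_range _ _ h3,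
      Finsupp.mapDomain_of_notMem_range _ _ h3, add_zero, add_zero] at h2
  have hEE : E = E' := Finsupp.ext fun P => by
    have h2 := DFunLike.congr_fun h1 (j P)
    have h3 : j P ∉ Set.range i := fun ⟨Q, hQ⟩ => hij Q P hQ
    rwa [Finsupp.add_apply, Finsupp.add_apply, Finsupp.mapDomain_apply hj,
      Finsupp.mapDomain_apply hj, Finsupp.mapDomain_of_notMem_range _ _ h3,
      Finsupp.mapDomain_of_notMem_range _ _ h3, zero_add, zero_add] at h2
  subst hDD hEE
  obtain rfl : k = l := hm (hD.2.symm.trans hD'.2)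
  rfl

theorem pow_dim_sub_one_le_card_effectiveInClass
    (hK : ∀ x : F, IsAlgebraic K x → x ∈ Set.range (algebraMap K F)) {D : Divisor K F}
    (hD : 0 < dim D) : Nat.card K ^ (dim D - 1) ≤
      Nat.card (EffectiveInClass (QuotientAddGroup.mk D : DivisorClassGroup K F)) := by
  have h1 := pow_dim_le_card_effectiveInClass hK D
  have hq : 1 < Nat.card K := Finite.one_lt_card
  set N := Nat.card (EffectiveInClass (QuotientAddGroup.mk D : DivisorClassGroup K F))
  obtain ⟨l, hl⟩ : ∃ l, dim D = l + 1 := ⟨dim D - 1, by omega⟩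
  obtain ⟨r, hr⟩ : ∃ r, Nat.card K = r + 2 := ⟨Nat.card K - 2, by omega⟩
  rw [hl, hr] at h1 ⊢
  simp only [Nat.add_sub_cancel, show r + 2 - 1 = r + 1 by omega] at h1 ⊢
  have h2 : 1 ≤ (r + 2) ^ l := Nat.one_le_pow _ _ (by omega)
  rw [pow_succ] at h1
  by_contra h
  have h3 : N + 1 ≤ (r + 2) ^ l := by omega
  nlinarith

theorem pow_le_numEffective
    (hK : ∀ x : F, IsAlgebraic K x → x ∈ Set.range (algebraMap K F)) {D : Divisor K F} {n : ℕ}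
    (hD : degree K F D = n) (hn : (genus K F).toNat ≤ n) :
    Nat.card K ^ (n - (genus K F).toNat) ≤ numEffective K F n := by
  have h1 := dim_eq_add_index D
  rw [hD] at h1
  have h2 := genus_nonneg hK
  have h3 : n - (genus K F).toNat + 1 ≤ dim D := by omega
  calc Nat.card K ^ (n - (genus K F).toNat) ≤ Nat.card K ^ (dim D - 1) :=
        Nat.pow_le_pow_right Nat.card_pos (by omega)
    _ ≤ _ := pow_dim_sub_one_le_card_effectiveInClass hK (by omega)
    _ ≤ numEffective K F n := by
        refine Nat.card_le_card_of_injective (fun E => ⟨E.1, E.2.1, ?_⟩)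
          fun E E' h => Subtype.ext (congrArg (fun D => D.1) h)
        rw [← classDegree_mk, E.2.2, classDegree_mk, hD]

/-- The bound `dim E ≤ deg E + dim 0` is used instead of `deg E + 1` because the result is applied
to an extension with more constants than `K`. -/
theorem numEffective_le_pow (n : ℕ) : numEffective K F n ≤
    classNumber K F * Nat.card K ^ (n + dim (0 : Divisor K F)) := by
  have h1 : numEffective K F n ≤
      Nat.card (ClassOfDegree K F n) * Nat.card K ^ (n + dim (0 : Divisor K F)) := by
    refine numEffective_le_card_mul fun D hD => ?_
    rcases isEmpty_or_nonempty
      (EffectiveInClass (QuotientAddGroup.mk D : DivisorClassGroup K F)) with h | ⟨E, hE, hED⟩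
    · rw [Nat.card_of_isEmpty]
      exact Nat.zero_le _
    refine (card_effectiveInClass_le D).trans (Nat.pow_le_pow_right Nat.card_pos ?_)
    rw [← dim_eq_of_mk_eq hED]
    have h2 := degree_sub_dim_mono hE
    have h3 : degree K F E = n := by rw [← classDegree_mk, hED, classDegree_mk, hD]
    rw [map_zero, h3] at h2
    omega
  refine h1.trans (Nat.mul_le_mul_right _ ?_)
  rcases isEmpty_or_nonempty (ClassOfDegree K F n) with h | ⟨c, hc⟩
  · rw [Nat.card_of_isEmpty]
    exact Nat.zero_le _
  · obtain ⟨D, rfl⟩ := QuotientAddGroup.mk_surjective c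
    exact (card_classOfDegree D hc).le

/-- F. K. Schmidt's theorem: there is a divisor of degree one. -/
theorem exists_degree_eq_one
    (hK : ∀ x : F, IsAlgebraic K x → x ∈ Set.range (algebraMap K F)) :
    ∃ D : Divisor K F, degree K F D = 1 := by
  obtain ⟨a, ha⟩ := Int.subgroup_cyclic (degree K F).range
  set d := a.natAbs with hd
  have hrange : ∀ n : ℤ, (∃ D : Divisor K F, degree K F D = n) ↔ (d : ℤ) ∣ n := fun n => by
    rw [← AddMonoidHom.mem_range, ha, ← AddSubgroup.zmultiples_eq_closure, Int.mem_zmultiples_iff,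
      hd, Int.natAbs_dvd]
  rw [hrange]
  have hdvd : ∀ P : Place K F, d ∣ P.degree := fun P => by
    have := (hrange P.degree).1 ⟨Finsupp.single P 1, by rw [degree_single, one_mul]⟩
    exact_mod_cast this
  by_contra hd1
  have hd2 : 2 ≤ d := by
    have h0 : d ≠ 0 := fun h => by
      obtain ⟨P⟩ := nonempty_place K F
      have := hdvd P
      rw [h, zero_dvd_iff] at this
      exact P.degree_pos.ne' this
    have h1 : d ≠ 1 := fun h => hd1 (by simp [h])
    omega
  obtain ⟨φ, _, _, i, j, hi, hj, hij, hid, hjd⟩ := exists_splitting_extension hK hd2 hdvd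
  set F' := AdjoinRoot (φ.map (algebraMap K F))
  set q := Nat.card K with hq
  have hq1 : 1 < q := Finite.one_lt_card
  set G := (genus K F).toNat with hG
  set c := dim (0 : Divisor K F') with hc
  -- With `N = d (2G + T)`, the extension has at most `T q ^ (N - 2G)` effective divisors of degree
  -- `N`. The splitting gives `T + 1` products, one for each way of distributing the degree, each at
  -- least `q ^ (N - 2G)`.
  set T := classNumber K F' * q ^ (c + 2 * G) with hT
  have h1 := sum_numEffective_mul_le hi hj hij hid hjd (ι := Fin (T + 1))
    (m := fun k => ((d * (G + k) : ℕ) : ℤ)) (n := fun k => ((d * (G + (T - k)) : ℕ) : ℤ))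
    (N := ((d * (2 * G + T) : ℕ) : ℤ))
    (fun k l h => by
      have h' : d * (G + k) = d * (G + l) := Int.ofNat_inj.1 h
      have := Nat.eq_of_mul_eq_mul_left (by omega) h'
      exact Fin.ext (by omega))
    (fun k => by
      have hk := k.2
      rw [← Nat.cast_add, ← Nat.mul_add]
      congr 2
      omega)
  have hA : ∀ r : ℕ, G ≤ r → q ^ (d * r - G) ≤ numEffective K F ((d * r : ℕ) : ℤ) := fun r hr => by
    obtain ⟨D, hD⟩ := (hrange ((d * r : ℕ) : ℤ)).2 (by simp)
    exact pow_le_numEffective hK hD (hr.trans (Nat.le_mul_of_pos_left r (by omega)))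
  have hGd : ∀ r : ℕ, G ≤ r → G ≤ d * r := fun r hr =>
    hr.trans (Nat.le_mul_of_pos_left r (by omega))
  have h2 : (T + 1) * q ^ (d * (2 * G + T) - 2 * G) ≤
      numEffective K F' ((d * (2 * G + T) : ℕ) : ℤ) := by
    refine le_trans ?_ h1
    calc (T + 1) * q ^ (d * (2 * G + T) - 2 * G)
        = ∑ _k : Fin (T + 1), q ^ (d * (2 * G + T) - 2 * G) := by simp
      _ ≤ _ := Finset.sum_le_sum fun k _ => ?_
    have hk := k.2
    have e1 := hGd (G + k) (by omega)
    have e2 := hGd (G + (T - k)) (by omega)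
    have e3 : d * (2 * G + T) = d * (G + k) + d * (G + (T - k)) := by
      rw [← Nat.mul_add]
      congr 1
      omega
    rw [show d * (2 * G + T) - 2 * G = (d * (G + k) - G) + (d * (G + (T - k)) - G) by omega,
      pow_add]
    exact Nat.mul_le_mul (hA _ (by omega)) (hA _ (by omega))
  have h3 := h2.trans (numEffective_le_pow (K := K) (F := F') (d * (2 * G + T)))
  have e4 : 2 * G ≤ d * (2 * G + T) := (Nat.le_mul_of_pos_left (2 * G) (by omega : 0 < d)).trans
    (Nat.mul_le_mul_left d (by omega))
  have h4 : d * (2 * G + T) + c = (d * (2 * G + T) - 2 * G) + (c + 2 * G) := by omega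
  rw [← hc, ← hq, h4, pow_add, mul_left_comm, mul_comm (q ^ _), ← hT] at h3
  have := Nat.le_of_mul_le_mul_right h3 (Nat.pow_pos (by omega))
  omega

end Schmidt

/-! ### Existence of non-special divisors -/

section NonSpecialDivisors

variable {K F : Type*} [Field K] [Field F] [Algebra K F] [IsFunctionField K F]

theorem add_one_le_dim_nsmul {D : Divisor K F} (hD : 0 ≤ D) {x : F} (hx : x ∈ riemannRochSpace D)
    (hxt : Transcendental K x) (n : ℕ) : n + 1 ≤ dim (n • D) := by
  have hpow : LinearIndependent K (fun k : ℕ => x ^ k) := by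
    have h := (Polynomial.basisMonomials K).linearIndependent.map'
      (Polynomial.aeval x).toLinearMap
      (LinearMap.ker_eq_bot.2 (transcendental_iff_injective.1 hxt))
    have he : (Polynomial.aeval x).toLinearMap ∘ Polynomial.basisMonomials K =
        fun k : ℕ => x ^ k := by
      ext k
      simp
    rwa [he] at h
  have hli : LinearIndependent K (fun k : Fin (n + 1) => x ^ (k : ℕ)) :=
    hpow.comp _ Fin.val_injective
  let v : Fin (n + 1) → riemannRochSpace (n • D) := fun k => ⟨x ^ (k : ℕ),
    riemannRochSpace_mono (nsmul_le_nsmul_left hD (by omega)) (riemannRochSpace_nsmul_pow hx k)⟩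
  have hv : LinearIndependent K v := LinearIndependent.of_comp (riemannRochSpace (n • D)).subtype hli
  simpa [dim] using hv.fintype_card_le_finrank

theorem index_eq_zero_of_lt_degree
    (hK : ∀ x : F, IsAlgebraic K x → x ∈ Set.range (algebraMap K F)) {D : Divisor K F}
    (hD : 2 * genus K F - 2 < degree K F D) : index D = 0 := by
  obtain ⟨W, hW⟩ := exists_isCanonical K F
  rw [index_eq_dim_sub hW]
  by_contra h
  obtain ⟨x, hx, hE⟩ := exists_principalDivisor_add_nonneg (Nat.pos_of_ne_zero h)
  have := degree_nonneg hE
  rw [map_add, degree_principalDivisor, map_sub, degree_canonical hK hW] at this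
  linarith

/-- A second effective divisor would give a nonconstant `x ∈ L(D)`. This is impossible in degree
`0`; in degree `1` its powers give `dim (nD) ≥ n + 1`, against `n + 1 - g` from Riemann–Roch. -/
theorem eq_of_effective_of_mk_eq
    (hK : ∀ x : F, IsAlgebraic K x → x ∈ Set.range (algebraMap K F)) (hg : 0 < genus K F)
    {D E : Divisor K F} (hD : 0 ≤ D) (hE : 0 ≤ E) (hdeg : degree K F D ≤ 1)
    (h : (QuotientAddGroup.mk E : DivisorClassGroup K F) = QuotientAddGroup.mk D) : E = D := by
  obtain ⟨x, hx, rfl⟩ := mk_eq_mk_iff.1 h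
  by_cases hxa : IsAlgebraic K x
  · rw [principalDivisor_of_isAlgebraic hxa, add_zero]
  exfalso
  have hxD : x ∈ riemannRochSpace D := by
    rw [mem_riemannRochSpace_iff hx, add_comm]
    exact hE
  have hd0 := degree_nonneg hD
  rcases (by omega : degree K F D = 0 ∨ degree K F D = 1) with hd | hd
  · have hD0 := eq_zero_of_degree_eq_zero hD hd
    subst hD0
    exact hxa (isAlgebraic_of_mem_riemannRochSpace_zero hxD)
  -- Beyond `2g - 2`, so the index of `nD` is zero.
  · set n := (2 * genus K F).toNat with hn
    have h1 := add_one_le_dim_nsmul hD hxD hxa n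
    have hdn : degree K F (n • D) = n := by rw [map_nsmul, hd, nsmul_eq_mul, mul_one]
    have h2 := dim_eq_add_index (n • D)
    rw [hdn, index_eq_zero_of_lt_degree hK (by rw [hdn]; omega)] at h2
    push_cast at h2
    omega

/-- A divisor class of degree `g` contains an effective non-special divisor if and only if its
residual class, of degree `g - 2`, contains no effective divisor. -/
theorem exists_effective_nonSpecial_iff
    (hK : ∀ x : F, IsAlgebraic K x → x ∈ Set.range (algebraMap K F)) :
    (∃ D : Divisor K F, 0 ≤ D ∧ degree K F D = genus K F ∧ IsNonSpecial D) ↔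
      ∃ D : Divisor K F, degree K F D = genus K F - 2 ∧ dim D = 0 := by
  obtain ⟨W, hW⟩ := exists_isCanonical K F
  have hdW := degree_canonical hK hW
  constructor
  · rintro ⟨D, _, hD, hns⟩
    refine ⟨W - D, by rw [map_sub, hD, hdW]; ring, ?_⟩
    rw [← index_eq_dim_sub hW, isNonSpecial_iff.1 hns]
  · rintro ⟨D, hD, hD0⟩
    have hi : index (W - D) = 0 := by rw [index_eq_dim_sub hW, sub_sub_cancel, hD0]
    have hd : degree K F (W - D) = genus K F := by rw [map_sub, hD, hdW]; ring
    have h1 := dim_eq_add_index (W - D)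
    rw [hi, hd] at h1
    have hpos : 0 < dim (W - D) := by
      zify
      push_cast at h1
      linarith
    obtain ⟨x, hx, hE⟩ := exists_principalDivisor_add_nonneg hpos
    refine ⟨_, hE, by rw [map_add, degree_principalDivisor, add_zero, hd], ?_⟩
    rw [isNonSpecial_iff, index_add_principalDivisor _ hx, hi]

variable [Finite K]

theorem exists_degree_eq (hK : ∀ x : F, IsAlgebraic K x → x ∈ Set.range (algebraMap K F))
    (n : ℤ) : ∃ D : Divisor K F, degree K F D = n := by
  obtain ⟨D, hD⟩ := exists_degree_eq_one hK
  exact ⟨n • D, by rw [map_zsmul, hD, smul_eq_mul, mul_one]⟩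

theorem card_classOfDegree_eq (hK : ∀ x : F, IsAlgebraic K x → x ∈ Set.range (algebraMap K F))
    (n : ℤ) : Nat.card (ClassOfDegree K F n) = classNumber K F := by
  obtain ⟨D, hD⟩ := exists_degree_eq hK n
  exact card_classOfDegree D hD

/-- Otherwise each of the `h` classes of degree `n` would contain an effective divisor. That there
are `h` classes, and not none, is Schmidt's theorem. -/
theorem exists_dim_eq_zero_of_numEffective_lt
    (hK : ∀ x : F, IsAlgebraic K x → x ∈ Set.range (algebraMap K F)) {n : ℤ}
    (h : numEffective K F n < classNumber K F) :
    ∃ D : Divisor K F, degree K F D = n ∧ dim D = 0 := by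
  by_contra! hc
  have h1 := card_mul_le_numEffective (K := K) (F := F) (n := n) (m := 1) fun D hD => by
    have := exists_effective_of_dim_pos (Nat.pos_of_ne_zero (hc D hD))
    exact Nat.card_pos
  rw [card_classOfDegree_eq hK, mul_one] at h1
  exact h1.not_gt h

/-- Every class of degree `g` has an effective member by Riemann–Roch. If all of these are special,
each class has dimension at least `2`, hence at least `(q² - 1) / (q - 1) = q + 1` effective
divisors. -/
theorem exists_effective_nonSpecial_of_numEffective_lt
    (hK : ∀ x : F, IsAlgebraic K x → x ∈ Set.range (algebraMap K F))
    (h : numEffective K F (genus K F) < classNumber K F * (Nat.card K + 1)) :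
    ∃ D : Divisor K F, 0 ≤ D ∧ degree K F D = genus K F ∧ IsNonSpecial D := by
  by_contra! hc
  refine h.not_ge ?_
  rw [← card_classOfDegree_eq hK (genus K F)]
  refine card_mul_le_numEffective fun D hD => ?_
  have h1 := dim_eq_add_index D
  rw [hD] at h1
  obtain ⟨x, hx, hE⟩ := exists_principalDivisor_add_nonneg
    (D := D) (by zify; linarith [Int.natCast_nonneg (index D)])
  have h2 := hc _ hE (by rw [map_add, degree_principalDivisor, add_zero, hD])
  rw [isNonSpecial_iff, index_add_principalDivisor D hx] at h2
  have h3 : 2 ≤ dim D := by omega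
  have h4 := pow_dim_le_card_effectiveInClass hK D
  have hq : 1 < Nat.card K := Finite.one_lt_card
  set N := Nat.card (EffectiveInClass (QuotientAddGroup.mk D : DivisorClassGroup K F))
  have h5 : Nat.card K ^ 2 ≤ N * (Nat.card K - 1) + 1 :=
    (Nat.pow_le_pow_right (by omega) h3).trans h4
  obtain ⟨r, hr⟩ : ∃ r, Nat.card K = r + 2 := ⟨Nat.card K - 2, by omega⟩
  rw [hr] at h5 ⊢
  rw [show r + 2 - 1 = r + 1 by omega] at h5
  by_contra hlt
  have h6 : N ≤ r + 2 := by omega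
  nlinarith [Nat.mul_le_mul_right (r + 1) h6]

/-- In degree `g - 2 ∈ {0, 1}` the map from effective divisors to classes is injective, so equal
finite cardinalities amount to surjectivity, that is, to the absence of a class of dimension `0`. -/
theorem not_exists_effective_nonSpecial_iff
    (hK : ∀ x : F, IsAlgebraic K x → x ∈ Set.range (algebraMap K F))
    (hg : genus K F = 2 ∨ genus K F = 3) :
    (¬ ∃ D : Divisor K F, 0 ≤ D ∧ degree K F D = genus K F ∧ IsNonSpecial D) ↔
      numEffective K F (genus K F - 2) = classNumber K F := by
  rw [exists_effective_nonSpecial_iff hK, ← card_classOfDegree_eq hK (genus K F - 2)]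
  set n := genus K F - 2 with hn
  let f : {D : Divisor K F // 0 ≤ D ∧ degree K F D = n} → ClassOfDegree K F n := fun D =>
    ⟨QuotientAddGroup.mk D.1, D.2.2⟩
  have hinj : Function.Injective f := fun D E h => Subtype.ext <|
    eq_of_effective_of_mk_eq hK (by omega) E.2.1 D.2.1 (by rw [E.2.2]; omega)
      (congrArg Subtype.val h)
  have hsurj : Function.Surjective f ↔ ¬ ∃ D : Divisor K F, degree K F D = n ∧ dim D = 0 := by
    constructor
    · rintro hs ⟨D, hD, hD0⟩
      obtain ⟨E, hE⟩ := hs ⟨QuotientAddGroup.mk D, hD⟩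
      have h1 := dim_eq_of_mk_eq (congrArg Subtype.val hE)
      have h2 := dim_pos_of_effective E.2.1
      omega
    · rintro h ⟨c, hc⟩
      obtain ⟨D, rfl⟩ := QuotientAddGroup.mk_surjective c
      obtain ⟨E⟩ := exists_effective_of_dim_pos
        (Nat.pos_of_ne_zero fun h0 => h ⟨D, hc, h0⟩)
      exact ⟨⟨E.1, E.2.1, by rw [← classDegree_mk, E.2.2, hc]⟩, Subtype.ext E.2.2⟩
  rw [← hsurj, numEffective]
  refine ⟨fun hs => Nat.card_congr (Equiv.ofBijective f ⟨hinj, hs⟩), fun h => ?_⟩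
  exact (hinj.bijective_of_nat_card_le h.ge).2

end NonSpecialDivisors

end AlgFunctionField

end

open AlgFunctionField in
theorem proposition3p2 (K F : Type*) [Field K] [Finite K] [Field F] [Algebra K F]
    [IsFunctionField K F]
    (hK : ∀ x : F, IsAlgebraic K x → x ∈ Set.range (algebraMap K F)) :
    (numEffective K F (genus K F) < classNumber K F * (Nat.card K + 1) →
      ∃ D : Divisor K F, 0 ≤ D ∧ degree K F D = genus K F ∧ IsNonSpecial D) ∧
    (numEffective K F (genus K F - 1) < classNumber K F →
      ∃ D : Divisor K F, degree K F D = genus K F - 1 ∧ IsNonSpecial D) ∧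
    (2 ≤ genus K F → numEffective K F (genus K F - 2) < classNumber K F →
      ∃ D : Divisor K F, 0 ≤ D ∧ degree K F D = genus K F ∧ IsNonSpecial D) ∧
    (genus K F = 2 ∨ genus K F = 3 →
      ((¬ ∃ D : Divisor K F, 0 ≤ D ∧ degree K F D = genus K F ∧ IsNonSpecial D) ↔
        numEffective K F (genus K F - 2) = classNumber K F)) := by
  refine ⟨exists_effective_nonSpecial_of_numEffective_lt hK, fun h => ?_, fun _ h => ?_,
    not_exists_effective_nonSpecial_iff hK⟩
  -- In degree `g - 1` Riemann–Roch reads `dim D = index D`.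
  · obtain ⟨D, hD, hD0⟩ := exists_dim_eq_zero_of_numEffective_lt hK h
    refine ⟨D, hD, isNonSpecial_iff.2 ?_⟩
    have h1 := dim_eq_add_index D
    rw [hD, hD0] at h1
    push_cast at h1
    omega
  · exact (exists_effective_nonSpecial_iff hK).2 (exists_dim_eq_zero_of_numEffective_lt hK h)
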